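/- **Notation.** Let $d,m,k\in\mathbb N$ with $m\ge 1$ and $1\le k\le 2m-1$. Let $A$ be a $d\times d$ integer matrix, all of whose eigenvalues are greater than $1$ in absolute value, and which is isotropic (diagonalizable over $\mathbb C$ with all eigenvalues of equal absolute value). Write $A^{-T}=(A^T)^{-1}$, let $A^{-T}=|\det A|^{-1/d}\,Q^{-1}UQ$ with $Q$ real symmetric positive definite and $U$ orthogonal, and put $W(\xi)=\xi^TQ^2\xi$. Let $S=\{s\in[0,1)^d: A^Ts\in\mathbb Z^d\}$. For a polynomial $P=\sum_a c_ax^a$ let $P(-iD)=\sum_a c_a(-i)^{|a|}D^a$, and write $\ker P(-iD)$ for the space of complex polynomials annihilated by $P(-iD)$. Let $X\neq0$ be a homogeneous polynomial of degree $k$ with complex coefficients. For $j\in\mathbb Z$ let ${}^jG$ be a trigonometric polynomial with complex coefficients such that ${}^jG(2\pi s)\ne0$ for all $s\in S\setminus\{0\}$ and $${}^jG\bigl((A^{-T})^j\xi\bigr)=C_j\bigl(X(\xi)+W(\xi)^m\bigr)+O(|\xi|^{2m+1}),\qquad \xi\to0,$$ with constants $C_j\in\mathbb C\setminus\{0\}$,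 and define the masks $${}^jm_0(\xi)=\prod_{s\in S\setminus\{0\}}\frac{{}^jG(\xi+2\pi s)}{{}^jG(2\pi s)}.$$ Let ${}^n\phi$, $n\in\mathbb Z$, be the corresponding nonstationary elliptic scaling functions, that is, compactly supported tempered distributions on $\mathbb R^d$ whose Fourier transforms $\widehat f(\xi)=(2\pi)^{-d/2}\langle f,e^{-i\xi\cdot x}\rangle$ are the (convergent) products ${}^n\widehat\phi(\xi)=\prod_{j\ge1}{}^{n+j}m_0\bigl((A^{-T})^j\xi\bigr)$, $\xi\in\mathbb R^d$; put $\phi={}^0\phi$. Let $\mathcal V_\phi$ be the space of all complex polynomials $P$ of the form $P=\sum_{n\in\mathbb Z^d}c_n\phi(\cdot-n)$ with arbitrary coefficients $c_n\in\mathbb C$. A space of polynomials is called shift-invariant if it contains with $P$ all $P(\cdot+h)$, $h\in\mathbb R^d$, and scale-invariant if it contains with $P$ all $P(t\,\cdot)$, $t>0$. **Theorem.** Suppose that some polynomial lies in $\ker X(-iD)$ but not in $\ker W(-iD)^m$. Then: 1. $\mathcal V_\phi$ is shift-invariant, and $\phi$ reproduces a polynomial space that is shift-invariant but not scale-invariant,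 i.e. $\mathcal V_\phi$ contains such a subspace. 2. $\mathcal V_\phi$ itself is not scale-invariant, provided that ${}^j\widehat\phi(2\pi A^{-T}n)\ne0$ for some $j\ge1$ and some $n\in\mathbb Z^d$ with $A^{-T}n\notin\mathbb Z^d$. (This proviso holds, for instance, if every ${}^jG$, $j\ge 1$, vanishes only on $2\pi\mathbb Z^d$ and $\sum_{j\ge1}|1-{}^{n+j}m_0((A^{-T})^j\xi)|<\infty$ for all $n\ge 1$ and $\xi\in\mathbb R^d$.) 3. If $X=i^kY$ with a real polynomial $Y$, so that the operator $X(-iD)$ has real coefficients, then 1 and 2 hold as well for the real vector space of all polynomials with real coefficients in $\mathcal V_\phi$ instead of $\mathcal V_\phi$ (and for real subspaces of it). -/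

import Mathlib

open scoped SchwartzMap Topology
open Filter Distribution

noncomputable section

namespace EllipticScaling

variable {d : ℕ}

/-! ### Polynomials, constant coefficient operators, invariance -/

/-- The partial derivative `D^a = D_1^{a_1} ⋯ D_d^{a_d}` on polynomials. -/
def partialD (a : Fin d →₀ ℕ) : Module.End ℂ (MvPolynomial (Fin d) ℂ) :=
  ((List.finRange d).map fun i => (MvPolynomial.pderiv i).toLinearMap ^ a i).prod

/-- The operator `P(-iD)` with symbol `P`, acting on polynomials:
if `P = ∑ c_a x^a`, it is `∑ c_a (-i)^{|a|} D^a`. -/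
def symbolOp (P : MvPolynomial (Fin d) ℂ) : Module.End ℂ (MvPolynomial (Fin d) ℂ) :=
  ∑ a ∈ P.support, (P.coeff a * (-Complex.I) ^ (∑ i, a i)) • partialD a

/-- Invariance under all real shifts `P ↦ P(· + h)`. -/
def IsShiftInvariant {𝕜 : Type*} [Field 𝕜] [Algebra ℝ 𝕜]
    (V : Submodule 𝕜 (MvPolynomial (Fin d) 𝕜)) : Prop :=
  ∀ P ∈ V, ∀ h : Fin d → ℝ,
    MvPolynomial.bind₁ (fun i => MvPolynomial.X i + MvPolynomial.C (algebraMap ℝ 𝕜 (h i))) P ∈ V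

/-- Invariance under all dilations `P ↦ P(t ·)`, `t > 0`. -/
def IsScaleInvariant {𝕜 : Type*} [Field 𝕜] [Algebra ℝ 𝕜]
    (V : Submodule 𝕜 (MvPolynomial (Fin d) 𝕜)) : Prop :=
  ∀ P ∈ V, ∀ t : ℝ, 0 < t →
    MvPolynomial.bind₁ (fun i => MvPolynomial.C (algebraMap ℝ 𝕜 t) * MvPolynomial.X i) P ∈ V

/-- The value of a complex polynomial at a real point. -/
def evalReal (P : MvPolynomial (Fin d) ℂ) (x : EuclideanSpace ℝ (Fin d)) : ℂ :=
  MvPolynomial.eval (fun i => (x i : ℂ)) P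

/-! ### Matrices -/

/-- The linear action of a real matrix on `ℝ^d`. -/
def act (M : Matrix (Fin d) (Fin d) ℝ) (x : EuclideanSpace ℝ (Fin d)) :
    EuclideanSpace ℝ (Fin d) :=
  WithLp.toLp 2 (M.mulVec x.ofLp)

/-- An integer matrix regarded as a real one. -/
def toReal (A : Matrix (Fin d) (Fin d) ℤ) : Matrix (Fin d) (Fin d) ℝ := A.map (fun n => (n : ℝ))

/-- A dilation matrix: integer entries, all eigenvalues greater than `1` in absolute value. -/
def IsDilationMatrix (A : Matrix (Fin d) (Fin d) ℤ) : Prop :=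
  ∀ z ∈ spectrum ℂ (A.map (fun n => (n : ℂ))), 1 < ‖z‖

/-- An isotropic matrix: diagonalizable over `ℂ`, with all eigenvalues equal in absolute value. -/
def IsIsotropic (M : Matrix (Fin d) (Fin d) ℝ) : Prop :=
  (∃ (T : Matrix (Fin d) (Fin d) ℂ) (v : Fin d → ℂ), IsUnit T.det ∧
    M.map (fun x => (x : ℂ)) = T * Matrix.diagonal v * T⁻¹) ∧
  ∃ r : ℝ, ∀ z ∈ spectrum ℂ (M.map (fun x => (x : ℂ))), ‖z‖ = r

/-- The matrix `A^{-T}`, i.e. the inverse of the transpose. -/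
def invT (A : Matrix (Fin d) (Fin d) ℤ) : Matrix (Fin d) (Fin d) ℝ := (toReal A).transpose⁻¹

/-- The quadratic form `W(x) = xᵀ Q² x`, as a polynomial. -/
def quadPoly (Q : Matrix (Fin d) (Fin d) ℝ) : MvPolynomial (Fin d) ℂ :=
  ∑ i, ∑ j, MvPolynomial.C (((Q * Q) i j : ℝ) : ℂ) * MvPolynomial.X i * MvPolynomial.X j

/-- An integer vector regarded as a point of `ℝ^d`. -/
def latticePt (n : Fin d → ℤ) : EuclideanSpace ℝ (Fin d) := WithLp.toLp 2 fun i => (n i : ℝ)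

/-- The set `S(M)` of the points `s ∈ [0,1)^d` with `M s ∈ ℤ^d`. -/
def cosetPoints (M : Matrix (Fin d) (Fin d) ℤ) : Set (EuclideanSpace ℝ (Fin d)) :=
  {s | (∀ i, s i ∈ Set.Ico (0 : ℝ) 1) ∧ ∃ n : Fin d → ℤ, act (toReal M) s = latticePt n}

theorem finite_cosetPoints (M : Matrix (Fin d) (Fin d) ℤ) (h : (toReal M).det ≠ 0) :
    (cosetPoints M).Finite := by
  have hinj : Function.Injective (act (toReal M)) := by
    intro x y hxy
    have := Matrix.mulVec_injective_of_isUnit ((Matrix.isUnit_iff_isUnit_det _).2 h.isUnit)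
    have e : (toReal M).mulVec x.ofLp = (toReal M).mulVec y.ofLp := by
      simpa [act] using hxy
    exact WithLp.ofLp_injective 2 (this e)
  have hlat : (latticePt '' (Set.Icc (fun i => -(∑ j, |M i j|)) (fun i => ∑ j, |M i j|)) :
      Set (EuclideanSpace ℝ (Fin d))).Finite := (Set.finite_Icc _ _).image _
  refine (hlat.preimage hinj.injOn).subset ?_
  rintro s ⟨hs, n, hn⟩
  refine ⟨n, ?_, hn.symm⟩
  have key : ∀ i, |(n i : ℝ)| ≤ ∑ j, |(M i j : ℝ)| := by
    intro i
    have : (n i : ℝ) = ∑ j, (M i j : ℝ) * s j := by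
      have := congrArg (fun v : EuclideanSpace ℝ (Fin d) => v i) hn
      simpa [act, latticePt, toReal, Matrix.mulVec, dotProduct] using this.symm
    rw [this]
    refine (Finset.abs_sum_le_sum_abs _ _).trans (Finset.sum_le_sum fun j _ => ?_)
    rw [abs_mul]
    have := hs j
    have h1 : |s j| ≤ 1 := by rw [abs_le]; constructor <;> linarith [this.1, this.2]
    nlinarith [abs_nonneg (M i j : ℝ)]
  constructor <;> intro i <;> have := abs_le.1 (key i) <;> simp only
  · exact_mod_cast this.1
  · exact_mod_cast this.2

/-! ### Trigonometric polynomials and masks -/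

/-- Trigonometric polynomials `∑ c_n e^{i n·ξ}` (finite sums, `n ∈ ℤ^d`), by their coefficients. -/
abbrev TrigPoly (d : ℕ) := (Fin d → ℤ) →₀ ℂ

/-- The value of a trigonometric polynomial. -/
def trigEval (G : TrigPoly d) (ξ : EuclideanSpace ℝ (Fin d)) : ℂ :=
  G.sum fun n c => c * Complex.exp (Complex.I * ((∑ i, (n i : ℝ) * ξ i : ℝ) : ℂ))

/-- The mask `m₀(ξ) = ∏ G(ξ + 2πs) / ∏ G(2πs)`, both products over `s ∈ S(Aᵀ) \ {0}`
(a finite set, since a dilation matrix is invertible). -/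
def mask (A : Matrix (Fin d) (Fin d) ℤ) (G : TrigPoly d) (ξ : EuclideanSpace ℝ (Fin d)) : ℂ :=
  (∏ᶠ s ∈ cosetPoints A.transpose \ {0}, trigEval G (ξ + (2 * Real.pi) • s)) /
    ∏ᶠ s ∈ cosetPoints A.transpose \ {0}, trigEval G ((2 * Real.pi) • s)

/-! ### Compactly supported distributions and their integer shifts -/

/-- `g` is the Fourier transform of the compactly supported distribution `f`, i.e. the function
`g(ξ) = (2π)^{-d/2} ⟨f, e^{-iξ·x}⟩`. As usual the exponential may be replaced by any compactly
supported smooth function that agrees with it near the support of `f`. -/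
def IsFourierTransform (f : 𝓢'(EuclideanSpace ℝ (Fin d), ℂ))
    (g : EuclideanSpace ℝ (Fin d) → ℂ) : Prop :=
  ∀ (ξ : EuclideanSpace ℝ (Fin d)) (ψ : 𝓢(EuclideanSpace ℝ (Fin d), ℂ)), HasCompactSupport ψ →
    (∀ᶠ x in 𝓝ˢ (dsupport f), ψ x = Complex.exp (-Complex.I * ((∑ i, ξ i * x i : ℝ) : ℂ))) →
    g ξ = (((2 * Real.pi) ^ (-(d : ℝ) / 2) : ℝ) : ℂ) * f ψ

/-- The nonstationary scaling functions `ⁿφ`, `n ∈ ℤ`, for the dilation matrix `A` and the masks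
`ʲm₀`: compactly supported distributions whose Fourier transforms are
`ⁿφ̂(ξ) = ∏_{j ≥ 1} ⁿ⁺ʲm₀((A^{-T})^j ξ)`. -/
structure IsNonstationaryScaling (A : Matrix (Fin d) (Fin d) ℤ)
    (m₀ : ℤ → EuclideanSpace ℝ (Fin d) → ℂ)
    (φ : ℤ → 𝓢'(EuclideanSpace ℝ (Fin d), ℂ))
    (φhat : ℤ → EuclideanSpace ℝ (Fin d) → ℂ) : Prop where
  compact_support : ∀ n, IsCompact (dsupport (φ n))
  fourier : ∀ n, IsFourierTransform (φ n) (φhat n)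
  product : ∀ n ξ, Tendsto
    (fun N : ℕ => ∏ j ∈ Finset.Icc 1 N, m₀ (n + j) (act (invT A ^ j) ξ)) atTop (𝓝 (φhat n ξ))

/-- The tails of the infinite product do not all vanish at the points where this would raise the
multiplicity of the zeros of `⁰φ̂` on `2πℤ^d \ {0}`: for some `j ≥ 1` and some `n ∈ ℤ^d` with
`A^{-T} n ∉ ℤ^d` one has `ʲφ̂(2π A^{-T} n) ≠ 0`. -/
def HasNonvanishingTail (A : Matrix (Fin d) (Fin d) ℤ)
    (φhat : ℤ → EuclideanSpace ℝ (Fin d) → ℂ) : Prop :=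
  ∃ (j : ℤ) (n : Fin d → ℤ), 1 ≤ j ∧ (∀ l, act (invT A) (latticePt n) ≠ latticePt l) ∧
    φhat j ((2 * Real.pi) • act (invT A) (latticePt n)) ≠ 0

/-- The identity `P = ∑_k c_k f(· - k)` of distributions on `ℝ^d`, for some coefficients `c_k`,
`k ∈ ℤ^d`. The support of `f` being compact, the sum is finite on every test function. -/
def IsReproduced (f : 𝓢'(EuclideanSpace ℝ (Fin d), ℂ)) (P : MvPolynomial (Fin d) ℂ) : Prop :=
  ∃ c : (Fin d → ℤ) → ℂ, ∀ ψ : 𝓢(EuclideanSpace ℝ (Fin d), ℂ), HasCompactSupport ψ →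
    HasSum (fun k => c k * f (SchwartzMap.compSubConstCLM ℂ (-latticePt k) ψ))
      (∫ x, evalReal P x * ψ x)

theorem integrable_evalReal_mul (P : MvPolynomial (Fin d) ℂ)
    (ψ : 𝓢(EuclideanSpace ℝ (Fin d), ℂ)) (hψ : HasCompactSupport ψ) :
    MeasureTheory.Integrable (fun x => evalReal P x * ψ x) := by
  have h1 : Continuous (evalReal P) := by
    unfold evalReal
    exact (MvPolynomial.continuous_eval P).comp (by fun_prop)
  exact (h1.mul ψ.continuous).integrable_of_hasCompactSupport hψ.mul_left

/-- The space of all polynomials in the span of the integer shifts of `f`. -/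
def reproduced (f : 𝓢'(EuclideanSpace ℝ (Fin d), ℂ)) :
    Submodule ℂ (MvPolynomial (Fin d) ℂ) where
  carrier := {P | IsReproduced f P}
  zero_mem' := ⟨0, fun ψ _ => by simp [evalReal]⟩
  add_mem' := by
    rintro P R ⟨c, hc⟩ ⟨e, he⟩
    refine ⟨c + e, fun ψ hψ => ?_⟩
    have h := (hc ψ hψ).add (he ψ hψ)
    rw [← MeasureTheory.integral_add (integrable_evalReal_mul P ψ hψ)
      (integrable_evalReal_mul R ψ hψ)] at h
    convert h using 2
    · simp [add_mul]
    · simp [evalReal, add_mul]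
  smul_mem' := by
    rintro a P ⟨c, hc⟩
    refine ⟨a • c, fun ψ hψ => ?_⟩
    have h := (hc ψ hψ).mul_left a
    have e : ∫ x, evalReal (a • P) x * ψ x = a * ∫ x, evalReal P x * ψ x := by
      rw [← MeasureTheory.integral_const_mul]
      simp [evalReal, mul_assoc]
    have e' : (fun k => (a • c) k * f (SchwartzMap.compSubConstCLM ℂ (-latticePt k) ψ)) =
        fun k => a * (c k * f (SchwartzMap.compSubConstCLM ℂ (-latticePt k) ψ)) := by
      funext k
      simp [mul_assoc]
    rw [e, e']
    exact h

/-- The space of all polynomials with real coefficients in the span of the integer shifts. -/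
def reproducedReal (f : 𝓢'(EuclideanSpace ℝ (Fin d), ℂ)) :
    Submodule ℝ (MvPolynomial (Fin d) ℝ) :=
  ((reproduced f).restrictScalars ℝ).comap
    (MvPolynomial.mapAlgHom (Algebra.ofId ℝ ℂ)).toLinearMap

end EllipticScaling

end

/-! The argument has an analytic and an algebraic half, joined by the symbol `X + W ^ m`.

Zeros of the Fourier transform. Let `n ≠ 0` be an integer vector. Since `A^{-T}` is a multiple `ρ <
1` of an isometry for the norm `‖Q x‖`, the points `(A^{-T})^l n` tend to `0` without reaching it,
so they leave the lattice at some first index `j + 1`. At that point the mask of index `j + 1`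
contains the factor `G_{j+1}`, evaluated at `(A^{-T})^{j+1} η`, whose expansion is a multiple of `X
+ W ^ m`. The earlier masks are periodic and only contribute their values near `0`. Hence `φ̂(2πn +
η) = (X + W ^ m)(η) H(η) + O(|η|^{2m+1})` (`exists_hasJet_fourier`), where `H(0) ≠ 0` if the tail of
the product does not vanish there.

Reproduction. By a Strang–Fix argument based on Poisson summation (`isReproduced_of_hasJet`), every
polynomial of degree at most `2m` annihilated by `(X + W ^ m)(-iD)` is reproduced. Conversely, if
the Taylor polynomial of `φ̂` at some `2πn`, `n ≠ 0`, taken as a symbol, maps a polynomial to a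
nonzero constant, that polynomial is not reproduced (`not_isReproduced_of_hasJet`): otherwise a
nonconstant plane wave would be a polynomial.

Algebra. From a polynomial in the kernel of `X(-iD)` but not of `W(-iD)^m` one obtains a form `P''`
of degree `2m` with `X(-iD) P'' = 0` and `W(-iD)^m P'' = c ≠ 0`. A form `R` of degree `k < 2m` with
`X(-iD) R = -c` satisfies `W(-iD)^m R = 0`, so `S = P'' + R` solves the full equation while its
component `R` does not (`exists_inhomogeneous_solution`). A scale-invariant space contains the
homogeneous components of its elements, so the shift-invariant space of reproduced solutions is not
scale-invariant. If the tail condition holds, `R` is not even reproduced, and the whole space fails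
to be scale-invariant. When the operator has real coefficients, the conjugate of `S` is again a
solution, and the real and imaginary parts of `S` carry the argument over to real polynomials. -/

open scoped ContDiff

noncomputable section

namespace EllipticScaling

variable {d : ℕ}

/-! ### Constant coefficient operators on polynomials -/

/-- The multi-index factorial. -/
def multiFactorial (b : Fin d →₀ ℕ) : ℂ := ∏ i, ((b i).factorial : ℂ)

theorem multiFactorial_ne_zero (b : Fin d →₀ ℕ) : multiFactorial b ≠ 0 :=
  Finset.prod_ne_zero_iff.2 fun i _ => by exact_mod_cast (b i).factorial_ne_zero

theorem multiFactorial_zero : multiFactorial (0 : Fin d →₀ ℕ) = 1 := by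
  simp [multiFactorial]

/-- The coefficient of a polynomial with respect to the divided powers `x^b / b!`. -/
def dcoeff (b : Fin d →₀ ℕ) (p : MvPolynomial (Fin d) ℂ) : ℂ := multiFactorial b * p.coeff b

theorem dcoeff_ext {p q : MvPolynomial (Fin d) ℂ} (h : ∀ b, dcoeff b p = dcoeff b q) : p = q := by
  ext b
  exact mul_left_cancel₀ (multiFactorial_ne_zero b) (h b)

theorem multiFactorial_add_single (b : Fin d →₀ ℕ) (i : Fin d) :
    multiFactorial (b + Finsupp.single i 1) = multiFactorial b * (b i + 1) := by
  unfold multiFactorial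
  rw [← Finset.mul_prod_erase _ _ (Finset.mem_univ i),
    ← Finset.mul_prod_erase _ (fun j => ((b j).factorial : ℂ)) (Finset.mem_univ i)]
  have : ∏ x ∈ Finset.univ.erase i, (((b + Finsupp.single i 1 : Fin d →₀ ℕ) x).factorial : ℂ) =
      ∏ x ∈ Finset.univ.erase i, ((b x).factorial : ℂ) := by
    refine Finset.prod_congr rfl fun j hj => ?_
    rw [Finsupp.add_apply, Finsupp.single_eq_of_ne (Finset.ne_of_mem_erase hj), add_zero]
  rw [this]
  simp only [Finsupp.add_apply, Finsupp.single_eq_same, Nat.factorial_succ]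
  push_cast
  ring

/-- This is the purpose of divided powers: differentiation becomes a pure shift of the index, and
identities between operators reduce to addition of multi-indices. -/
theorem dcoeff_pderiv (b : Fin d →₀ ℕ) (i : Fin d) (p : MvPolynomial (Fin d) ℂ) :
    dcoeff b (MvPolynomial.pderiv i p) = dcoeff (b + Finsupp.single i 1) p := by
  unfold dcoeff
  rw [MvPolynomial.coeff_pderiv, multiFactorial_add_single]
  ring

theorem dcoeff_pderiv_pow (i : Fin d) (n : ℕ) (b : Fin d →₀ ℕ) (p : MvPolynomial (Fin d) ℂ) :
    dcoeff b (((MvPolynomial.pderiv i).toLinearMap ^ n) p) =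
      dcoeff (b + Finsupp.single i n) p := by
  induction n generalizing b with
  | zero => simp
  | succ n ih =>
    rw [pow_succ', Module.End.mul_apply]
    change dcoeff b (MvPolynomial.pderiv i _) = _
    rw [dcoeff_pderiv, ih, add_assoc, ← Finsupp.single_add, add_comm 1 n]

theorem dcoeff_list_prod (l : List (Fin d)) (a b : Fin d →₀ ℕ) (p : MvPolynomial (Fin d) ℂ) :
    dcoeff b ((l.map fun i => (MvPolynomial.pderiv i).toLinearMap ^ a i).prod p) =
      dcoeff (b + (l.map fun i => Finsupp.single i (a i)).sum) p := by
  induction l generalizing b with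
  | nil => simp
  | cons i l ih =>
    rw [List.map_cons, List.prod_cons, Module.End.mul_apply, dcoeff_pderiv_pow, ih,
      List.map_cons, List.sum_cons, add_assoc]

theorem dcoeff_partialD (a b : Fin d →₀ ℕ) (p : MvPolynomial (Fin d) ℂ) :
    dcoeff b (partialD a p) = dcoeff (a + b) p := by
  have : ((List.finRange d).map fun i => Finsupp.single i (a i)).sum = a := by
    rw [← Fin.sum_univ_def]
    ext j
    simp
  rw [partialD, dcoeff_list_prod, this, add_comm]

theorem partialD_add (a b : Fin d →₀ ℕ) (p : MvPolynomial (Fin d) ℂ) :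
    partialD (a + b) p = partialD a (partialD b p) :=
  dcoeff_ext fun c => by simp only [dcoeff_partialD]; congr 1; abel

theorem symbolOp_eq_sum {P : MvPolynomial (Fin d) ℂ} {s : Finset (Fin d →₀ ℕ)}
    (hs : P.support ⊆ s) :
    symbolOp P = ∑ a ∈ s, (P.coeff a * (-Complex.I) ^ (∑ i, a i)) • partialD a := by
  refine Finset.sum_subset hs fun a _ ha => ?_
  rw [MvPolynomial.notMem_support_iff.1 ha, zero_mul, zero_smul]

theorem symbolOp_add (P R : MvPolynomial (Fin d) ℂ) :
    symbolOp (P + R) = symbolOp P + symbolOp R := by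
  classical
  rw [symbolOp_eq_sum (P := P + R) (s := P.support ∪ R.support) MvPolynomial.support_add,
    symbolOp_eq_sum (P := P) Finset.subset_union_left,
    symbolOp_eq_sum (P := R) Finset.subset_union_right, ← Finset.sum_add_distrib]
  refine Finset.sum_congr rfl fun a _ => ?_
  rw [MvPolynomial.coeff_add, add_mul, add_smul]

theorem symbolOp_monomial (a : Fin d →₀ ℕ) (c : ℂ) :
    symbolOp (MvPolynomial.monomial a c) = (c * (-Complex.I) ^ (∑ i, a i)) • partialD a := by
  classical
  rw [symbolOp_eq_sum (s := {a}) MvPolynomial.support_monomial_subset]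
  simp

theorem symbolOp_C (c : ℂ) (p : MvPolynomial (Fin d) ℂ) :
    symbolOp (MvPolynomial.C c) p = c • p := by
  rw [MvPolynomial.C_apply, symbolOp_monomial]
  have : partialD (0 : Fin d →₀ ℕ) p = p := dcoeff_ext fun b => by simp [dcoeff_partialD]
  simp [this]

theorem symbolOp_one (p : MvPolynomial (Fin d) ℂ) : symbolOp 1 p = p := by
  simpa using symbolOp_C 1 p

/-- Multiplicativity makes all the operators commute and lets Taylor polynomials of products act as
compositions. -/
theorem symbolOp_mul (P R p : MvPolynomial (Fin d) ℂ) :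
    symbolOp (P * R) p = symbolOp P (symbolOp R p) := by
  induction P using MvPolynomial.induction_on' with
  | monomial a c =>
    induction R using MvPolynomial.induction_on' with
    | monomial b e =>
      simp only [MvPolynomial.monomial_mul, symbolOp_monomial, LinearMap.smul_apply, map_smul,
        partialD_add, smul_smul, Finsupp.add_apply, Finset.sum_add_distrib, pow_add]
      congr 1
      ring
    | add R₁ R₂ h₁ h₂ => simp only [mul_add, symbolOp_add, LinearMap.add_apply, map_add, h₁, h₂]
  | add P₁ P₂ h₁ h₂ => simp only [add_mul, symbolOp_add, LinearMap.add_apply, h₁, h₂]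

theorem symbolOp_comm (P R p : MvPolynomial (Fin d) ℂ) :
    symbolOp P (symbolOp R p) = symbolOp R (symbolOp P p) := by
  rw [← symbolOp_mul, mul_comm, symbolOp_mul]

theorem symbolOp_neg (P p : MvPolynomial (Fin d) ℂ) : symbolOp (-P) p = -symbolOp P p := by
  rw [← neg_one_mul, symbolOp_mul, show (-1 : MvPolynomial (Fin d) ℂ) = MvPolynomial.C (-1) by simp,
    symbolOp_C, neg_one_smul]

theorem symbolOp_sub (P R p : MvPolynomial (Fin d) ℂ) :
    symbolOp (P - R) p = symbolOp P p - symbolOp R p := by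
  rw [sub_eq_add_neg, symbolOp_add, LinearMap.add_apply, symbolOp_neg, sub_eq_add_neg]

theorem symbolOp_pow (P p : MvPolynomial (Fin d) ℂ) (n : ℕ) :
    symbolOp (P ^ n) p = (symbolOp P ^ n) p := by
  induction n with
  | zero => simp [symbolOp_one]
  | succ n ih => rw [pow_succ', symbolOp_mul, ih, pow_succ', Module.End.mul_apply]

theorem dcoeff_smul (b : Fin d →₀ ℕ) (c : ℂ) (p : MvPolynomial (Fin d) ℂ) :
    dcoeff b (c • p) = c * dcoeff b p := by
  simp [dcoeff, mul_left_comm]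

theorem dcoeff_sum {ι : Type*} (s : Finset ι) (f : ι → MvPolynomial (Fin d) ℂ) (b : Fin d →₀ ℕ) :
    dcoeff b (∑ i ∈ s, f i) = ∑ i ∈ s, dcoeff b (f i) := by
  simp [dcoeff, MvPolynomial.coeff_sum, Finset.mul_sum]

theorem dcoeff_symbolOp (T p : MvPolynomial (Fin d) ℂ) (b : Fin d →₀ ℕ) :
    dcoeff b (symbolOp T p) =
      ∑ a ∈ T.support, T.coeff a * (-Complex.I) ^ a.degree * dcoeff (a + b) p := by
  rw [symbolOp, LinearMap.sum_apply, dcoeff_sum]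
  refine Finset.sum_congr rfl fun a _ => ?_
  rw [LinearMap.smul_apply, dcoeff_smul, dcoeff_partialD, Finsupp.degree_eq_sum]

/-- A symbol without terms of degree at most `r` annihilates the polynomials of degree at most
`r`. -/
theorem symbolOp_eq_zero_of_coeff {r : ℕ} {T p : MvPolynomial (Fin d) ℂ}
    (hT : ∀ a : Fin d →₀ ℕ, a.degree ≤ r → T.coeff a = 0) (hp : p.totalDegree ≤ r) :
    symbolOp T p = 0 := by
  refine dcoeff_ext fun b => ?_
  rw [dcoeff_symbolOp]
  trans 0
  · refine Finset.sum_eq_zero fun a _ => ?_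
    by_cases ha : a.degree ≤ r
    · rw [hT a ha]; ring
    · have : p.coeff (a + b) = 0 := by
        refine MvPolynomial.coeff_eq_zero_of_totalDegree_lt ?_
        have h1 : (a + b).degree = ∑ i ∈ (a + b).support, (a + b) i := rfl
        rw [← h1, map_add]
        omega
      simp [dcoeff, this]
  · simp [dcoeff]

theorem symbolOp_congr {r : ℕ} {T T' p : MvPolynomial (Fin d) ℂ}
    (hT : ∀ a : Fin d →₀ ℕ, a.degree ≤ r → T.coeff a = T'.coeff a) (hp : p.totalDegree ≤ r) :
    symbolOp T p = symbolOp T' p := by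
  rw [← sub_eq_zero, ← symbolOp_sub]
  exact symbolOp_eq_zero_of_coeff (fun a ha => by simp [hT a ha]) hp

theorem _root_.MvPolynomial.IsHomogeneous.degree_eq_of_coeff {k : ℕ}
    {F : MvPolynomial (Fin d) ℂ} (hF : F.IsHomogeneous k) {a : Fin d →₀ ℕ} (ha : F.coeff a ≠ 0) :
    a.degree = k := by
  rw [Finsupp.degree_eq_weight_one]
  exact hF ha

/-- A homogeneous symbol lowers every degree by exactly `k`, so an equation for the operator can be
read off degree by degree. -/
theorem homogeneousComponent_symbolOp {k : ℕ} {F : MvPolynomial (Fin d) ℂ}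
    (hF : F.IsHomogeneous k) (n : ℕ) (p : MvPolynomial (Fin d) ℂ) :
    MvPolynomial.homogeneousComponent n (symbolOp F p) =
      symbolOp F (MvPolynomial.homogeneousComponent (k + n) p) := by
  refine dcoeff_ext fun b => ?_
  have key : ∀ (l : ℕ) (q : MvPolynomial (Fin d) ℂ) (c : Fin d →₀ ℕ),
      dcoeff c (MvPolynomial.homogeneousComponent l q) =
        if c.degree = l then dcoeff c q else 0 := by
    intro l q c
    simp only [dcoeff, MvPolynomial.coeff_homogeneousComponent]
    split_ifs <;> simp
  rw [key, dcoeff_symbolOp, dcoeff_symbolOp]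
  by_cases hb : b.degree = n
  · rw [if_pos hb]
    refine Finset.sum_congr rfl fun a ha => ?_
    have : a.degree = k := hF.degree_eq_of_coeff (MvPolynomial.mem_support_iff.1 ha)
    rw [key, if_pos (by rw [map_add]; omega)]
  · rw [if_neg hb]
    symm
    refine Finset.sum_eq_zero fun a ha => ?_
    have : a.degree = k := hF.degree_eq_of_coeff (MvPolynomial.mem_support_iff.1 ha)
    rw [key, if_neg (by rw [map_add]; omega), mul_zero]

/-- A homogeneous symbol annihilates the homogeneous polynomials of smaller degree. -/
theorem symbolOp_eq_zero_of_lt {k n : ℕ} {F : MvPolynomial (Fin d) ℂ}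
    (hF : F.IsHomogeneous k) {p : MvPolynomial (Fin d) ℂ} (hp : p.totalDegree ≤ n) (h : n < k) :
    symbolOp F p = 0 := by
  refine symbolOp_eq_zero_of_coeff (r := n) (fun a ha => ?_) hp
  by_contra hc
  have : a.degree = k := hF.degree_eq_of_coeff hc
  omega

theorem coeff_zero_symbolOp_monomial (T : MvPolynomial (Fin d) ℂ) (b : Fin d →₀ ℕ) (c : ℂ) :
    (symbolOp T (MvPolynomial.monomial b c)).coeff 0 =
      T.coeff b * (-Complex.I) ^ b.degree * (multiFactorial b * c) := by
  classical
  have h : dcoeff 0 (symbolOp T (MvPolynomial.monomial b c)) =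
      (symbolOp T (MvPolynomial.monomial b c)).coeff 0 := by
    rw [dcoeff, multiFactorial_zero, one_mul]
  rw [← h, dcoeff_symbolOp, Finset.sum_eq_single b]
  · simp [dcoeff]
  · intro a _ hab
    rw [dcoeff, add_zero, MvPolynomial.coeff_monomial, if_neg (Ne.symm hab)]
    ring
  · intro hb
    rw [MvPolynomial.notMem_support_iff.1 hb]
    ring

/-! ### Shifts and dilations -/

/-- The shift `P ↦ P(· + h)`. -/
abbrev shiftHom {𝕜 : Type*} [Field 𝕜] (h : Fin d → 𝕜) :
    MvPolynomial (Fin d) 𝕜 →ₐ[𝕜] MvPolynomial (Fin d) 𝕜 :=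
  MvPolynomial.bind₁ fun i => MvPolynomial.X i + MvPolynomial.C (h i)

theorem eval_shiftHom {𝕜 : Type*} [Field 𝕜] (h x : Fin d → 𝕜) (p : MvPolynomial (Fin d) 𝕜) :
    MvPolynomial.eval x (shiftHom h p) = MvPolynomial.eval (x + h) p := by
  induction p using MvPolynomial.induction_on with
  | C a => simp
  | add p q hp hq => simp only [map_add, hp, hq]
  | mul_X p i hp => simp [hp]

theorem pderiv_shiftHom {𝕜 : Type*} [Field 𝕜] (h : Fin d → 𝕜) (i : Fin d)
    (p : MvPolynomial (Fin d) 𝕜) :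
    MvPolynomial.pderiv i (shiftHom h p) = shiftHom h (MvPolynomial.pderiv i p) := by
  classical
  induction p using MvPolynomial.induction_on with
  | C a => simp
  | add p q hp hq => simp only [map_add, hp, hq]
  | mul_X p j hp =>
    rw [map_mul, MvPolynomial.pderiv_mul, MvPolynomial.pderiv_mul, map_add, map_mul, map_mul, hp]
    simp only [MvPolynomial.bind₁_X_right, map_add, MvPolynomial.pderiv_C, add_zero,
      MvPolynomial.pderiv_X]
    congr 2
    rcases eq_or_ne j i with rfl | hij
    · simp
    · simp [hij.symm]

theorem partialD_shiftHom (h : Fin d → ℂ) (a : Fin d →₀ ℕ) (p : MvPolynomial (Fin d) ℂ) :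
    partialD a (shiftHom h p) = shiftHom h (partialD a p) := by
  have hpow : ∀ (i : Fin d) (n : ℕ) (q : MvPolynomial (Fin d) ℂ),
      ((MvPolynomial.pderiv i).toLinearMap ^ n) (shiftHom h q) =
        shiftHom h (((MvPolynomial.pderiv i).toLinearMap ^ n) q) := by
    intro i n
    induction n with
    | zero => simp
    | succ n ih =>
      intro q
      rw [pow_succ, Module.End.mul_apply, Module.End.mul_apply]
      change ((MvPolynomial.pderiv i).toLinearMap ^ n) (MvPolynomial.pderiv i (shiftHom h q)) = _
      rw [pderiv_shiftHom, ih]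
      rfl
  unfold partialD
  induction List.finRange d generalizing p with
  | nil => simp
  | cons i l ih =>
    rw [List.map_cons, List.prod_cons, Module.End.mul_apply, ih, hpow, Module.End.mul_apply]

theorem symbolOp_shiftHom (T : MvPolynomial (Fin d) ℂ) (h : Fin d → ℂ)
    (p : MvPolynomial (Fin d) ℂ) : symbolOp T (shiftHom h p) = shiftHom h (symbolOp T p) := by
  simp only [symbolOp, LinearMap.sum_apply, LinearMap.smul_apply, map_sum, map_smul,
    partialD_shiftHom]

/-! ### Shift invariance from integer shifts; homogeneous components from scale invariance. -/

section Invariance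

variable {𝕜 : Type*} [Field 𝕜]

/-- The coefficients of `P(· + h)` are polynomials in `h`. The functional varies in the induction
because a new factor `x_i` is absorbed into it. -/
theorem exists_eval_eq_functional_shift (P : MvPolynomial (Fin d) 𝕜)
    (l : MvPolynomial (Fin d) 𝕜 →ₗ[𝕜] 𝕜) :
    ∃ L : MvPolynomial (Fin d) 𝕜, ∀ h, l (shiftHom h P) = MvPolynomial.eval h L := by
  induction P using MvPolynomial.induction_on generalizing l with
  | C a => exact ⟨MvPolynomial.C (l (MvPolynomial.C a)), fun h => by simp⟩
  | add p q hp hq =>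
    obtain ⟨L, hL⟩ := hp l
    obtain ⟨M, hM⟩ := hq l
    exact ⟨L + M, fun h => by simp only [map_add, hL, hM]⟩
  | mul_X p i hp =>
    obtain ⟨L, hL⟩ := hp l
    obtain ⟨M, hM⟩ := hp (l ∘ₗ LinearMap.mulRight 𝕜 (MvPolynomial.X i))
    refine ⟨M + MvPolynomial.X i * L, fun h => ?_⟩
    have hM' : l (shiftHom h p * MvPolynomial.X i) = MvPolynomial.eval h M := hM h
    rw [map_mul, MvPolynomial.bind₁_X_right, mul_add, map_add, hM', mul_comm (shiftHom h p)
      (MvPolynomial.C (h i)), ← MvPolynomial.smul_eq_C_mul, map_smul, hL]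
    simp

/-- Testing membership with functionals turns it into the vanishing of a polynomial in the shift or
dilation parameter, which is then decided on an infinite set. -/
theorem mem_of_forall_functional {V : Submodule 𝕜 (MvPolynomial (Fin d) 𝕜)}
    {P : MvPolynomial (Fin d) 𝕜}
    (h : ∀ l : MvPolynomial (Fin d) 𝕜 →ₗ[𝕜] 𝕜, (∀ p ∈ V, l p = 0) → l P = 0) : P ∈ V := by
  by_contra hP
  obtain ⟨l, hl, hV⟩ := Submodule.exists_le_ker_of_notMem hP
  exact hl (h l fun p hp => hV hp)

theorem coeff_bind₁_C_mul_X (t : 𝕜) (P : MvPolynomial (Fin d) 𝕜) (b : Fin d →₀ ℕ) :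
    (MvPolynomial.bind₁ (fun i => MvPolynomial.C t * MvPolynomial.X i) P).coeff b =
      t ^ b.degree * P.coeff b := by
  classical
  induction P using MvPolynomial.induction_on' with
  | monomial a c =>
    have : MvPolynomial.bind₁ (fun i => MvPolynomial.C t * MvPolynomial.X i)
        (MvPolynomial.monomial a c) = MvPolynomial.monomial a (t ^ a.degree * c) := by
      rw [MvPolynomial.bind₁_monomial]
      simp only [mul_pow, Finset.prod_mul_distrib]
      rw [Finset.prod_pow_eq_pow_sum, MvPolynomial.monomial_eq (s := a), Finsupp.prod,
        Finsupp.degree_apply, map_mul, map_pow]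
      ring
    rw [this, MvPolynomial.coeff_monomial, MvPolynomial.coeff_monomial]
    split_ifs with h
    · rw [h]
    · simp
  | add p q hp hq => rw [map_add, MvPolynomial.coeff_add, hp, hq, MvPolynomial.coeff_add, mul_add]

theorem bind₁_C_mul_X_eq_sum (t : 𝕜) (P : MvPolynomial (Fin d) 𝕜) :
    MvPolynomial.bind₁ (fun i => MvPolynomial.C t * MvPolynomial.X i) P =
      ∑ l ∈ Finset.range (P.totalDegree + 1), t ^ l • MvPolynomial.homogeneousComponent l P := by
  ext b
  rw [coeff_bind₁_C_mul_X]
  simp only [MvPolynomial.coeff_sum, MvPolynomial.coeff_smul,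
    MvPolynomial.coeff_homogeneousComponent, smul_eq_mul, mul_ite, mul_zero]
  rw [Finset.sum_ite_eq]
  split_ifs with h
  · rfl
  · rw [MvPolynomial.coeff_eq_zero_of_totalDegree_lt, mul_zero]
    rw [Finset.mem_range, not_lt] at h
    change P.totalDegree < b.degree
    omega

variable [Algebra ℝ 𝕜]

/-- A subspace of polynomials that is invariant under integer shifts is invariant under all real
shifts. -/
theorem isShiftInvariant_of_int {V : Submodule 𝕜 (MvPolynomial (Fin d) 𝕜)}
    (hV : ∀ P ∈ V, ∀ n : Fin d → ℤ, shiftHom (fun i => algebraMap ℝ 𝕜 (n i)) P ∈ V) :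
    IsShiftInvariant V := by
  intro P hP h
  refine mem_of_forall_functional fun l hl => ?_
  obtain ⟨L, hL⟩ := exists_eval_eq_functional_shift P l
  have hinj : Function.Injective fun n : ℤ => algebraMap ℝ 𝕜 (n : ℝ) :=
    (algebraMap ℝ 𝕜).injective.comp Int.cast_injective
  have : L = 0 := by
    -- The integer points form a product of infinite sets, on which only the zero polynomial
    -- vanishes.
    refine MvPolynomial.funext_set (fun _ => Set.range fun n : ℤ => algebraMap ℝ 𝕜 (n : ℝ))
      (fun _ => Set.infinite_range_of_injective hinj) fun x hx => ?_
    choose n hn using fun i => hx i (Set.mem_univ i)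
    have hxn : x = fun i => algebraMap ℝ 𝕜 (n i) := funext fun i => (hn i).symm
    rw [hxn, ← hL, map_zero]
    exact hl _ (hV P hP n)
  have h2 := hL fun i => algebraMap ℝ 𝕜 (h i)
  rw [this, map_zero] at h2
  exact h2

/-- A scale-invariant space of polynomials contains the homogeneous components of its
elements. -/
theorem IsScaleInvariant.homogeneousComponent_mem
    {V : Submodule 𝕜 (MvPolynomial (Fin d) 𝕜)} (hV : IsScaleInvariant V)
    {P : MvPolynomial (Fin d) 𝕜} (hP : P ∈ V) (k : ℕ) :
    MvPolynomial.homogeneousComponent k P ∈ V := by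
  by_cases hk : P.totalDegree < k
  · rw [MvPolynomial.homogeneousComponent_eq_zero _ _ hk]
    exact V.zero_mem
  refine mem_of_forall_functional fun l hl => ?_
  -- `q` is `t ↦ l(P(t ·))`. It vanishes for all `t > 0`, hence identically, and its coefficient at
  -- `t ^ k` is the value wanted.
  set q : Polynomial 𝕜 := ∑ j ∈ Finset.range (P.totalDegree + 1),
    Polynomial.monomial j (l (MvPolynomial.homogeneousComponent j P)) with hq
  have hq0 : q = 0 := by
    refine Polynomial.eq_zero_of_infinite_isRoot q
      (((Set.Ioi_infinite (0 : ℝ)).image (algebraMap ℝ 𝕜).injective.injOn).mono ?_)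
    rintro _ ⟨t, ht, rfl⟩
    have := hl _ (hV P hP t ht)
    rw [bind₁_C_mul_X_eq_sum] at this
    simp only [map_sum, map_smul, smul_eq_mul] at this
    simp only [Set.mem_ofPred_eq, Polynomial.IsRoot, hq, Polynomial.eval_finsetSum,
      Polynomial.eval_monomial]
    rw [← this]
    exact Finset.sum_congr rfl fun j _ => mul_comm _ _
  have h1 : q.coeff k = l (MvPolynomial.homogeneousComponent k P) := by
    simp only [hq, Polynomial.finsetSum_coeff, Polynomial.coeff_monomial]
    rw [Finset.sum_ite_eq', if_pos (Finset.mem_range.2 (by omega))]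
  rw [← h1, hq0, Polynomial.coeff_zero]

end Invariance

/-! ### Solutions with a nontrivial homogeneous component -/

theorem dcoeff_zero_eq (p : MvPolynomial (Fin d) ℂ) : dcoeff 0 p = p.coeff 0 := by
  rw [dcoeff, multiFactorial_zero, one_mul]

theorem symbolOp_eq_C_of_homogeneous {k : ℕ} {F p : MvPolynomial (Fin d) ℂ}
    (hF : F.IsHomogeneous k) (hp : p.IsHomogeneous k) :
    symbolOp F p = MvPolynomial.C ((symbolOp F p).coeff 0) := by
  have h := homogeneousComponent_symbolOp hF 0 p
  rw [add_zero, MvPolynomial.homogeneousComponent_eq_self hp,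
    MvPolynomial.homogeneousComponent_zero] at h
  exact h.symm

/-- If some polynomial is annihilated by `X(-iD)` but not by `F(-iD)`, with `X` of smaller degree,
then `X(-iD) + F(-iD)` annihilates a polynomial whose homogeneous component of degree `deg X` is
not annihilated by `X(-iD)`. -/
theorem exists_inhomogeneous_solution {k r : ℕ} (hkr : k < r) {X F : MvPolynomial (Fin d) ℂ}
    (hX : X.IsHomogeneous k) (hX0 : X ≠ 0) (hF : F.IsHomogeneous r)
    {P : MvPolynomial (Fin d) ℂ} (hXP : symbolOp X P = 0) (hFP : symbolOp F P ≠ 0) :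
    ∃ S : MvPolynomial (Fin d) ℂ, S.totalDegree ≤ r ∧ symbolOp (X + F) S = 0 ∧
      ∃ c : ℂ, c ≠ 0 ∧
        symbolOp X (MvPolynomial.homogeneousComponent k S) = MvPolynomial.C c ∧
        symbolOp (X + F) (MvPolynomial.homogeneousComponent k S) = MvPolynomial.C c := by
  obtain ⟨b, hb⟩ := MvPolynomial.ne_zero_iff.1 hFP
  -- Differentiating along `b` moves a nonzero coefficient of `F(-iD) P` to the constant term;
  -- `X(-iD)` still annihilates the result, as the operators commute.
  set P' := symbolOp (MvPolynomial.monomial b 1) P with hP'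
  have hXP' : symbolOp X P' = 0 := by rw [hP', symbolOp_comm, hXP, map_zero]
  set c := (symbolOp F P').coeff 0 with hc
  have hc0 : c ≠ 0 := by
    rw [hc, ← dcoeff_zero_eq, hP', symbolOp_comm, symbolOp_monomial, LinearMap.smul_apply,
      dcoeff_smul, dcoeff_partialD, add_zero, dcoeff]
    refine mul_ne_zero (mul_ne_zero one_ne_zero (pow_ne_zero _ (neg_ne_zero.2 Complex.I_ne_zero)))
      (mul_ne_zero (multiFactorial_ne_zero b) hb)
  set P'' := MvPolynomial.homogeneousComponent r P' with hP''
  have hP''h : P''.IsHomogeneous r := MvPolynomial.homogeneousComponent_isHomogeneous _ _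
  have hXP'' : symbolOp X P'' = 0 := by
    have := homogeneousComponent_symbolOp hX (r - k) P'
    rw [show k + (r - k) = r by omega, hXP', map_zero] at this
    exact this.symm
  have hFP'' : symbolOp F P'' = MvPolynomial.C c := by
    have := homogeneousComponent_symbolOp hF 0 P'
    rw [add_zero, MvPolynomial.homogeneousComponent_zero] at this
    exact this.symm
  obtain ⟨a, ha⟩ := MvPolynomial.ne_zero_iff.1 hX0
  set e := X.coeff a * (-Complex.I) ^ a.degree * multiFactorial a with he
  have he0 : e ≠ 0 := mul_ne_zero (mul_ne_zero ha
    (pow_ne_zero _ (neg_ne_zero.2 Complex.I_ne_zero))) (multiFactorial_ne_zero a)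
  -- One monomial of `X` is enough: on forms of degree `k` the operator `X(-iD)` takes constant
  -- values, and the factor `-c / e` makes this value `-c`.
  set R := MvPolynomial.monomial a (-c / e) with hR
  have hRh : R.IsHomogeneous k := MvPolynomial.isHomogeneous_monomial _ (hX.degree_eq_of_coeff ha)
  have hXR : symbolOp X R = MvPolynomial.C (-c) := by
    rw [symbolOp_eq_C_of_homogeneous hX hRh, hR, coeff_zero_symbolOp_monomial]
    congr 1
    rw [← mul_assoc, ← he]
    field_simp
  have hFR : symbolOp F R = 0 := symbolOp_eq_zero_of_lt hF hRh.totalDegree_le hkr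
  have hcomp : MvPolynomial.homogeneousComponent k (P'' + R) = R := by
    rw [map_add, MvPolynomial.homogeneousComponent_eq_self hRh,
      MvPolynomial.homogeneousComponent_of_mem hP''h, if_neg hkr.ne, zero_add]
  refine ⟨P'' + R, ?_, ?_, -c, neg_ne_zero.2 hc0, ?_, ?_⟩
  · exact (MvPolynomial.totalDegree_add _ _).trans
      (max_le hP''h.totalDegree_le (hRh.totalDegree_le.trans hkr.le))
  · rw [symbolOp_add, LinearMap.add_apply, map_add, map_add, hXP'', hFP'', hXR, hFR]
    simp
  · rw [hcomp, hXR]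
  · rw [hcomp, symbolOp_add, LinearMap.add_apply, hXR, hFR, add_zero]

/-! ### Operators with real coefficients -/

/-- The hypothesis says that the coefficients of the operator, with the powers of `-i` included, are
real; these differ from the coefficients of the symbol. -/
theorem symbolOp_map_conj {T : MvPolynomial (Fin d) ℂ}
    (hT : ∀ a : Fin d →₀ ℕ, (starRingEnd ℂ) (T.coeff a * (-Complex.I) ^ a.degree) =
      T.coeff a * (-Complex.I) ^ a.degree) (p : MvPolynomial (Fin d) ℂ) :
    symbolOp T (MvPolynomial.map (starRingEnd ℂ) p) =
      MvPolynomial.map (starRingEnd ℂ) (symbolOp T p) := by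
  have key : ∀ (b : Fin d →₀ ℕ) (q : MvPolynomial (Fin d) ℂ),
      dcoeff b (MvPolynomial.map (starRingEnd ℂ) q) = (starRingEnd ℂ) (dcoeff b q) := by
    intro b q
    rw [dcoeff, dcoeff, MvPolynomial.coeff_map, map_mul]
    congr 1
    simp [multiFactorial, map_prod]
  refine dcoeff_ext fun b => ?_
  rw [key, dcoeff_symbolOp, dcoeff_symbolOp, map_sum]
  refine Finset.sum_congr rfl fun a _ => ?_
  rw [map_mul, hT, key]

/-- By homogeneity the same power `(-i)^k` multiplies all coefficients, so only `z (-i)^k` has to be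
real. The two uses are `z = 1` with even degree, for `W ^ m`, and `z = i ^ k`, for `X`. -/
theorem conj_coeff_of_isHomogeneous {k : ℕ} {Y : MvPolynomial (Fin d) ℝ}
    {T : MvPolynomial (Fin d) ℂ} (hT : T.IsHomogeneous k) {z : ℂ}
    (hz : (starRingEnd ℂ) (z * (-Complex.I) ^ k) = z * (-Complex.I) ^ k)
    (hTY : T = MvPolynomial.C z * MvPolynomial.map Complex.ofRealHom Y) (a : Fin d →₀ ℕ) :
    (starRingEnd ℂ) (T.coeff a * (-Complex.I) ^ a.degree) =
      T.coeff a * (-Complex.I) ^ a.degree := by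
  by_cases ha : T.coeff a = 0
  · simp [ha]
  rw [hT.degree_eq_of_coeff ha, hTY, MvPolynomial.coeff_C_mul, MvPolynomial.coeff_map,
    mul_right_comm, map_mul, hz]
  simp

theorem exists_map_add_I_smul_map (S : MvPolynomial (Fin d) ℂ) :
    ∃ a b : MvPolynomial (Fin d) ℝ, S = MvPolynomial.map Complex.ofRealHom a +
      Complex.I • MvPolynomial.map Complex.ofRealHom b := by
  induction S using MvPolynomial.induction_on' with
  | monomial a c =>
    refine ⟨MvPolynomial.monomial a c.re, MvPolynomial.monomial a c.im, ?_⟩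
    rw [MvPolynomial.map_monomial, MvPolynomial.map_monomial, MvPolynomial.smul_monomial,
      ← map_add]
    congr 1
    simp [mul_comm Complex.I]
  | add p q hp hq =>
    obtain ⟨a, b, rfl⟩ := hp
    obtain ⟨a', b', rfl⟩ := hq
    refine ⟨a + a', b + b', ?_⟩
    rw [map_add, map_add, smul_add]
    abel

/-- The real and imaginary parts of a polynomial lie in every complex space that contains it and
its conjugate. -/
theorem exists_real_parts_mem {V : Submodule ℂ (MvPolynomial (Fin d) ℂ)}
    {S : MvPolynomial (Fin d) ℂ} (hS : S ∈ V) (hS' : MvPolynomial.map (starRingEnd ℂ) S ∈ V) :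
    ∃ a b : MvPolynomial (Fin d) ℝ, MvPolynomial.map Complex.ofRealHom a ∈ V ∧
      MvPolynomial.map Complex.ofRealHom b ∈ V ∧ S = MvPolynomial.map Complex.ofRealHom a +
        Complex.I • MvPolynomial.map Complex.ofRealHom b := by
  obtain ⟨a, b, rfl⟩ := exists_map_add_I_smul_map S
  have e : MvPolynomial.map (starRingEnd ℂ) (MvPolynomial.map Complex.ofRealHom a +
      Complex.I • MvPolynomial.map Complex.ofRealHom b) = MvPolynomial.map Complex.ofRealHom a -
      Complex.I • MvPolynomial.map Complex.ofRealHom b := by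
    ext x
    simp [MvPolynomial.coeff_map, sub_eq_add_neg]
  rw [e] at hS'
  refine ⟨a, b, ?_, ?_, rfl⟩
  · convert V.smul_mem (1 / 2 : ℂ) (V.add_mem hS hS') using 1
    module
  · convert V.smul_mem (-Complex.I / 2 : ℂ) (V.sub_mem hS hS') using 1
    ext x
    simp only [MvPolynomial.coeff_smul, MvPolynomial.coeff_sub, MvPolynomial.coeff_add, smul_eq_mul]
    linear_combination (MvPolynomial.coeff x (MvPolynomial.map Complex.ofRealHom b)) *
      Complex.I_mul_I

theorem isHomogeneous_quadPoly (Q : Matrix (Fin d) (Fin d) ℝ) : (quadPoly Q).IsHomogeneous 2 := by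
  refine MvPolynomial.IsHomogeneous.sum _ _ _ fun i _ => MvPolynomial.IsHomogeneous.sum _ _ _
    fun j _ => ?_
  have := ((MvPolynomial.isHomogeneous_C (Fin d) (((Q * Q) i j : ℝ) : ℂ)).mul
    (MvPolynomial.isHomogeneous_X ℂ i)).mul (MvPolynomial.isHomogeneous_X ℂ j)
  simpa using this

theorem quadPoly_eq_map (Q : Matrix (Fin d) (Fin d) ℝ) :
    quadPoly Q = MvPolynomial.map Complex.ofRealHom (∑ i, ∑ j,
      MvPolynomial.C ((Q * Q) i j) * MvPolynomial.X i * MvPolynomial.X j) := by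
  simp [quadPoly, map_sum]

theorem symbolOp_quadPoly_pow_map_conj (Q : Matrix (Fin d) (Fin d) ℝ) (m : ℕ)
    (p : MvPolynomial (Fin d) ℂ) :
    symbolOp (quadPoly Q ^ m) (MvPolynomial.map (starRingEnd ℂ) p) =
      MvPolynomial.map (starRingEnd ℂ) (symbolOp (quadPoly Q ^ m) p) := by
  refine symbolOp_map_conj (conj_coeff_of_isHomogeneous ((isHomogeneous_quadPoly Q).pow m)
    (z := 1) ?_ (Y := (∑ i, ∑ j,
      MvPolynomial.C ((Q * Q) i j) * MvPolynomial.X i * MvPolynomial.X j) ^ m) ?_) p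
  · rw [one_mul, pow_mul]
    simp
  · rw [map_one, one_mul, quadPoly_eq_map, map_pow]

theorem symbolOp_I_pow_map_conj {k : ℕ} {X : MvPolynomial (Fin d) ℂ} (hX : X.IsHomogeneous k)
    {Y : MvPolynomial (Fin d) ℝ}
    (hXY : X = MvPolynomial.C (Complex.I ^ k) * MvPolynomial.map Complex.ofRealHom Y)
    (p : MvPolynomial (Fin d) ℂ) :
    symbolOp X (MvPolynomial.map (starRingEnd ℂ) p) =
      MvPolynomial.map (starRingEnd ℂ) (symbolOp X p) := by
  refine symbolOp_map_conj (conj_coeff_of_isHomogeneous hX ?_ hXY) p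
  rw [← mul_pow]
  simp

/-! ### Polynomial expansions at the origin -/

theorem evalReal_add (P R : MvPolynomial (Fin d) ℂ) (x : EuclideanSpace ℝ (Fin d)) :
    evalReal (P + R) x = evalReal P x + evalReal R x := map_add _ _ _

theorem evalReal_sub (P R : MvPolynomial (Fin d) ℂ) (x : EuclideanSpace ℝ (Fin d)) :
    evalReal (P - R) x = evalReal P x - evalReal R x := map_sub _ _ _

theorem evalReal_mul (P R : MvPolynomial (Fin d) ℂ) (x : EuclideanSpace ℝ (Fin d)) :
    evalReal (P * R) x = evalReal P x * evalReal R x := map_mul _ _ _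

theorem evalReal_pow (P : MvPolynomial (Fin d) ℂ) (n : ℕ) (x : EuclideanSpace ℝ (Fin d)) :
    evalReal (P ^ n) x = evalReal P x ^ n := map_pow _ _ _

theorem evalReal_C (c : ℂ) (x : EuclideanSpace ℝ (Fin d)) :
    evalReal (MvPolynomial.C c) x = c := MvPolynomial.eval_C _

theorem evalReal_X (i : Fin d) (x : EuclideanSpace ℝ (Fin d)) :
    evalReal (MvPolynomial.X i) x = x i := MvPolynomial.eval_X _

theorem evalReal_one (x : EuclideanSpace ℝ (Fin d)) :
    evalReal (1 : MvPolynomial (Fin d) ℂ) x = 1 := map_one _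

theorem evalReal_sum {ι : Type*} (s : Finset ι) (P : ι → MvPolynomial (Fin d) ℂ)
    (x : EuclideanSpace ℝ (Fin d)) : evalReal (∑ i ∈ s, P i) x = ∑ i ∈ s, evalReal (P i) x :=
  map_sum _ _ _

theorem evalReal_zero_right (P : MvPolynomial (Fin d) ℂ) : evalReal P 0 = P.coeff 0 := by
  have : (fun i : Fin d => (((0 : EuclideanSpace ℝ (Fin d)) i : ℝ) : ℂ)) = 0 := by
    ext i; simp
  rw [evalReal, this, ← MvPolynomial.constantCoeff_eq, MvPolynomial.constantCoeff]
  simp [MvPolynomial.constantCoeff]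

theorem differentiable_evalReal (P : MvPolynomial (Fin d) ℂ) : Differentiable ℝ (evalReal P) := by
  induction P using MvPolynomial.induction_on with
  | C a =>
    have : evalReal (MvPolynomial.C a : MvPolynomial (Fin d) ℂ) = fun _ => a :=
      funext (evalReal_C a)
    rw [this]
    fun_prop
  | add p q hp hq =>
    have : evalReal (p + q) = fun x => evalReal p x + evalReal q x := funext (evalReal_add p q)
    rw [this]
    fun_prop
  | mul_X p i hp =>
    have : evalReal (p * MvPolynomial.X i) = fun x => evalReal p x * Complex.ofRealCLM (x i) :=
      funext fun x => by rw [evalReal_mul, evalReal_X]; rfl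
    rw [this]
    fun_prop

theorem continuous_evalReal (P : MvPolynomial (Fin d) ℂ) : Continuous (evalReal P) :=
  (differentiable_evalReal P).continuous

theorem evalReal_isBigO_one (P : MvPolynomial (Fin d) ℂ) :
    evalReal P =O[𝓝 0] (fun _ => (1 : ℝ)) :=
  (continuous_evalReal P).continuousAt.norm.isBoundedUnder_le.isBigO_one ℝ

theorem evalReal_isBigO_norm {P : MvPolynomial (Fin d) ℂ} (hP : P.coeff 0 = 0) :
    evalReal P =O[𝓝 0] fun ξ => ‖ξ‖ := by
  have := (differentiable_evalReal P).differentiableAt (x := 0) |>.isBigO_sub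
  rw [evalReal_zero_right, hP] at this
  simpa using this.norm_right

/-- `f` agrees with the polynomial `T` up to terms of order `r + 1` at the origin. -/
def HasJet (r : ℕ) (f : EuclideanSpace ℝ (Fin d) → ℂ) (T : MvPolynomial (Fin d) ℂ) : Prop :=
  (fun ξ => f ξ - evalReal T ξ) =O[𝓝 0] fun ξ => ‖ξ‖ ^ (r + 1)

theorem isBigO_norm_pow_one (n : ℕ) :
    (fun ξ : EuclideanSpace ℝ (Fin d) => ‖ξ‖ ^ n) =O[𝓝 0] (fun _ => (1 : ℝ)) := by
  have : Continuous fun ξ : EuclideanSpace ℝ (Fin d) => ‖ξ‖ ^ n := by fun_prop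
  exact this.continuousAt.norm.isBoundedUnder_le.isBigO_one ℝ

theorem isBigO_norm_pow_of_le {m n : ℕ} (h : m ≤ n) :
    (fun ξ : EuclideanSpace ℝ (Fin d) => ‖ξ‖ ^ n) =O[𝓝 0] fun ξ => ‖ξ‖ ^ m := by
  have := (isBigO_norm_pow_one (d := d) (n - m)).mul
    (Asymptotics.isBigO_refl (fun ξ : EuclideanSpace ℝ (Fin d) => ‖ξ‖ ^ m) (𝓝 0))
  simpa [← pow_add, Nat.sub_add_cancel h] using this

namespace HasJet

variable {r : ℕ} {f g : EuclideanSpace ℝ (Fin d) → ℂ} {S T : MvPolynomial (Fin d) ℂ}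

theorem const (r : ℕ) (c : ℂ) :
    HasJet (d := d) r (fun _ => c) (MvPolynomial.C c) := by
  simpa [HasJet, evalReal_C] using Asymptotics.isBigO_zero _ _

theorem mono {r' : ℕ} (h : HasJet r f T) (hr : r' ≤ r) : HasJet r' f T :=
  h.trans (isBigO_norm_pow_of_le (by omega))

theorem congr' (h : HasJet r f T) (hfg : f =ᶠ[𝓝 0] g) : HasJet r g T :=
  Asymptotics.IsBigO.congr' h (hfg.mono fun ξ hξ => by simp only [hξ]) EventuallyEq.rfl

theorem isBigO_one (h : HasJet r f T) : f =O[𝓝 0] (fun _ => (1 : ℝ)) := by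
  have := (Asymptotics.IsBigO.trans h (isBigO_norm_pow_one _)).add (evalReal_isBigO_one T)
  simpa using this

theorem add (hf : HasJet r f S) (hg : HasJet r g T) :
    HasJet r (fun ξ => f ξ + g ξ) (S + T) := by
  refine (Asymptotics.IsBigO.add hf hg).congr_left fun ξ => ?_
  rw [evalReal_add]
  ring

theorem mul (hf : HasJet r f S) (hg : HasJet r g T) :
    HasJet r (fun ξ => f ξ * g ξ) (S * T) := by
  have h1 := Asymptotics.IsBigO.mul hf hg.isBigO_one
  have h2 := Asymptotics.IsBigO.mul (evalReal_isBigO_one S) hg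
  simp only [mul_one, one_mul] at h1 h2
  refine (h1.add h2).congr_left fun ξ => ?_
  rw [evalReal_mul]
  ring

theorem finset_sum {ι : Type*} (s : Finset ι) {f : ι → EuclideanSpace ℝ (Fin d) → ℂ}
    (h : ∀ i ∈ s, ∃ T, HasJet r (f i) T) : ∃ T, HasJet r (fun ξ => ∑ i ∈ s, f i ξ) T := by
  classical
  induction s using Finset.induction_on with
  | empty => exact ⟨_, by simpa using const r 0⟩
  | insert a s ha ih =>
    obtain ⟨T, hT⟩ := ih fun i hi => h i (Finset.mem_insert_of_mem hi)
    obtain ⟨S, hS⟩ := h a (Finset.mem_insert_self _ _)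
    exact ⟨S + T, by simpa [Finset.sum_insert ha] using hS.add hT⟩

theorem finset_prod {ι : Type*} (s : Finset ι) {f : ι → EuclideanSpace ℝ (Fin d) → ℂ}
    (h : ∀ i ∈ s, ∃ T, HasJet r (f i) T) : ∃ T, HasJet r (fun ξ => ∏ i ∈ s, f i ξ) T := by
  classical
  induction s using Finset.induction_on with
  | empty => exact ⟨_, by simpa using const r 1⟩
  | insert a s ha ih =>
    obtain ⟨T, hT⟩ := ih fun i hi => h i (Finset.mem_insert_of_mem hi)
    obtain ⟨S, hS⟩ := h a (Finset.mem_insert_self _ _)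
    exact ⟨S * T, by simpa [Finset.prod_insert ha] using hS.mul hT⟩

theorem apply_zero (h : HasJet r f T) : f 0 = T.coeff 0 := by
  obtain ⟨c, hc⟩ := Asymptotics.IsBigO.bound h
  -- The filter is not punctured, so the bound holds at the origin itself, where its right-hand side
  -- is `0`.
  have h0 := hc.self_of_nhds
  have : f 0 - evalReal T 0 = 0 := by simpa using h0
  rw [← evalReal_zero_right]
  exact sub_eq_zero.1 this

end HasJet

/-! ### Expansions under linear substitutions and exponentials. -/

theorem act_isBigO (M : Matrix (Fin d) (Fin d) ℝ) :
    act M =O[𝓝 0] fun ξ : EuclideanSpace ℝ (Fin d) => ξ := by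
  have : act M = (Matrix.toEuclideanLin M).toContinuousLinearMap := by
    ext x i
    simp [act, Matrix.toLpLin_apply]
  rw [this]
  exact ContinuousLinearMap.isBigO_id _ _

theorem continuous_act (M : Matrix (Fin d) (Fin d) ℝ) : Continuous (act M) := by
  have : act M = (Matrix.toEuclideanLin M).toContinuousLinearMap := by
    ext x i
    simp [act, Matrix.toLpLin_apply]
  rw [this]
  exact ContinuousLinearMap.continuous _

theorem act_zero (M : Matrix (Fin d) (Fin d) ℝ) : act M 0 = 0 := by
  ext i; simp [act]

theorem act_add (M : Matrix (Fin d) (Fin d) ℝ) (x y : EuclideanSpace ℝ (Fin d)) :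
    act M (x + y) = act M x + act M y := by
  ext i; simp [act, Matrix.mulVec_add]

theorem act_smul (M : Matrix (Fin d) (Fin d) ℝ) (c : ℝ) (x : EuclideanSpace ℝ (Fin d)) :
    act M (c • x) = c • act M x := by
  ext i; simp [act, Matrix.mulVec_smul]

theorem act_mul (M N : Matrix (Fin d) (Fin d) ℝ) (x : EuclideanSpace ℝ (Fin d)) :
    act (M * N) x = act M (act N x) := by
  ext i; simp [act]

theorem act_one (x : EuclideanSpace ℝ (Fin d)) : act (1 : Matrix (Fin d) (Fin d) ℝ) x = x := by
  ext i; simp [act]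

theorem HasJet.comp_act {r : ℕ} {f : EuclideanSpace ℝ (Fin d) → ℂ} {T : MvPolynomial (Fin d) ℂ}
    (h : HasJet r f T) (M : Matrix (Fin d) (Fin d) ℝ) :
    HasJet r (fun ξ => f (act M ξ)) (MvPolynomial.bind₁
      (fun i => ∑ j, MvPolynomial.C ((M i j : ℝ) : ℂ) * MvPolynomial.X j) T) := by
  have ht : Tendsto (act M) (𝓝 0) (𝓝 0) := by
    simpa [act_zero] using (continuous_act M).tendsto 0
  have h1 := Asymptotics.IsBigO.comp_tendsto h ht
  have h2 : (fun ξ => ‖act M ξ‖ ^ (r + 1)) =O[𝓝 0]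
      fun ξ : EuclideanSpace ℝ (Fin d) => ‖ξ‖ ^ (r + 1) :=
    (act_isBigO M).norm_norm.pow (r + 1)
  refine (h1.trans h2).congr_left fun ξ => ?_
  have : evalReal (MvPolynomial.bind₁
      (fun i => ∑ j, MvPolynomial.C ((M i j : ℝ) : ℂ) * MvPolynomial.X j) T) ξ =
      evalReal T (act M ξ) := by
    simp only [evalReal, MvPolynomial.eval, MvPolynomial.eval₂Hom_bind₁]
    congr 2
    ext i
    simp [act, Matrix.mulVec, dotProduct]
  rw [this]
  rfl

/-- Without constant term, `L = O(‖ξ‖)`, so the remainder of the exponential series after degree `r`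
has order `r + 1`. -/
theorem HasJet.exp (r : ℕ) {L : MvPolynomial (Fin d) ℂ} (hL : L.coeff 0 = 0) :
    ∃ T, HasJet r (fun ξ => Complex.exp (evalReal L ξ)) T := by
  refine ⟨∑ l ∈ Finset.range (r + 1), MvPolynomial.C ((l.factorial : ℂ)⁻¹) * L ^ l, ?_⟩
  have h1 : (fun ξ => Complex.exp (evalReal L ξ) -
      evalReal (∑ l ∈ Finset.range (r + 1), MvPolynomial.C ((l.factorial : ℂ)⁻¹) * L ^ l) ξ)
      =O[𝓝 0] fun ξ => ‖evalReal L ξ‖ ^ (r + 1) * Real.exp ‖evalReal L ξ‖ := by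
    refine Asymptotics.IsBigO.of_bound 1 (Eventually.of_forall fun ξ => ?_)
    rw [one_mul, Real.norm_of_nonneg (by positivity)]
    refine le_trans (le_of_eq ?_) (Complex.norm_exp_sub_sum_le_norm_mul_exp _ _)
    congr 2
    rw [evalReal_sum]
    refine Finset.sum_congr rfl fun l _ => ?_
    rw [evalReal_mul, evalReal_C, evalReal_pow]
    ring
  have h2 : (fun ξ : EuclideanSpace ℝ (Fin d) => Real.exp ‖evalReal L ξ‖) =O[𝓝 0]
      (fun _ => (1 : ℝ)) := by
    have : Continuous fun ξ : EuclideanSpace ℝ (Fin d) => Real.exp ‖evalReal L ξ‖ :=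
      Real.continuous_exp.comp (continuous_evalReal L).norm
    exact this.continuousAt.norm.isBoundedUnder_le.isBigO_one ℝ
  have h3 := ((evalReal_isBigO_norm hL).norm_left.pow (r + 1)).mul h2
  simp only [mul_one] at h3
  exact h1.trans h3

theorem evalReal_smul_eq_sum (T : MvPolynomial (Fin d) ℂ) (t : ℝ)
    (x : EuclideanSpace ℝ (Fin d)) :
    evalReal T (t • x) = ∑ l ∈ Finset.range (T.totalDegree + 1),
      (t : ℂ) ^ l * evalReal (MvPolynomial.homogeneousComponent l T) x := by
  have h := congrArg (fun P => evalReal P x) (bind₁_C_mul_X_eq_sum (t : ℂ) T)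
  rw [evalReal_sum] at h
  have h2 : evalReal (MvPolynomial.bind₁ (fun i => MvPolynomial.C (t : ℂ) * MvPolynomial.X i) T) x =
      evalReal T (t • x) := by
    simp only [evalReal, MvPolynomial.eval, MvPolynomial.eval₂Hom_bind₁]
    congr 2
    ext i
    simp
  rw [← h2, h]
  exact Finset.sum_congr rfl fun l _ => by rw [MvPolynomial.smul_eq_C_mul, evalReal_mul, evalReal_C]

/-! ### Uniqueness of expansions. -/

theorem eq_zero_of_evalReal {T : MvPolynomial (Fin d) ℂ} (h : ∀ x, evalReal T x = 0) : T = 0 := by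
  refine MvPolynomial.funext_set (fun _ => Set.range ((↑) : ℝ → ℂ))
    (fun _ => Set.infinite_range_of_injective Complex.ofReal_injective) fun x hx => ?_
  choose y hy using fun i => hx i (Set.mem_univ i)
  have := h (WithLp.toLp 2 y)
  rw [map_zero, ← this, evalReal]
  congr 2
  ext i
  exact (hy i).symm

/-- Factors are split off one at a time: after division by `X ^ l` with `l < n` the quotient is
`O(|t|^{n-l})` away from `0`, so by continuity it vanishes at `0`. -/
theorem X_pow_dvd_of_isBigO {q : Polynomial ℂ} {n : ℕ}
    (h : (fun t : ℝ => q.eval (t : ℂ)) =O[𝓝 0] fun t => t ^ n) : Polynomial.X ^ n ∣ q := by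
  suffices ∀ l ≤ n, Polynomial.X ^ l ∣ q from this n le_rfl
  intro l hl
  induction l with
  | zero => simp
  | succ l ih =>
    obtain ⟨s, rfl⟩ := ih (by omega)
    suffices s.coeff 0 = 0 by
      rw [pow_succ]
      exact mul_dvd_mul_left _ (Polynomial.X_dvd_iff.2 this)
    rw [Polynomial.coeff_zero_eq_eval_zero]
    have hcont : Continuous fun t : ℝ => s.eval (t : ℂ) :=
      s.continuous.comp Complex.continuous_ofReal
    have h1 : Tendsto (fun t : ℝ => s.eval (t : ℂ)) (𝓝[≠] 0) (𝓝 (s.eval 0)) := by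
      simpa using (hcont.tendsto 0).mono_left nhdsWithin_le_nhds
    have h2 : (fun t : ℝ => s.eval (t : ℂ)) =O[𝓝[≠] 0] fun t : ℝ => ‖t‖ ^ (n - l) := by
      have h3 := (h.mono nhdsWithin_le_nhds (l := 𝓝[≠] 0)).norm_right.mul
        (Asymptotics.isBigO_refl (fun t : ℝ => (((t : ℂ) ^ l)⁻¹)) (𝓝[≠] 0)).norm_right
      refine h3.congr' ?_ ?_
      · filter_upwards [self_mem_nhdsWithin] with t ht
        have : (t : ℂ) ≠ 0 := Complex.ofReal_ne_zero.2 ht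
        rw [Polynomial.eval_mul, Polynomial.eval_pow, Polynomial.eval_X]
        field_simp
      · filter_upwards [self_mem_nhdsWithin] with t ht
        have : ‖t‖ ≠ 0 := norm_ne_zero_iff.2 ht
        rw [norm_pow, norm_inv, norm_pow, Complex.norm_real, pow_sub₀ _ this (by omega)]
    have h3 : Tendsto (fun t : ℝ => ‖t‖ ^ (n - l)) (𝓝[≠] 0) (𝓝 0) := by
      have : Continuous fun t : ℝ => ‖t‖ ^ (n - l) := by fun_prop
      simpa [show n - l ≠ 0 by omega] using (this.tendsto 0).mono_left nhdsWithin_le_nhds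
    exact tendsto_nhds_unique h1 (h2.trans_tendsto h3)

theorem coeff_eq_zero_of_isBigO {r : ℕ} {T : MvPolynomial (Fin d) ℂ}
    (h : evalReal T =O[𝓝 0] fun ξ => ‖ξ‖ ^ (r + 1)) (a : Fin d →₀ ℕ) (ha : a.degree ≤ r) :
    T.coeff a = 0 := by
  have key : MvPolynomial.homogeneousComponent a.degree T = 0 := by
    refine eq_zero_of_evalReal fun x => ?_
    by_cases hlt : T.totalDegree < a.degree
    · rw [MvPolynomial.homogeneousComponent_eq_zero _ _ hlt, evalReal, map_zero]
    -- Restriction to the line through `x`: the coefficients of `t ↦ T(t x)` are the values at `x`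
    -- of the homogeneous components.
    set q : Polynomial ℂ := ∑ l ∈ Finset.range (T.totalDegree + 1),
      Polynomial.monomial l (evalReal (MvPolynomial.homogeneousComponent l T) x) with hq
    have hqe : ∀ t : ℝ, q.eval (t : ℂ) = evalReal T (t • x) := by
      intro t
      rw [evalReal_smul_eq_sum, hq, Polynomial.eval_finsetSum]
      exact Finset.sum_congr rfl fun l _ => by rw [Polynomial.eval_monomial, mul_comm]
    have hO : (fun t : ℝ => q.eval (t : ℂ)) =O[𝓝 0] fun t => t ^ (r + 1) := by
      simp only [hqe]
      have ht : Tendsto (fun t : ℝ => t • x) (𝓝 0) (𝓝 0) := by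
        have : Continuous fun t : ℝ => t • x := by fun_prop
        simpa using this.tendsto 0
      refine (h.comp_tendsto ht).trans ?_
      refine Asymptotics.IsBigO.of_bound (‖x‖ ^ (r + 1)) (Eventually.of_forall fun t => ?_)
      simp [norm_smul, mul_pow, mul_comm]
    have h1 := (Polynomial.X_pow_dvd_iff.1 (X_pow_dvd_of_isBigO hO)) a.degree
      (by omega)
    rw [hq, Polynomial.finsetSum_coeff] at h1
    simp only [Polynomial.coeff_monomial] at h1
    rwa [Finset.sum_ite_eq', if_pos (Finset.mem_range.2 (by omega))] at h1
  have := congrArg (MvPolynomial.coeff a) key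
  rwa [MvPolynomial.coeff_homogeneousComponent, if_pos rfl, MvPolynomial.coeff_zero] at this

/-- The operators defined by two expansions of order `r` of the same function agree on polynomials
of degree at most `r`. -/
theorem HasJet.symbolOp_eq {r : ℕ} {f : EuclideanSpace ℝ (Fin d) → ℂ}
    {S T p : MvPolynomial (Fin d) ℂ} (hS : HasJet r f S) (hT : HasJet r f T)
    (hp : p.totalDegree ≤ r) : symbolOp S p = symbolOp T p := by
  refine symbolOp_congr (fun a ha => ?_) hp
  rw [← sub_eq_zero, ← MvPolynomial.coeff_sub]
  refine coeff_eq_zero_of_isBigO (r := r) ?_ a ha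
  refine (Asymptotics.IsBigO.sub hT hS).congr_left fun ξ => ?_
  rw [evalReal_sub]
  ring

/-- Truncated geometric series: `N = 1 - T / T(0)` has no constant term, and the product with `T`
telescopes to `1 - N ^ (r + 1)`. -/
theorem exists_approx_inverse (r : ℕ) {T : MvPolynomial (Fin d) ℂ} (hT : T.coeff 0 ≠ 0) :
    ∃ S : MvPolynomial (Fin d) ℂ, HasJet r (fun _ => 1) (T * S) := by
  obtain ⟨N, hN⟩ : ∃ N, N = 1 - MvPolynomial.C (T.coeff 0)⁻¹ * T := ⟨_, rfl⟩
  have hN0 : N.coeff 0 = 0 := by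
    rw [hN, MvPolynomial.coeff_sub, MvPolynomial.coeff_C_mul, MvPolynomial.coeff_zero_one,
      inv_mul_cancel₀ hT, sub_self]
  refine ⟨MvPolynomial.C (T.coeff 0)⁻¹ * ∑ i ∈ Finset.range (r + 1), N ^ i, ?_⟩
  have e : T * (MvPolynomial.C (T.coeff 0)⁻¹ * ∑ i ∈ Finset.range (r + 1), N ^ i) =
      1 - N ^ (r + 1) := by
    rw [← mul_neg_geom_sum, hN]
    ring
  rw [e]
  refine ((evalReal_isBigO_norm hN0).pow (r + 1)).congr_left fun ξ => ?_
  rw [evalReal_sub, evalReal_one, evalReal_pow]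
  ring

/-- Nothing is assumed about `f` beyond `f g = h`. The difference `f - T S'` times `g` is controlled
by the expansions of `g` and `h`, and `1 / g` is bounded near the origin. -/
theorem HasJet.div {r : ℕ} {f g h : EuclideanSpace ℝ (Fin d) → ℂ}
    {S T : MvPolynomial (Fin d) ℂ} (hg : HasJet r g S) (hh : HasJet r h T)
    (hfg : ∀ ξ, f ξ * g ξ = h ξ) (hgc : ContinuousAt g 0) (hg0 : g 0 ≠ 0) :
    ∃ R, HasJet r f R := by
  obtain ⟨S', hS'⟩ := exists_approx_inverse r (T := S) (by rwa [← hg.apply_zero])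
  refine ⟨T * S', ?_⟩
  have hinv : (fun ξ => (g ξ)⁻¹) =O[𝓝 0] (fun _ => (1 : ℝ)) :=
    (hgc.inv₀ hg0).norm.isBoundedUnder_le.isBigO_one ℝ
  -- The three terms add up to `h - g T S'`, and each is small for its own reason.
  have h1 : (fun ξ => h ξ - evalReal T ξ + evalReal T ξ * (1 - evalReal (S * S') ξ) +
      evalReal T ξ * evalReal S' ξ * (evalReal S ξ - g ξ)) =O[𝓝 0] fun ξ => ‖ξ‖ ^ (r + 1) := by
    have e1 := (evalReal_isBigO_one T).mul hS'
    have e2 := ((evalReal_isBigO_one T).mul (evalReal_isBigO_one S')).mul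
      (Asymptotics.IsBigO.neg_left hg)
    simp only [one_mul, neg_sub] at e1 e2
    exact (Asymptotics.IsBigO.add hh e1).add e2
  have h2 := hinv.mul h1
  simp only [one_mul] at h2
  refine h2.congr' ?_ EventuallyEq.rfl
  filter_upwards [hgc.eventually_ne hg0] with ξ hξ
  rw [← hfg, evalReal_mul, evalReal_mul]
  field_simp
  ring

/-- The space `ℝ^d`. -/
abbrev Space (d : ℕ) := EuclideanSpace ℝ (Fin d)

/-! ### Tempered distributions and convolution integrals -/

section Convolution

variable {G : Type*} [NormedAddCommGroup G] [NormedSpace ℝ G] [NormedSpace ℂ G]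
  [IsScalarTower ℝ ℂ G]

theorem hasFDerivAt_integral_smul_sub {g : Space d → ℂ} (hg : Continuous g) {H : Space d → G}
    (hH : ContDiff ℝ 1 H) (hHc : HasCompactSupport H) (x : (Space d)) :
    HasFDerivAt (fun x => ∫ y, g y • H (x - y)) (∫ y, g y • fderiv ℝ H (x - y)) x :=
  hHc.hasFDerivAt_convolution_right (ContinuousLinearMap.lsmul ℝ ℂ) hg.locallyIntegrable hH x

theorem linearIsometryEquiv_integral {F₁ F₂ : Type*} [NormedAddCommGroup F₁] [NormedSpace ℝ F₁]
    [NormedAddCommGroup F₂] [NormedSpace ℝ F₂] (L : F₁ ≃ₗᵢ[ℝ] F₂) (f : Space d → F₁) :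
    L (∫ y, f y) = ∫ y, L (f y) :=
  (L.toContinuousLinearEquiv.integral_comp_comm f).symm

theorem iteratedFDeriv_integral_smul_sub [CompleteSpace G] {g : Space d → ℂ} (hg : Continuous g)
    {H : Space d → G}
    (hH : ContDiff ℝ ∞ H) (hHc : HasCompactSupport H) (l : ℕ) (x : (Space d)) :
    iteratedFDeriv ℝ l (fun x => ∫ y, g y • H (x - y)) x =
      ∫ y, g y • iteratedFDeriv ℝ l H (x - y) := by
  induction l generalizing x with
  | zero =>
    simp only [iteratedFDeriv_zero_eq_comp, Function.comp_apply]
    rw [← LinearIsometryEquiv.coe_toContinuousLinearEquiv,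
      ← ContinuousLinearEquiv.integral_comp_comm]
    rfl
  | succ l ih =>
    have hl : ContDiff ℝ 1 (iteratedFDeriv ℝ l H) :=
      hH.iteratedFDeriv_right (m := 1) (by
        rw [← Nat.cast_one, ← Nat.cast_add]; exact_mod_cast le_top)
    simp only [iteratedFDeriv_succ_eq_comp_left, Function.comp_apply]
    rw [funext ih, (hasFDerivAt_integral_smul_sub hg hl (hHc.iteratedFDeriv l) x).fderiv]
    exact linearIsometryEquiv_integral (F₁ := Space d →L[ℝ] (Space d [×l]→L[ℝ] G))
      (F₂ := ContinuousMultilinearMap ℝ (fun _ : Fin (l + 1) => Space d) G)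
      (continuousMultilinearCurryLeftEquiv ℝ (fun _ : Fin (l + 1) => Space d) G).symm _

theorem contDiff_integral_smul_sub {g : Space d → ℂ} (hg : Continuous g) {H : Space d → G}
    (hH : ContDiff ℝ ∞ H) (hHc : HasCompactSupport H) :
    ContDiff ℝ ∞ fun x => ∫ y, g y • H (x - y) :=
  hHc.contDiff_convolution_right (ContinuousLinearMap.lsmul ℝ ℂ) hg.locallyIntegrable hH

theorem hasCompactSupport_integral_smul_sub {g : Space d → ℂ} (hgc : HasCompactSupport g)
    {H : Space d → G}
    (hHc : HasCompactSupport H) :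
    HasCompactSupport fun x => ∫ y, g y • H (x - y) :=
  HasCompactSupport.convolution (ContinuousLinearMap.lsmul ℝ ℂ) hgc hHc

end Convolution

/-- The bound makes `f` descend to a bounded functional on the range of `j`, which Hahn–Banach
extends. A distribution thereby becomes a functional on a Banach space, where it commutes with
Bochner integrals. -/
theorem exists_extension_of_norm_le {V M : Type*} [AddCommGroup V] [Module ℂ V]
    [NormedAddCommGroup M] [NormedSpace ℂ M] (j : V →ₗ[ℂ] M) (f : V →ₗ[ℂ] ℂ) (C : ℝ)
    (h : ∀ v, ‖f v‖ ≤ C * ‖j v‖) : ∃ Φ : M →L[ℂ] ℂ, ∀ v, Φ (j v) = f v := by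
  have hker : LinearMap.ker j ≤ LinearMap.ker f := by
    intro v hv
    have := h v
    rw [LinearMap.mem_ker.1 hv, norm_zero, mul_zero] at this
    exact norm_le_zero_iff.1 this
  set F : LinearMap.range j →ₗ[ℂ] ℂ :=
    (LinearMap.ker j).liftQ f hker ∘ₗ j.quotKerEquivRange.symm.toLinearMap with hF
  have hFj : ∀ v, F ⟨j v, LinearMap.mem_range_self j v⟩ = f v := by
    intro v
    have : j.quotKerEquivRange.symm ⟨j v, LinearMap.mem_range_self j v⟩ =
        (LinearMap.ker j).mkQ v := by
      rw [LinearEquiv.symm_apply_eq]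
      rfl
    simp [hF, this]
  obtain ⟨Φ, hΦ, -⟩ := exists_extension_norm_eq (LinearMap.range j) (F.mkContinuous C (by
    rintro ⟨_, v, rfl⟩
    rw [hFj]
    exact h v))
  exact ⟨Φ, fun v => (hΦ ⟨j v, LinearMap.mem_range_self j v⟩).trans (hFj v)⟩

instance compactSpace_closedBall (R : ℝ) : CompactSpace (Metric.closedBall (0 : Space d) R) :=
  isCompact_iff_compactSpace.1 (isCompact_closedBall _ _)

/-- The derivatives of a Schwartz function on a compact set. -/
def derivsOn (K : Set (Space d)) (s : Finset (ℕ × ℕ)) :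
    𝓢(Space d, ℂ) →ₗ[ℂ]
      (∀ p : s, C(K, Space d [×p.1.2]→L[ℝ] ℂ)) where
  toFun f p := ⟨fun x => iteratedFDeriv ℝ p.1.2 f x,
    ((f.smooth ⊤).continuous_iteratedFDeriv (mod_cast le_top)).comp continuous_subtype_val⟩
  map_add' f g := by
    funext p
    ext1 x
    exact iteratedFDeriv_add_apply ((f.smooth _).contDiffAt) ((g.smooth _).contDiffAt)
  map_smul' c f := by
    funext p
    ext1 x
    exact iteratedFDeriv_const_smul_apply ((f.smooth _).contDiffAt)

/-- On test functions supported in a fixed ball, a tempered distribution factors through finitely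
many derivatives. -/
theorem exists_factor_derivsOn (φ : 𝓢'((Space d), ℂ)) (R : ℝ) :
    ∃ (s : Finset (ℕ × ℕ)) (Φ : (∀ p : s,
        C(Metric.closedBall (0 : Space d) R, Space d [×p.1.2]→L[ℝ] ℂ)) →L[ℂ] ℂ),
      ∀ f : 𝓢((Space d), ℂ), tsupport f ⊆ Metric.closedBall 0 R →
        φ f = Φ (derivsOn (Metric.closedBall 0 R) s f) := by
  obtain ⟨s, C, -, hC⟩ := Seminorm.bound_of_continuous (schwartz_withSeminorms ℂ (Space d) ℂ)
    ((normSeminorm ℂ ℂ).comp φ.toLinearMap) (continuous_norm.comp φ.cont)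
  refine ⟨s, ?_⟩
  set V : Submodule ℂ 𝓢((Space d), ℂ) :=
    { carrier := {f | ∀ x ∉ Metric.closedBall (0 : (Space d)) R, f x = 0}
      zero_mem' := fun x _ => rfl
      add_mem' := fun {f g} hf hg x hx => by
        change f x + g x = 0
        rw [hf x hx, hg x hx, add_zero]
      smul_mem' := fun c f hf x hx => by
        change c • f x = 0
        rw [hf x hx, smul_zero] } with hV
  -- Continuity bounds `φ` by finitely many Schwartz seminorms. On the ball their weights `‖x‖ ^
  -- p.1` are bounded, and only the derivatives remain.
  obtain ⟨Φ, hΦ⟩ := exists_extension_of_norm_le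
    (M := ∀ p : s, C(Metric.closedBall (0 : Space d) R, Space d [×p.1.2]→L[ℝ] ℂ))
    (derivsOn (Metric.closedBall (0 : (Space d)) R) s ∘ₗ V.subtype) (φ.toLinearMap ∘ₗ V.subtype)
    (C * ∑ p ∈ s, |R| ^ p.1) (by
      rintro ⟨f, hf⟩
      have hsupp : tsupport f ⊆ Metric.closedBall (0 : (Space d)) R :=
        closure_minimal (fun x hx => by_contra fun h => hx (hf x h)) Metric.isClosed_closedBall
      refine (hC f).trans ?_
      rw [smul_apply, NNReal.smul_def, smul_eq_mul, mul_assoc]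
      refine mul_le_mul_of_nonneg_left ?_ C.2
      refine Seminorm.finset_sup_apply_le (by positivity) fun p hp => ?_
      refine SchwartzMap.seminorm_le_bound ℂ _ _ f (by positivity) fun x => ?_
      by_cases hx : x ∈ Metric.closedBall (0 : (Space d)) R
      · have h1 : ‖iteratedFDeriv ℝ p.2 f x‖ ≤
            ‖derivsOn (Metric.closedBall (0 : (Space d)) R) s f‖ :=
          (ContinuousMap.norm_coe_le_norm
            (derivsOn (Metric.closedBall (0 : (Space d)) R) s f ⟨p, hp⟩) ⟨x, hx⟩).trans
            (norm_le_pi_norm (derivsOn (Metric.closedBall (0 : (Space d)) R) s f) ⟨p, hp⟩)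
        have h2 : ‖x‖ ^ p.1 ≤ ∑ p ∈ s, |R| ^ p.1 :=
          (pow_le_pow_left₀ (norm_nonneg _) ((mem_closedBall_zero_iff.1 hx).trans
            (le_abs_self R)) _).trans
            (Finset.single_le_sum (f := fun p : ℕ × ℕ => |R| ^ p.1)
              (fun _ _ => by positivity) hp)
        exact mul_le_mul h2 h1 (norm_nonneg _) (by positivity)
      · have : iteratedFDeriv ℝ p.2 f x = 0 := by
          by_contra h0
          exact hx (hsupp (support_iteratedFDeriv_subset _ h0))
        rw [this, norm_zero, mul_zero]
        positivity)
  refine ⟨Φ, fun f hf => ?_⟩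
  have hfV : f ∈ V := fun x hx => image_eq_zero_of_notMem_tsupport fun h => hx (hf h)
  exact (hΦ ⟨f, hfV⟩).symm

/-- The function `y ↦ ⟨φ, ψ(· - y)⟩`. -/
def shiftPairing (φ : 𝓢'(Space d, ℂ)) (ψ : 𝓢(Space d, ℂ)) (y : Space d) : ℂ :=
  φ (SchwartzMap.compSubConstCLM ℂ y ψ)

theorem iteratedFDeriv_compSubConst (ψ : 𝓢(Space d, ℂ)) (l : ℕ) (x y : Space d) :
    iteratedFDeriv ℝ l (SchwartzMap.compSubConstCLM ℂ y ψ) x = iteratedFDeriv ℝ l ψ (x - y) :=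
  iteratedFDeriv_comp_sub l y x

theorem tsupport_compSubConst_subset {ψ : 𝓢(Space d, ℂ)} {R r : ℝ}
    (hψ : tsupport ψ ⊆ Metric.closedBall 0 R) {y : Space d} (hy : ‖y‖ ≤ r) :
    tsupport (SchwartzMap.compSubConstCLM ℂ y ψ) ⊆ Metric.closedBall 0 (R + r) := by
  refine closure_minimal (fun x hx => ?_) Metric.isClosed_closedBall
  have h := mem_closedBall_zero_iff.1 (hψ (subset_tsupport _ (show ψ (x - y) ≠ 0 from hx)))
  rw [mem_closedBall_zero_iff]
  calc ‖x‖ = ‖(x - y) + y‖ := by rw [sub_add_cancel]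
    _ ≤ R + r := (norm_add_le _ _).trans (add_le_add h hy)

theorem continuous_derivsOn_compSubConst (ψ : 𝓢(Space d, ℂ)) (R : ℝ) (s : Finset (ℕ × ℕ)) :
    Continuous fun y => derivsOn (Metric.closedBall 0 R) s (SchwartzMap.compSubConstCLM ℂ y ψ) := by
  refine continuous_pi fun p => ContinuousMap.continuous_of_continuous_uncurry _ ?_
  have : Function.uncurry (fun (y : Space d) (x : Metric.closedBall (0 : Space d) R) =>
      derivsOn (Metric.closedBall 0 R) s (SchwartzMap.compSubConstCLM ℂ y ψ) p x) =
      fun q => iteratedFDeriv ℝ p.1.2 ψ ((q.2 : Space d) - q.1) := by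
    funext q
    exact iteratedFDeriv_compSubConst ψ _ _ _
  rw [this]
  exact ((ψ.smooth ⊤).continuous_iteratedFDeriv (mod_cast le_top)).comp (by fun_prop)

theorem exists_tsupport_subset_closedBall {F : Type*} [Zero F] {f : Space d → F}
    (hf : HasCompactSupport f) : ∃ R : ℝ, 0 ≤ R ∧ tsupport f ⊆ Metric.closedBall 0 R := by
  obtain ⟨R, hR⟩ := (IsCompact.isBounded hf).subset_closedBall (0 : Space d)
  exact ⟨max R 0, le_max_right _ _,
    hR.trans (Metric.closedBall_subset_closedBall (le_max_left _ _))⟩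

theorem continuous_shiftPairing (φ : 𝓢'(Space d, ℂ)) {ψ : 𝓢(Space d, ℂ)}
    (hψ : HasCompactSupport ψ) : Continuous (shiftPairing φ ψ) := by
  obtain ⟨R, -, hR⟩ := exists_tsupport_subset_closedBall hψ
  rw [continuous_iff_continuousAt]
  intro y₀
  obtain ⟨s, Φ, hΦ⟩ := exists_factor_derivsOn φ (R + (‖y₀‖ + 1))
  have h1 : ContinuousAt (fun y => Φ (derivsOn (Metric.closedBall 0 (R + (‖y₀‖ + 1))) s
      (SchwartzMap.compSubConstCLM ℂ y ψ))) y₀ :=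
    (Φ.continuous.comp (continuous_derivsOn_compSubConst ψ _ s)).continuousAt
  refine h1.congr ?_
  have : ∀ᶠ y in 𝓝 y₀, ‖y‖ < ‖y₀‖ + 1 :=
    continuous_norm.continuousAt.eventually_lt continuousAt_const (by simp)
  filter_upwards [this] with y hy
  exact (hΦ _ (tsupport_compSubConst_subset hR hy.le)).symm

/-- The separating evaluations identify `w` with the Bochner integral of `g • v`, and a continuous
functional passes under that integral. -/
theorem apply_eq_integral_smul_of_separating {M : Type*} [NormedAddCommGroup M] [NormedSpace ℂ M]
    [CompleteSpace M] (Φ : M →L[ℂ] ℂ) {v : Space d → M} (hv : Continuous v) {g : Space d → ℂ}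
    (hg : Continuous g) (hgc : HasCompactSupport g) {ι : Type*} {F : ι → Type*}
    [∀ i, NormedAddCommGroup (F i)] [∀ i, NormedSpace ℂ (F i)] [∀ i, CompleteSpace (F i)]
    (ev : ∀ i, M →L[ℂ] F i) {w : M} (hsep : ∀ w', (∀ i, ev i w = ev i w') → w = w')
    (h : ∀ i, ev i w = ∫ y, g y • ev i (v y)) : Φ w = ∫ y, g y * Φ (v y) := by
  have hi : MeasureTheory.Integrable fun y => g y • v y :=
    (hg.smul hv).integrable_of_hasCompactSupport hgc.smul_right
  have hw : w = ∫ y, g y • v y := hsep _ fun i => by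
    rw [h, ← (ev i).integral_comp_comm hi]
    simp only [map_smul]
  rw [hw, ← Φ.integral_comp_comm hi]
  simp only [map_smul, smul_eq_mul]

/-- A tempered distribution commutes with convolution integrals. -/
theorem apply_eq_integral_shiftPairing (φ : 𝓢'(Space d, ℂ)) {ψ : 𝓢(Space d, ℂ)}
    (hψ : HasCompactSupport ψ) {g : Space d → ℂ} (hg : Continuous g) (hgc : HasCompactSupport g)
    {F : 𝓢(Space d, ℂ)} (hF : ∀ x, F x = ∫ y, g y • ψ (x - y)) :
    φ F = ∫ y, g y * shiftPairing φ ψ y := by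
  obtain ⟨R, hR0, hR⟩ := exists_tsupport_subset_closedBall hψ
  obtain ⟨r, hr0, hr⟩ := exists_tsupport_subset_closedBall hgc
  have hFsupp : tsupport F ⊆ Metric.closedBall 0 (R + r) := by
    refine closure_minimal (fun x hx => ?_) Metric.isClosed_closedBall
    by_contra hxR
    refine hx ?_
    rw [hF]
    refine MeasureTheory.integral_eq_zero_of_ae (Eventually.of_forall fun y => ?_)
    by_cases hy : y ∈ Metric.closedBall (0 : Space d) r
    · have : ψ (x - y) = 0 := by
        refine image_eq_zero_of_notMem_tsupport fun h => hxR ?_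
        have h1 := mem_closedBall_zero_iff.1 (hR h)
        have h2 := mem_closedBall_zero_iff.1 hy
        rw [mem_closedBall_zero_iff]
        calc ‖x‖ = ‖(x - y) + y‖ := by rw [sub_add_cancel]
          _ ≤ R + r := (norm_add_le _ _).trans (add_le_add h1 h2)
      simp [this]
    · simp [image_eq_zero_of_notMem_tsupport fun h => hy (hr h)]
  -- This ball contains the support of `F` and those of all `ψ(· - y)` with `y` in the support of
  -- `g`, so one factorization serves both sides.
  obtain ⟨s, Φ, hΦ⟩ := exists_factor_derivsOn φ (R + r)
  have hFF : (F : Space d → ℂ) = fun x => ∫ y, g y • ψ (x - y) := funext hF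
  rw [hΦ F hFsupp, apply_eq_integral_smul_of_separating
    (M := ∀ p : s, C(Metric.closedBall (0 : Space d) (R + r), Space d [×p.1.2]→L[ℝ] ℂ)) Φ
    (continuous_derivsOn_compSubConst ψ _ s) hg hgc
    (ι := s × Metric.closedBall (0 : Space d) (R + r))
    (F := fun i => Space d [×i.1.1.2]→L[ℝ] ℂ)
    (fun i => (ContinuousMap.evalCLM ℂ i.2).comp (ContinuousLinearMap.proj (R := ℂ)
      (φ := fun p : s => C(Metric.closedBall (0 : Space d) (R + r),
        Space d [×p.1.2]→L[ℝ] ℂ)) i.1)) ?_ ?_]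
  · refine MeasureTheory.integral_congr_ae (Eventually.of_forall fun y => ?_)
    by_cases hy : y ∈ tsupport g
    · simp only [shiftPairing]
      rw [hΦ _ (tsupport_compSubConst_subset hR (mem_closedBall_zero_iff.1 (hr hy)))]
    · simp [image_eq_zero_of_notMem_tsupport hy]
  · intro w' hw'
    funext p
    ext1 x
    exact hw' (p, x)
  · rintro ⟨p, x⟩
    have h2 : derivsOn (Metric.closedBall (0 : Space d) (R + r)) s F p x =
        iteratedFDeriv ℝ p.1.2 (fun x => ∫ y, g y • ψ (x - y)) x := by
      rw [← hFF]
      rfl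
    refine h2.trans ?_
    rw [iteratedFDeriv_integral_smul_sub hg (ψ.smooth ⊤) hψ]
    refine MeasureTheory.integral_congr_ae (Eventually.of_forall fun y => ?_)
    exact congrArg (g y • ·) (iteratedFDeriv_compSubConst ψ _ _ _).symm

/-! ### Plane waves -/

/-- The plane wave `e^{iξ·x}`. -/
def wave (ξ x : Space d) : ℂ := Complex.exp (Complex.I * ((∑ i, ξ i * x i : ℝ) : ℂ))

theorem wave_comm (ξ x : Space d) : wave ξ x = wave x ξ := by
  simp only [wave, mul_comm]

theorem wave_add_left (ξ η x : Space d) : wave (ξ + η) x = wave ξ x * wave η x := by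
  rw [wave, wave, wave, ← Complex.exp_add, ← mul_add, ← Complex.ofReal_add,
    ← Finset.sum_add_distrib]
  congr 4
  funext i
  simp [add_mul]

theorem wave_add_right (ξ x y : Space d) : wave ξ (x + y) = wave ξ x * wave ξ y := by
  rw [wave_comm, wave_add_left, wave_comm x, wave_comm y]

theorem wave_zero_left (x : Space d) : wave 0 x = 1 := by simp [wave]

theorem wave_neg_mul (ξ x : Space d) : wave (-ξ) x * wave ξ x = 1 := by
  rw [← wave_add_left, neg_add_cancel, wave_zero_left]

theorem wave_neg_right (ξ x : Space d) : wave ξ (-x) = wave (-ξ) x := by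
  simp [wave]

theorem wave_neg_left (ξ x : Space d) :
    wave (-ξ) x = Complex.exp (-Complex.I * ((∑ i, ξ i * x i : ℝ) : ℂ)) := by
  simp [wave]

theorem contDiff_wave (ξ : Space d) : ContDiff ℝ ∞ (wave ξ) := by
  have h : ContDiff ℝ ∞ fun x : Space d => ∑ i, ξ i * x i :=
    ContDiff.sum fun i _ => by fun_prop
  exact ContDiff.cexp (contDiff_const.mul (Complex.ofRealCLM.contDiff.comp h))

theorem continuous_wave (ξ : Space d) : Continuous (wave ξ) := (contDiff_wave ξ).continuous

theorem contDiffBump_coe (f : ContDiffBump (0 : Space d)) :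
    ContDiff ℝ ∞ fun x => ((f x : ℝ) : ℂ) :=
  Complex.ofRealCLM.contDiff.comp f.contDiff

theorem hasCompactSupport_bump_mul (f : ContDiffBump (0 : Space d)) (g : Space d → ℂ) :
    HasCompactSupport fun x => ((f x : ℝ) : ℂ) * g x :=
  HasCompactSupport.mul_right (f.hasCompactSupport.comp_left (g := ((↑) : ℝ → ℂ)) (by simp))

/-- A plane wave, cut off to a test function. -/
def cutWave (f : ContDiffBump (0 : Space d)) (ξ : Space d) : 𝓢(Space d, ℂ) :=
  (hasCompactSupport_bump_mul f (wave ξ)).toSchwartzMap ((contDiffBump_coe f).mul (contDiff_wave ξ))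

theorem cutWave_apply (f : ContDiffBump (0 : Space d)) (ξ x : Space d) :
    cutWave f ξ x = ((f x : ℝ) : ℂ) * wave ξ x := rfl

theorem hasCompactSupport_cutWave (f : ContDiffBump (0 : Space d)) (ξ : Space d) :
    HasCompactSupport (cutWave f ξ) := hasCompactSupport_bump_mul f _

/-- The constant `(2π)^{-d/2}`. -/
abbrev fourierConst (d : ℕ) : ℂ := (((2 * Real.pi) ^ (-(d : ℝ) / 2) : ℝ) : ℂ)

theorem fourierConst_ne_zero (d : ℕ) : fourierConst d ≠ 0 :=
  Complex.ofReal_ne_zero.2 (Real.rpow_pos_of_pos (by positivity) _).ne'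

section FourierTransform

variable {φ : 𝓢'(Space d, ℂ)} {g : Space d → ℂ}

theorem exists_bump_dsupport (hφ : IsCompact (dsupport φ)) (R : ℝ) :
    ∃ f : ContDiffBump (0 : Space d), R ≤ f.rIn ∧ dsupport φ ⊆ Metric.ball 0 f.rIn := by
  obtain ⟨r, hr⟩ := hφ.isBounded.subset_ball (0 : Space d)
  exact ⟨⟨max 1 (max r R), max 1 (max r R) + 1, by positivity, by linarith⟩,
    (le_max_right _ _).trans (le_max_right _ _),
    hr.trans (Metric.ball_subset_ball ((le_max_left _ _).trans (le_max_right _ _)))⟩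

theorem eventually_cutWave {f : ContDiffBump (0 : Space d)}
    (hf : dsupport φ ⊆ Metric.ball 0 f.rIn) (ξ : Space d) :
    ∀ᶠ x in 𝓝ˢ (dsupport φ), cutWave f ξ x = wave ξ x := by
  filter_upwards [Metric.isOpen_ball.mem_nhdsSet.2 hf] with x hx
  rw [cutWave_apply, f.one_of_mem_closedBall (Metric.ball_subset_closedBall hx)]
  simp

theorem IsFourierTransform.apply_cutWave (hg : IsFourierTransform φ g)
    {f : ContDiffBump (0 : Space d)} (hf : dsupport φ ⊆ Metric.ball 0 f.rIn) (ξ : Space d) :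
    g ξ = fourierConst d * φ (cutWave f (-ξ)) := by
  refine hg ξ _ (hasCompactSupport_cutWave _ _) ?_
  filter_upwards [eventually_cutWave hf (-ξ)] with x hx
  rw [hx, wave_neg_left]

/-- A compactly supported distribution vanishes on the test functions that vanish near its
support. -/
theorem IsFourierTransform.apply_eq_zero (hg : IsFourierTransform φ g)
    (hφ : IsCompact (dsupport φ)) {ψ : 𝓢(Space d, ℂ)} (hψ : HasCompactSupport ψ)
    (h0 : ∀ᶠ x in 𝓝ˢ (dsupport φ), ψ x = 0) : φ ψ = 0 := by
  obtain ⟨f, -, hf⟩ := exists_bump_dsupport hφ 0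
  have h1 := hg.apply_cutWave hf 0
  -- The cut-off of the constant `1`, and its sum with `ψ`, are both admissible test functions for
  -- `g 0`.
  have h2 := hg 0 (cutWave f (-0) + ψ) ((hasCompactSupport_cutWave f _).add hψ) (by
    filter_upwards [eventually_cutWave hf (-0), h0] with x hx hx0
    rw [← wave_neg_left, ← hx]
    change cutWave f (-0) x + ψ x = _
    rw [hx0, add_zero])
  rw [h1, map_add, mul_add] at h2
  have := (add_eq_left.1 h2.symm)
  exact (mul_eq_zero.1 this).resolve_left (fourierConst_ne_zero d)

theorem IsFourierTransform.hasCompactSupport_shiftPairing (hg : IsFourierTransform φ g)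
    (hφ : IsCompact (dsupport φ)) {ψ : 𝓢(Space d, ℂ)} (hψ : HasCompactSupport ψ) :
    HasCompactSupport (shiftPairing φ ψ) := by
  obtain ⟨R, hR0, hR⟩ := exists_tsupport_subset_closedBall hψ
  obtain ⟨f, -, hf⟩ := exists_bump_dsupport hφ 0
  refine HasCompactSupport.intro (isCompact_closedBall 0 (R + f.rIn)) fun y hy => ?_
  refine hg.apply_eq_zero hφ ?_ ?_
  · exact hψ.comp_homeomorph (Homeomorph.subRight y)
  · filter_upwards [Metric.isOpen_ball.mem_nhdsSet.2 hf] with x hx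
    rw [SchwartzMap.compSubConstCLM_apply]
    refine image_eq_zero_of_notMem_tsupport fun h => hy ?_
    have h1 := mem_closedBall_zero_iff.1 (hR h)
    have h2 := (mem_ball_zero_iff.1 hx).le
    rw [mem_closedBall_zero_iff]
    calc ‖y‖ = ‖x - (x - y)‖ := by rw [sub_sub_cancel]
      _ ≤ ‖x‖ + ‖x - y‖ := norm_sub_le _ _
      _ ≤ R + f.rIn := by linarith

/-- The Fourier transform of `y ↦ ⟨φ, ψ(· - y)⟩`. -/
theorem IsFourierTransform.integral_shiftPairing (hg : IsFourierTransform φ g)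
    (hφ : IsCompact (dsupport φ)) {ψ : 𝓢(Space d, ℂ)} (hψ : HasCompactSupport ψ) (ξ : Space d) :
    fourierConst d * ∫ y, shiftPairing φ ψ y * wave (-ξ) y = g ξ * ∫ z, ψ z * wave ξ z := by
  obtain ⟨R, hR0, hR⟩ := exists_tsupport_subset_closedBall hψ
  obtain ⟨r, hr0, hr⟩ := exists_tsupport_subset_closedBall (hg.hasCompactSupport_shiftPairing hφ hψ)
  obtain ⟨f, -, hf⟩ := exists_bump_dsupport hφ 0
  -- The plateau of `θ` has to contain the support of `y ↦ ⟨φ, ψ(· - y)⟩`, and all differences `x -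
  -- z` with `x` near the support of `φ` and `z` in that of `ψ`.
  obtain ⟨θ, hθ, -⟩ := exists_bump_dsupport hφ (max r (R + f.rIn))
  set F : 𝓢(Space d, ℂ) := (hasCompactSupport_integral_smul_sub
    (hasCompactSupport_cutWave θ (-ξ)) hψ).toSchwartzMap
    (contDiff_integral_smul_sub (cutWave θ (-ξ)).continuous (ψ.smooth ⊤) hψ) with hF
  have hFa : ∀ x, F x = ∫ y, cutWave θ (-ξ) y • ψ (x - y) := fun x => rfl
  have h1 := apply_eq_integral_shiftPairing φ hψ (cutWave θ (-ξ)).continuous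
    (hasCompactSupport_cutWave θ (-ξ)) hFa
  have h2 : ∫ y, cutWave θ (-ξ) y * shiftPairing φ ψ y = ∫ y, shiftPairing φ ψ y * wave (-ξ) y := by
    refine MeasureTheory.integral_congr_ae (Eventually.of_forall fun y => ?_)
    by_cases hy : y ∈ tsupport (shiftPairing φ ψ)
    · simp only [cutWave_apply]
      rw [θ.one_of_mem_closedBall (Metric.closedBall_subset_closedBall
        ((le_max_left _ _).trans hθ) (hr hy))]
      simp [mul_comm]
    · simp [image_eq_zero_of_notMem_tsupport hy]
  set a := ∫ z, ψ z * wave ξ z with ha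
  -- Plane waves are eigenfunctions of convolution: near the support of `φ`, `F` is the plane wave
  -- times the number `a`.
  have h3 : φ (F - a • cutWave f (-ξ)) = 0 := by
    refine hg.apply_eq_zero hφ ?_ ?_
    · exact (hasCompactSupport_integral_smul_sub (hasCompactSupport_cutWave θ (-ξ)) hψ).sub
        ((hasCompactSupport_cutWave f (-ξ)).smul_left (f := fun _ => a))
    · filter_upwards [Metric.isOpen_ball.mem_nhdsSet.2 hf, eventually_cutWave hf (-ξ)] with x hx hfx
      change F x - a * cutWave f (-ξ) x = 0
      rw [hfx, hFa, sub_eq_zero, ← MeasureTheory.integral_sub_left_eq_self _ _ x, ha,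
        ← MeasureTheory.integral_mul_const]
      refine MeasureTheory.integral_congr_ae (Eventually.of_forall fun z => ?_)
      simp only [sub_sub_cancel, smul_eq_mul, cutWave_apply]
      by_cases hz : z ∈ tsupport ψ
      · have hz1 := mem_closedBall_zero_iff.1 (hR hz)
        have hx1 := (mem_ball_zero_iff.1 hx).le
        rw [θ.one_of_mem_closedBall, sub_eq_add_neg, wave_add_right, wave_neg_right, neg_neg]
        · push_cast
          ring
        · rw [mem_closedBall_zero_iff]
          exact (norm_sub_le _ _).trans ((by linarith : ‖x‖ + ‖z‖ ≤ R + f.rIn).trans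
            ((le_max_right _ _).trans hθ))
      · simp [image_eq_zero_of_notMem_tsupport hz]
  rw [map_sub, map_smul, sub_eq_zero, smul_eq_mul] at h3
  rw [← h2, ← h1, h3, hg.apply_cutWave hf]
  ring

end FourierTransform

/-! ### Fourier integrals of compactly supported functions -/

/-- The Fourier integral `∫ w(y) e^{-iη·y} dy`. -/
def fourierInt (w : Space d → ℂ) (η : Space d) : ℂ := ∫ y, w y * wave (-η) y

theorem abs_sum_mul_le (η y : Space d) : |∑ i, η i * y i| ≤ ‖η‖ * ‖y‖ := by
  have h : ∑ i, η i * y i = inner ℝ η y := by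
    simp [PiLp.inner_apply, mul_comm]
  rw [h]
  exact abs_real_inner_le_norm η y

/-- The Taylor polynomial of the Fourier integral of `w` at the origin. -/
def momentPoly (r : ℕ) (w : Space d → ℂ) : MvPolynomial (Fin d) ℂ :=
  ∑ l ∈ Finset.range (r + 1), ∑ a ∈ Finset.piAntidiag Finset.univ l,
    MvPolynomial.monomial (Finsupp.equivFunOnFinite.symm a)
      ((-Complex.I) ^ l / (∏ i, ((a i).factorial : ℂ)) * ∫ y, w y * ∏ i, (y i : ℂ) ^ a i)

theorem coeff_momentPoly {r : ℕ} (w : Space d → ℂ) {b : Fin d →₀ ℕ} (hb : b.degree ≤ r) :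
    (momentPoly r w).coeff b = (-Complex.I) ^ b.degree / multiFactorial b *
      ∫ y, w y * ∏ i, (y i : ℂ) ^ b i := by
  classical
  have hdeg : ∑ i, b i = b.degree := (Finsupp.degree_eq_sum b).symm
  rw [momentPoly, MvPolynomial.coeff_sum, Finset.sum_eq_single b.degree]
  · rw [MvPolynomial.coeff_sum, Finset.sum_eq_single (b : Fin d → ℕ)]
    · rw [MvPolynomial.coeff_monomial, if_pos (by ext; simp)]
      rfl
    · intro a _ hab
      rw [MvPolynomial.coeff_monomial, if_neg]
      rintro rfl
      exact hab (by simp)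
    · intro h
      exact absurd (Finset.mem_piAntidiag.2 ⟨hdeg, fun _ _ => Finset.mem_univ _⟩) h
  · intro l _ hl
    rw [MvPolynomial.coeff_sum]
    refine Finset.sum_eq_zero fun a ha => ?_
    rw [MvPolynomial.coeff_monomial, if_neg]
    rintro rfl
    refine hl ?_
    rw [← (Finset.mem_piAntidiag.1 ha).1, Finsupp.degree_eq_sum]
    simp
  · intro h
    exact absurd (Finset.mem_range.2 (by omega)) h

theorem evalReal_monomial (b : Fin d →₀ ℕ) (c : ℂ) (x : Space d) :
    evalReal (MvPolynomial.monomial b c) x = c * ∏ i, (x i : ℂ) ^ b i := by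
  rw [evalReal, MvPolynomial.eval_monomial, Finsupp.prod_fintype _ _ (by simp)]

theorem continuous_prod_coord_pow (a : Fin d → ℕ) :
    Continuous fun y : Space d => ∏ i, (y i : ℂ) ^ a i := by
  refine continuous_finsetProd _ fun i _ => ?_
  exact (Complex.continuous_ofReal.comp (by fun_prop)).pow _

section

variable {w : Space d → ℂ}

theorem integrable_mul_of_hasCompactSupport (hw : Continuous w) (hwc : HasCompactSupport w)
    {f : Space d → ℂ} (hf : Continuous f) :
    MeasureTheory.Integrable fun y => w y * f y :=
  (hw.mul hf).integrable_of_hasCompactSupport hwc.mul_right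

/-- Multinomial expansion of `(-iη·y)^l` turns the truncated exponential series into the sum over
moments. -/
theorem evalReal_momentPoly (hw : Continuous w) (hwc : HasCompactSupport w)
    (r : ℕ) (η : Space d) :
    evalReal (momentPoly r w) η = ∫ y, w y * ∑ l ∈ Finset.range (r + 1),
      (-Complex.I * ((∑ i, η i * y i : ℝ) : ℂ)) ^ l / (l.factorial : ℂ) := by
  have hcont : ∀ l : ℕ, Continuous fun y : Space d =>
      (-Complex.I * ((∑ i, η i * y i : ℝ) : ℂ)) ^ l / (l.factorial : ℂ) := by
    intro l
    have : Continuous fun y : Space d => ∑ i, η i * y i :=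
      continuous_finsetSum _ fun i _ => by fun_prop
    exact ((continuous_const.mul (Complex.continuous_ofReal.comp this)).pow l).div_const _
  simp only [Finset.mul_sum]
  rw [MeasureTheory.integral_finsetSum _ fun l _ =>
    integrable_mul_of_hasCompactSupport hw hwc (hcont l), momentPoly, evalReal_sum]
  refine Finset.sum_congr rfl fun l _ => ?_
  have hpow : ∀ y : Space d,
      (-Complex.I * ((∑ i, η i * y i : ℝ) : ℂ)) ^ l / (l.factorial : ℂ) =
        ∑ a ∈ Finset.piAntidiag Finset.univ l,
          ((-Complex.I) ^ l / (∏ i, ((a i).factorial : ℂ)) * ∏ i, (η i : ℂ) ^ a i) *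
            ∏ i, (y i : ℂ) ^ a i := by
    intro y
    rw [mul_pow, Complex.ofReal_sum, Finset.sum_pow_eq_sum_piAntidiag, Finset.mul_sum,
      Finset.sum_div]
    refine Finset.sum_congr rfl fun a ha => ?_
    have h1 := Nat.multinomial_spec Finset.univ a
    rw [(Finset.mem_piAntidiag.1 ha).1] at h1
    have h2 : (∏ i, ((a i).factorial : ℂ)) * (Nat.multinomial Finset.univ a : ℂ) =
        (l.factorial : ℂ) := by exact_mod_cast h1
    have h3 : (∏ i, ((a i).factorial : ℂ)) ≠ 0 :=
      Finset.prod_ne_zero_iff.2 fun i _ => by exact_mod_cast (a i).factorial_ne_zero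
    have h4 : (l.factorial : ℂ) ≠ 0 := by exact_mod_cast l.factorial_ne_zero
    have h5 : ∏ i, ((η i * y i : ℝ) : ℂ) ^ a i =
        (∏ i, (η i : ℂ) ^ a i) * ∏ i, (y i : ℂ) ^ a i := by
      rw [← Finset.prod_mul_distrib]
      exact Finset.prod_congr rfl fun i _ => by push_cast; ring
    rw [h5]
    field_simp
    rw [← h2]
    ring
  simp only [hpow, Finset.mul_sum]
  rw [MeasureTheory.integral_finsetSum _ fun a _ => integrable_mul_of_hasCompactSupport hw hwc
    ((continuous_prod_coord_pow a).const_mul _), evalReal_sum]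
  refine Finset.sum_congr rfl fun a _ => ?_
  rw [evalReal_monomial]
  simp only [Finsupp.equivFunOnFinite_symm_apply_apply]
  rw [mul_right_comm, ← MeasureTheory.integral_const_mul]
  refine MeasureTheory.integral_congr_ae (Eventually.of_forall fun y => ?_)
  ring

theorem hasJet_fourierInt (hw : Continuous w) (hwc : HasCompactSupport w)
    (r : ℕ) : HasJet r (fourierInt w) (momentPoly r w) := by
  obtain ⟨R, hR0, hR⟩ := exists_tsupport_subset_closedBall hwc
  refine Asymptotics.IsBigO.of_bound (∫ y, ‖w y‖ * (R ^ (r + 1) * Real.exp R)) ?_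
  have hint : MeasureTheory.Integrable w := hw.integrable_of_hasCompactSupport hwc
  filter_upwards [Metric.ball_mem_nhds (0 : Space d) one_pos] with η hη
  have hη1 : ‖η‖ ≤ 1 := (mem_ball_zero_iff.1 hη).le
  have hcs : Continuous fun y : Space d => ∑ i, η i * y i :=
    continuous_finsetSum _ fun i _ => by fun_prop
  have hcont : Continuous fun y : Space d => ∑ l ∈ Finset.range (r + 1),
      (-Complex.I * ((∑ i, η i * y i : ℝ) : ℂ)) ^ l / (l.factorial : ℂ) :=
    continuous_finsetSum _ fun l _ =>
      ((continuous_const.mul (Complex.continuous_ofReal.comp hcs)).pow l).div_const _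
  rw [evalReal_momentPoly hw hwc, fourierInt, ← MeasureTheory.integral_sub
    (integrable_mul_of_hasCompactSupport hw hwc (continuous_wave _))
    (integrable_mul_of_hasCompactSupport hw hwc hcont), norm_pow, norm_norm,
    ← MeasureTheory.integral_mul_const]
  refine MeasureTheory.norm_integral_le_of_norm_le ((hint.norm.mul_const _).mul_const _)
    (Eventually.of_forall fun y => ?_)
  by_cases hy : y ∈ tsupport w
  · have hyR : ‖y‖ ≤ R := mem_closedBall_zero_iff.1 (hR hy)
    rw [← mul_sub, norm_mul, mul_assoc]
    refine mul_le_mul_of_nonneg_left ?_ (norm_nonneg _)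
    rw [wave_neg_left]
    refine (Complex.norm_exp_sub_sum_le_norm_mul_exp _ _).trans ?_
    have h1 : ‖-Complex.I * ((∑ i, η i * y i : ℝ) : ℂ)‖ ≤ ‖η‖ * R := by
      rw [norm_mul, norm_neg, Complex.norm_I, one_mul, Complex.norm_real, Real.norm_eq_abs]
      exact (abs_sum_mul_le η y).trans (mul_le_mul_of_nonneg_left hyR (norm_nonneg _))
    calc _ ≤ (‖η‖ * R) ^ (r + 1) * Real.exp R := by
          refine mul_le_mul (pow_le_pow_left₀ (norm_nonneg _) h1 _) (Real.exp_le_exp.2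
            (h1.trans (mul_le_of_le_one_left hR0 hη1))) (Real.exp_pos _).le (by positivity)
      _ = R ^ (r + 1) * Real.exp R * ‖η‖ ^ (r + 1) := by ring
  · simp [image_eq_zero_of_notMem_tsupport hy]

/-- The factorials from differentiating `y^b` cancel those in the moments, and the two powers of
`-i` combine to `(-1)^{|b|}`, which accounts for the reflected argument. -/
theorem coeff_zero_symbolOp_momentPoly (hw : Continuous w) (hwc : HasCompactSupport w)
    {r : ℕ} {p : MvPolynomial (Fin d) ℂ}
    (hp : p.totalDegree ≤ r) :
    (symbolOp (momentPoly r w) p).coeff 0 = ∫ y, evalReal p (-y) * w y := by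
  have hI : ∀ b : Fin d →₀ ℕ, ∫ y, evalReal (MvPolynomial.monomial b (p.coeff b)) (-y) * w y =
      (-1) ^ b.degree * p.coeff b * ∫ y, w y * ∏ i, (y i : ℂ) ^ b i := by
    intro b
    rw [← MeasureTheory.integral_const_mul]
    refine MeasureTheory.integral_congr_ae (Eventually.of_forall fun y => ?_)
    have : ∏ i, (((-y) i : ℝ) : ℂ) ^ b i = (-1) ^ b.degree * ∏ i, (y i : ℂ) ^ b i := by
      rw [Finsupp.degree_eq_sum, ← Finset.prod_pow_eq_pow_sum, ← Finset.prod_mul_distrib]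
      refine Finset.prod_congr rfl fun i _ => ?_
      rw [← mul_pow]
      simp
    simp only [evalReal_monomial]
    rw [this]
    ring
  have hsum : ∀ y, evalReal p (-y) * w y =
      ∑ b ∈ p.support, evalReal (MvPolynomial.monomial b (p.coeff b)) (-y) * w y := by
    intro y
    rw [← Finset.sum_mul, ← evalReal_sum, ← MvPolynomial.as_sum]
  simp only [hsum]
  rw [MeasureTheory.integral_finsetSum _ fun b _ => ?_]
  · conv_lhs => rw [p.as_sum, map_sum, MvPolynomial.coeff_sum]
    refine Finset.sum_congr rfl fun b hb => ?_
    have hbr : b.degree ≤ r := (MvPolynomial.le_totalDegree hb).trans hp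
    rw [hI, coeff_zero_symbolOp_monomial, coeff_momentPoly w hbr]
    have h1 := multiFactorial_ne_zero b
    have h2 : (-1 : ℂ) ^ b.degree = (-Complex.I) ^ b.degree * (-Complex.I) ^ b.degree := by
      rw [← mul_pow]
      simp
    rw [h2]
    field_simp
  · simp only [mul_comm _ (w _)]
    exact integrable_mul_of_hasCompactSupport hw hwc ((continuous_evalReal _).comp continuous_neg)

/-- Convolution of a polynomial with `w` is the action of the symbol `∫ w(y) e^{-iη·y} dy`. -/
theorem integral_evalReal_sub_mul (hw : Continuous w) (hwc : HasCompactSupport w)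
    {r : ℕ} {T R : MvPolynomial (Fin d) ℂ}
    (hT : HasJet r (fourierInt w) T) (hR : R.totalDegree ≤ r) (x : Space d) :
    ∫ y, evalReal R (x - y) * w y = evalReal (symbolOp T R) x := by
  have hshift : ∀ (p : MvPolynomial (Fin d) ℂ) (y : Space d),
      evalReal (shiftHom (fun i => (x i : ℂ)) p) y = evalReal p (x + y) := by
    intro p y
    rw [evalReal, eval_shiftHom, evalReal]
    congr 2
    ext i
    simp [add_comm]
  -- A shift moves `x` to the origin, where the constant term decides. The order `r'` is raised so
  -- that no bound on the degree of the shifted polynomial is needed.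
  set R' := shiftHom (fun i => (x i : ℂ)) R with hR'
  set r' := max r R'.totalDegree
  have hT' := hasJet_fourierInt hw hwc r'
  rw [hT.symbolOp_eq (hT'.mono (le_max_left _ _)) hR]
  have h1 := coeff_zero_symbolOp_momentPoly hw hwc (p := R') (r := r') (le_max_right _ _)
  rw [hR', symbolOp_shiftHom, ← evalReal_zero_right, hshift, add_zero] at h1
  rw [h1]
  refine MeasureTheory.integral_congr_ae (Eventually.of_forall fun y => ?_)
  simp only [hshift, sub_eq_add_neg]

end

theorem HasJet.continuousAt {r : ℕ} {f : Space d → ℂ} {T : MvPolynomial (Fin d) ℂ}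
    (h : HasJet r f T) : ContinuousAt f 0 := by
  have h1 : Tendsto (fun ξ : Space d => ‖ξ‖ ^ (r + 1)) (𝓝 0) (𝓝 0) := by
    have : Continuous fun ξ : Space d => ‖ξ‖ ^ (r + 1) := by fun_prop
    simpa using this.tendsto 0
  have h2 := (Asymptotics.IsBigO.trans_tendsto h h1).add ((continuous_evalReal T).tendsto 0)
  simp only [sub_add_cancel, zero_add] at h2
  rwa [evalReal_zero_right, ← h.apply_zero] at h2

section FourierTransform

variable {φ : 𝓢'(Space d, ℂ)} {g : Space d → ℂ}

theorem integral_mul_wave_eq_fourierInt (ψ : Space d → ℂ) (ξ₀ η : Space d) :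
    ∫ z, ψ z * wave (ξ₀ + η) z = fourierInt (fun y => ψ (-y) * wave (-ξ₀) y) η := by
  rw [fourierInt, ← MeasureTheory.integral_neg_eq_self]
  refine MeasureTheory.integral_congr_ae (Eventually.of_forall fun y => ?_)
  simp only [wave_neg_right, neg_add, wave_add_left]
  ring

theorem continuous_comp_neg_mul_wave {ψ : Space d → ℂ} (hψ : Continuous ψ) (ξ₀ : Space d) :
    Continuous fun y => ψ (-y) * wave (-ξ₀) y :=
  (hψ.comp continuous_neg).mul (continuous_wave _)

theorem hasCompactSupport_comp_neg_mul_wave {ψ : Space d → ℂ} (hψ : HasCompactSupport ψ)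
    (ξ₀ : Space d) : HasCompactSupport fun y => ψ (-y) * wave (-ξ₀) y :=
  HasCompactSupport.mul_right (hψ.comp_homeomorph (Homeomorph.neg (Space d)))

/-- Near `ξ₀` this exhibits `g` as a quotient of Fourier integrals of continuous functions of
compact support, whose expansions are explicit. -/
theorem IsFourierTransform.fourierInt_shiftPairing (hg : IsFourierTransform φ g)
    (hφ : IsCompact (dsupport φ)) {ψ : 𝓢(Space d, ℂ)} (hψ : HasCompactSupport ψ)
    (ξ₀ η : Space d) :
    fourierInt (fun y => shiftPairing φ ψ y * wave (-ξ₀) y) η = (fourierConst d)⁻¹ *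
      (g (ξ₀ + η) * fourierInt (fun y => ψ (-y) * wave (-ξ₀) y) η) := by
  rw [← integral_mul_wave_eq_fourierInt, ← hg.integral_shiftPairing hφ hψ,
    inv_mul_cancel_left₀ (fourierConst_ne_zero d), fourierInt]
  refine MeasureTheory.integral_congr_ae (Eventually.of_forall fun y => ?_)
  simp only [neg_add, wave_add_left]
  ring

/-- The Fourier transform of a compactly supported distribution has expansions of all orders at
every point. -/
theorem IsFourierTransform.exists_hasJet (hg : IsFourierTransform φ g)
    (hφ : IsCompact (dsupport φ)) (ξ₀ : Space d) (r : ℕ) :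
    ∃ T, HasJet r (fun η => g (ξ₀ + η)) T := by
  obtain ⟨f⟩ : Nonempty (ContDiffBump (0 : Space d)) := inferInstance
  -- With this frequency the divisor at `η = 0` is the integral of the bump function, which is
  -- positive.
  set ψ := cutWave f (-ξ₀) with hψ
  have hψc : HasCompactSupport ψ := hasCompactSupport_cutWave f _
  have ha := hasJet_fourierInt (continuous_comp_neg_mul_wave ψ.continuous ξ₀)
    (hasCompactSupport_comp_neg_mul_wave hψc ξ₀) r
  have hu := hasJet_fourierInt (w := fun y => shiftPairing φ ψ y * wave (-ξ₀) y)
    ((continuous_shiftPairing φ hψc).mul (continuous_wave (-ξ₀)))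
    (hg.hasCompactSupport_shiftPairing hφ hψc).mul_right r
  refine ha.div ((HasJet.const r (fourierConst d)).mul hu) (fun η => ?_) ha.continuousAt ?_
  · rw [hg.fourierInt_shiftPairing hφ hψc, mul_inv_cancel_left₀ (fourierConst_ne_zero d)]
  · rw [← integral_mul_wave_eq_fourierInt, add_zero]
    have : ∀ z, ψ z * wave ξ₀ z = ((f z : ℝ) : ℂ) := by
      intro z
      rw [hψ, cutWave_apply, mul_assoc, wave_neg_mul, mul_one]
    simp only [this]
    rw [integral_complex_ofReal]
    exact Complex.ofReal_ne_zero.2 f.integral_pos.ne'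

end FourierTransform

/-! ### Poisson summation for continuous functions of compact support -/

/-- An integer vector regarded as a vector of reals. -/
abbrev intVec (n : Fin d → ℤ) : Fin d → ℝ := fun i => (n i : ℝ)

/-- The half-open unit cube with corner `n`. -/
abbrev unitCube (n : Fin d → ℤ) : Set (Fin d → ℝ) := {x | ∀ i, x i ∈ Set.Ioc (n i : ℝ) (n i + 1)}

theorem measurableSet_unitCube (n : Fin d → ℤ) : MeasurableSet (unitCube n) :=
  MeasurableSet.univ_pi' fun _ => measurableSet_Ioc

theorem finite_norm_intVec_le (M : ℝ) : {n : Fin d → ℤ | ‖intVec n‖ ≤ M}.Finite := by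
  refine (Set.finite_Icc (fun _ => -⌈M⌉) (fun _ => ⌈M⌉)).subset fun n hn => ?_
  have h : ∀ i, |(n i : ℝ)| ≤ (⌈M⌉ : ℝ) := fun i =>
    ((norm_le_pi_norm (intVec n) i).trans hn).trans (Int.le_ceil M)
  constructor <;> intro i <;> have := abs_le.1 (h i)
  · exact_mod_cast this.1
  · exact_mod_cast this.2

theorem setIntegral_unitCube (u : (Fin d → ℝ) → ℂ) (n : Fin d → ℤ) :
    ∫ x in unitCube n, u x = ∫ x in unitCube 0, u (x + intVec n) := by
  have hmp := MeasureTheory.measurePreserving_add_right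
    (MeasureTheory.volume : MeasureTheory.Measure (Fin d → ℝ)) (intVec n)
  rw [← hmp.setIntegral_preimage_emb (measurableEmbedding_addRight _)]
  congr 2
  ext x
  simp only [Set.mem_preimage, Set.mem_ofPred_eq, Pi.add_apply, Set.mem_Ioc, Pi.zero_apply,
    Int.cast_zero]
  refine forall_congr' fun i => ?_
  constructor <;> rintro ⟨h1, h2⟩ <;> constructor <;> linarith

theorem hasSum_setIntegral_unitCube {u : (Fin d → ℝ) → ℂ} (hu : MeasureTheory.Integrable u) :
    HasSum (fun n : Fin d → ℤ => ∫ x in unitCube 0, u (x + intVec n)) (∫ x, u x) := by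
  have huniv : (⋃ n : Fin d → ℤ, unitCube n) = Set.univ := by
    refine Set.eq_univ_of_forall fun x => Set.mem_iUnion.2 ⟨fun i => ⌈x i⌉ - 1, fun i => ?_⟩
    constructor
    · push_cast
      linarith [Int.ceil_lt_add_one (x i)]
    · push_cast
      linarith [Int.le_ceil (x i)]
  have hdisj : Pairwise (Function.onFun Disjoint (unitCube (d := d))) := by
    intro m n hmn
    refine Set.disjoint_left.2 fun x hx hx' => hmn ?_
    funext i
    have h1 := hx i
    have h2 := hx' i
    have h3 : (m i : ℝ) < n i + 1 := h1.1.trans_le h2.2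
    have h4 : (n i : ℝ) < m i + 1 := h2.1.trans_le h1.2
    have h5 : m i < n i + 1 := by exact_mod_cast h3
    have h6 : n i < m i + 1 := by exact_mod_cast h4
    omega
  have h := MeasureTheory.hasSum_integral_iUnion (f := u) (μ := MeasureTheory.volume)
    (fun n : Fin d → ℤ => measurableSet_unitCube n) hdisj hu.integrableOn
  rw [huniv, MeasureTheory.setIntegral_univ] at h
  exact h.congr_fun fun n => (setIntegral_unitCube u n).symm

/-- The sum of the integer translates of a function. -/
def periodization (u : (Fin d → ℝ) → ℂ) (x : Fin d → ℝ) : ℂ :=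
  ∑ᶠ n : Fin d → ℤ, u (x + intVec n)

theorem continuous_periodization {u : (Fin d → ℝ) → ℂ} (hu : Continuous u)
    (huc : HasCompactSupport u) : Continuous (periodization u) := by
  obtain ⟨M, hM⟩ := huc.isCompact.isBounded.exists_norm_le
  refine continuous_finsum (fun n => hu.comp (continuous_id.add continuous_const)) fun x => ?_
  refine ⟨Metric.ball x 1, Metric.ball_mem_nhds x one_pos,
    (finite_norm_intVec_le (M + (‖x‖ + 1))).subset ?_⟩
  rintro n ⟨y, hy, hyx⟩
  have h1 : ‖y + intVec n‖ ≤ M := hM _ (subset_tsupport _ hy)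
  have h2 : ‖y‖ ≤ ‖x‖ + 1 := by
    have := mem_ball_iff_norm.1 hyx
    linarith [norm_sub_norm_le y x]
  calc ‖intVec n‖ = ‖(y + intVec n) - y‖ := by rw [add_sub_cancel_left]
    _ ≤ ‖y + intVec n‖ + ‖y‖ := norm_sub_le _ _
    _ ≤ _ := add_le_add h1 h2

theorem periodization_add_intVec (u : (Fin d → ℝ) → ℂ) (x : Fin d → ℝ) (m : Fin d → ℤ) :
    periodization u (x + intVec m) = periodization u x := by
  rw [periodization, periodization,
    ← finsum_comp_equiv (Equiv.addLeft m) (f := fun n => u (x + intVec n))]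
  refine finsum_congr fun n => ?_
  congr 1
  funext i
  simp [intVec, add_assoc]

theorem finsum_eq_sum_of_norm_le {u : (Fin d → ℝ) → ℂ} {M : ℝ}
    (hM : ∀ x ∈ tsupport u, ‖x‖ ≤ M) {x : Fin d → ℝ} {R : ℝ} (hx : ‖x‖ ≤ R) :
    periodization u x = ∑ n ∈ (finite_norm_intVec_le (d := d) (M + R)).toFinset,
      u (x + intVec n) := by
  refine finsum_eq_sum_of_support_subset _ fun n hn => ?_
  have h1 : ‖x + intVec n‖ ≤ M := hM _ (subset_tsupport _ hn)
  simp only [Set.Finite.coe_toFinset, Set.mem_ofPred_eq]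
  calc ‖intVec n‖ = ‖(x + intVec n) - x‖ := by rw [add_sub_cancel_left]
    _ ≤ ‖x + intVec n‖ + ‖x‖ := norm_sub_le _ _
    _ ≤ _ := add_le_add h1 hx

/-- The projection onto the torus. -/
abbrev torusMk (x : Fin d → ℝ) : UnitAddTorus (Fin d) := fun i => (x i : UnitAddCircle)

theorem isOpenQuotientMap_torusMk : IsOpenQuotientMap (torusMk (d := d)) :=
  IsOpenQuotientMap.piMap fun _ => QuotientAddGroup.isOpenQuotientMap_mk

/-- The lift is defined through an arbitrary section; periodicity makes it independent of the
section, and continuity descends along the quotient map. -/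
theorem exists_torus_lift {W : (Fin d → ℝ) → ℂ} (hW : Continuous W)
    (hper : ∀ x m, W (x + intVec m) = W x) :
    ∃ F : C(UnitAddTorus (Fin d), ℂ), ∀ x, F (torusMk x) = W x := by
  have hsurj : Function.Surjective (torusMk (d := d)) := isOpenQuotientMap_torusMk.surjective
  have key : ∀ x, W (Function.surjInv hsurj (torusMk x)) = W x := by
    intro x
    have h := Function.surjInv_eq hsurj (torusMk x)
    set y := Function.surjInv hsurj (torusMk x)
    have h' : ∀ i, ∃ m : ℤ, y i = x i + m := by
      intro i
      have hi : ((y i : ℝ) : UnitAddCircle) = (x i : ℝ) := congrFun h i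
      rw [← sub_eq_zero, ← AddCircle.coe_sub, AddCircle.coe_eq_zero_iff] at hi
      obtain ⟨m, hm⟩ := hi
      refine ⟨m, ?_⟩
      rw [zsmul_one] at hm
      linarith
    choose m hm using h'
    have : y = x + intVec m := funext hm
    rw [this, hper]
  refine ⟨⟨fun t => W (Function.surjInv hsurj t), ?_⟩, key⟩
  rw [isOpenQuotientMap_torusMk.isQuotientMap.continuous_iff]
  exact hW.congr fun x => (key x).symm

theorem mFourier_torusMk (n : Fin d → ℤ) (x : Fin d → ℝ) :
    UnitAddTorus.mFourier n (torusMk x) =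
      Complex.exp (Complex.I * ((∑ i, (2 * Real.pi * n i) * x i : ℝ) : ℂ)) := by
  simp only [UnitAddTorus.mFourier, ContinuousMap.coe_mk, fourier_coe_apply]
  rw [← Complex.exp_sum]
  congr 1
  push_cast
  rw [Finset.mul_sum]
  refine Finset.sum_congr rfl fun i _ => ?_
  ring

theorem mFourier_torusMk_add_intVec (n m : Fin d → ℤ) (x : Fin d → ℝ) :
    UnitAddTorus.mFourier n (torusMk (x + intVec m)) = UnitAddTorus.mFourier n (torusMk x) := by
  congr 1
  funext i
  simp [torusMk]

/-- Unfolding: the translated cubes tile the space and the exponential is periodic. Only finitely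
many translates of `u` meet the unit cube, so sum and integral interchange. -/
theorem mFourierCoeff_of_periodization {u : (Fin d → ℝ) → ℂ} (hu : Continuous u)
    (huc : HasCompactSupport u) {F : C(UnitAddTorus (Fin d), ℂ)}
    (hF : ∀ x, F (torusMk x) = periodization u x) (k : Fin d → ℤ) :
    UnitAddTorus.mFourierCoeff F k =
      ∫ x, u x * UnitAddTorus.mFourier (-k) (torusMk x) := by
  obtain ⟨M, hM⟩ := huc.isCompact.isBounded.exists_norm_le
  set e : (Fin d → ℝ) → ℂ := fun x => UnitAddTorus.mFourier (-k) (torusMk x) with he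
  have hec : Continuous e :=
    (UnitAddTorus.mFourier (-k)).continuous.comp isOpenQuotientMap_torusMk.continuous
  have hue : MeasureTheory.Integrable fun x => u x * e x :=
    (hu.mul hec).integrable_of_hasCompactSupport huc.mul_right
  have hcube : ∀ x ∈ unitCube (0 : Fin d → ℤ), ‖x‖ ≤ 1 := by
    intro x hx
    refine (pi_norm_le_iff_of_nonneg zero_le_one).2 fun i => ?_
    have := hx i
    simp only [Pi.zero_apply, Int.cast_zero, zero_add] at this
    rw [Real.norm_eq_abs, abs_le]
    constructor <;> linarith [this.1, this.2]
  have hsum := hasSum_setIntegral_unitCube hue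
  set T := (finite_norm_intVec_le (d := d) (M + 1)).toFinset with hT
  have hzero : ∀ n ∉ T, ∫ x in unitCube 0, u (x + intVec n) * e (x + intVec n) = 0 := by
    intro n hn
    refine MeasureTheory.setIntegral_eq_zero_of_forall_eq_zero fun x hx => ?_
    suffices h : x + intVec n ∉ tsupport u by
      simp only [image_eq_zero_of_notMem_tsupport h, zero_mul]
    intro hmem
    refine hn ?_
    simp only [hT, Set.Finite.mem_toFinset, Set.mem_ofPred_eq]
    calc ‖intVec n‖ = ‖(x + intVec n) - x‖ := by rw [add_sub_cancel_left]
      _ ≤ ‖x + intVec n‖ + ‖x‖ := norm_sub_le _ _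
      _ ≤ _ := add_le_add (hM _ hmem) (hcube x hx)
  rw [hsum.unique (hasSum_sum_of_ne_finset_zero hzero),
    UnitAddTorus.mFourierCoeff_eq_integral _ _ 0, ← MeasureTheory.integral_finsetSum]
  · have hset : {x : Fin d → ℝ | ∀ i, x i ∈ Set.Ioc ((0 : Fin d → ℝ) i) ((0 : Fin d → ℝ) i + 1)} =
        unitCube 0 := by
      ext x
      simp
    rw [hset]
    refine MeasureTheory.setIntegral_congr_fun (measurableSet_unitCube 0) fun x hx => ?_
    have h1 : F (fun i => (x i : UnitAddCircle)) = ∑ n ∈ T, u (x + intVec n) :=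
      (hF x).trans (finsum_eq_sum_of_norm_le hM (hcube x hx))
    simp only [smul_eq_mul]
    rw [h1, Finset.mul_sum]
    refine Finset.sum_congr rfl fun n _ => ?_
    rw [he]
    simp only [mFourier_torusMk_add_intVec]
    rw [mul_comm]
  · intro n _
    exact (hue.comp_add_right (intVec n)).integrableOn

/-- Only the mean survives in the Fourier series of the periodization, so the series is trivially
summable and represents the continuous periodization at every point, in particular at the origin. -/
theorem hasSum_intVec_of_integral_eq_zero {u : (Fin d → ℝ) → ℂ} (hu : Continuous u)
    (huc : HasCompactSupport u)
    (h0 : ∀ k ≠ 0, ∫ x, u x * UnitAddTorus.mFourier (-k) (torusMk x) = 0) :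
    HasSum (fun n : Fin d → ℤ => u (intVec n)) (∫ x, u x) := by
  obtain ⟨F, hF⟩ := exists_torus_lift (continuous_periodization hu huc)
    (periodization_add_intVec u)
  have hcoeff : ∀ k ∉ ({0} : Finset (Fin d → ℤ)), UnitAddTorus.mFourierCoeff F k = 0 := by
    intro k hk
    rw [mFourierCoeff_of_periodization hu huc hF]
    exact h0 k (by simpa using hk)
  have h1 := UnitAddTorus.hasSum_mFourier_series_apply_of_summable
    (summable_of_ne_finset_zero hcoeff) (torusMk 0)
  have h2 : HasSum (fun k => UnitAddTorus.mFourierCoeff F k •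
      UnitAddTorus.mFourier k (torusMk (0 : Fin d → ℝ)))
      (∑ k ∈ {0}, UnitAddTorus.mFourierCoeff F k •
        UnitAddTorus.mFourier k (torusMk (0 : Fin d → ℝ))) :=
    hasSum_sum_of_ne_finset_zero (s := {0}) fun k hk => by rw [hcoeff k hk, zero_smul]
  have h3 := h1.unique h2
  rw [Finset.sum_singleton, hF, mFourierCoeff_of_periodization hu huc hF] at h3
  simp only [neg_zero, UnitAddTorus.mFourier_zero, ContinuousMap.one_apply, mul_one,
    smul_eq_mul] at h3
  rw [← h3]
  obtain ⟨M, hM⟩ := huc.isCompact.isBounded.exists_norm_le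
  have hfin : (Function.support fun n : Fin d → ℤ => u (intVec n)).Finite :=
    (finite_norm_intVec_le M).subset fun n hn => hM _ (subset_tsupport _ hn)
  have h4 : HasSum (fun n : Fin d → ℤ => u (intVec n)) (∑ n ∈ hfin.toFinset, u (intVec n)) :=
    hasSum_sum_of_ne_finset_zero fun n hn => by simpa using hn
  rw [← finsum_eq_sum _ hfin] at h4
  simpa [periodization] using h4

/-- **Poisson summation** when all Fourier coefficients but the mean vanish. -/
theorem hasSum_latticePt_of_fourierInt_eq_zero {w : Space d → ℂ} (hw : Continuous w)
    (hwc : HasCompactSupport w)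
    (h0 : ∀ n ≠ 0, fourierInt w ((2 * Real.pi) • latticePt n) = 0) :
    HasSum (fun n : Fin d → ℤ => w (latticePt n)) (∫ x, w x) := by
  have hint : ∀ f : Space d → ℂ, ∫ x : Fin d → ℝ, f (WithLp.toLp 2 x) = ∫ y, f y := fun f =>
    (PiLp.volume_preserving_toLp (Fin d)).integral_comp
      (MeasurableEquiv.toLp 2 (Fin d → ℝ)).measurableEmbedding f
  have hhom : HasCompactSupport fun x : Fin d → ℝ => w (WithLp.toLp 2 x) :=
    hwc.comp_homeomorph (PiLp.homeomorph 2 (fun _ : Fin d => ℝ)).symm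
  rw [← hint]
  refine hasSum_intVec_of_integral_eq_zero (hw.comp (by fun_prop)) hhom fun k hk => ?_
  rw [← h0 k hk, fourierInt, ← hint]
  refine MeasureTheory.integral_congr_ae (MeasureTheory.ae_of_all _ fun x => ?_)
  simp only [mFourier_torusMk, wave]
  congr 4
  refine Finset.sum_congr rfl fun i _ => ?_
  simp [latticePt]

/-! ### The dilation matrix -/

section Dilation

variable {A : Matrix (Fin d) (Fin d) ℤ}

theorem map_complex_det (A : Matrix (Fin d) (Fin d) ℤ) :
    (A.map fun n => (n : ℂ)).det = (A.det : ℂ) :=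
  ((Int.castRingHom ℂ).map_det A).symm

theorem toReal_det (A : Matrix (Fin d) (Fin d) ℤ) : (toReal A).det = (A.det : ℝ) :=
  ((Int.castRingHom ℝ).map_det A).symm

theorem IsDilationMatrix.det_ne_zero (hA : IsDilationMatrix A) : (toReal A).det ≠ 0 := by
  intro h
  rw [toReal_det, Int.cast_eq_zero] at h
  have h0 : (0 : ℂ) ∈ spectrum ℂ (A.map fun n => (n : ℂ)) := by
    rw [spectrum.zero_mem_iff, Matrix.isUnit_iff_isUnit_det, map_complex_det, h]
    simp
  have := hA 0 h0
  norm_num at this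

theorem one_lt_norm_multiset_prod (s : Multiset ℂ) (hs : s ≠ 0) (h : ∀ z ∈ s, 1 < ‖z‖) :
    1 < ‖s.prod‖ := by
  induction s using Multiset.induction_on with
  | empty => exact absurd rfl hs
  | cons a s ih =>
    have ha := h a (Multiset.mem_cons_self a s)
    rw [Multiset.prod_cons, norm_mul]
    rcases eq_or_ne s 0 with rfl | hs'
    · simpa using ha
    · exact one_lt_mul_of_lt_of_le ha (ih hs' fun z hz => h z (Multiset.mem_cons_of_mem hz)).le

theorem IsDilationMatrix.one_lt_abs_det (hA : IsDilationMatrix A) (hd : d ≠ 0) :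
    1 < |(toReal A).det| := by
  set M := A.map fun n => (n : ℂ) with hM
  have hroots : M.charpoly.roots ≠ 0 := by
    rw [← Multiset.card_pos, (IsAlgClosed.splits M.charpoly).natDegree_eq_card_roots.symm,
      Matrix.charpoly_natDegree_eq_dim, Fintype.card_fin]
    omega
  have h := one_lt_norm_multiset_prod M.charpoly.roots hroots fun z hz =>
    hA z (Matrix.mem_spectrum_iff_isRoot_charpoly.2 (Polynomial.isRoot_of_mem_roots hz))
  rw [← Matrix.det_eq_prod_roots_charpoly, hM, map_complex_det] at h
  rw [toReal_det]
  simpa using h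

theorem norm_act_orthogonal {U : Matrix (Fin d) (Fin d) ℝ}
    (hU : U ∈ Matrix.orthogonalGroup (Fin d) ℝ) (x : Space d) : ‖act U x‖ = ‖x‖ := by
  have h1 : U.transpose * U = 1 := (Matrix.mem_orthogonalGroup_iff' (Fin d) ℝ).1 hU
  have h2 : ∀ y : Space d, ‖y‖ ^ 2 = y.ofLp ⬝ᵥ y.ofLp := fun y => by
    rw [EuclideanSpace.real_norm_sq_eq]
    simp [dotProduct, sq]
  have h3 : ‖act U x‖ ^ 2 = ‖x‖ ^ 2 := by
    rw [h2, h2]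
    simp only [act]
    rw [Matrix.dotProduct_mulVec, Matrix.vecMul_mulVec, h1, Matrix.vecMul_one]
  exact (sq_eq_sq₀ (norm_nonneg _) (norm_nonneg _)).1 h3

theorem act_pow_succ (M : Matrix (Fin d) (Fin d) ℝ) (j : ℕ) (x : Space d) :
    act (M ^ (j + 1)) x = act M (act (M ^ j) x) := by
  rw [pow_succ', act_mul]

/-- In the norm `‖Q x‖` the matrix `B` is `ρ` times an isometry. -/
theorem tendsto_act_pow {B Q U : Matrix (Fin d) (Fin d) ℝ} {ρ : ℝ} (hρ0 : 0 ≤ ρ) (hρ : ρ < 1)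
    (hQ : IsUnit Q.det) (hU : U ∈ Matrix.orthogonalGroup (Fin d) ℝ)
    (hB : B = ρ • (Q⁻¹ * U * Q)) (x : Space d) :
    Tendsto (fun j : ℕ => act (B ^ j) x) atTop (𝓝 0) := by
  have hstep : ∀ y : Space d, ‖act Q (act B y)‖ = ρ * ‖act Q y‖ := by
    intro y
    have h : Q * B = ρ • (U * Q) := by
      rw [hB, Matrix.mul_smul, ← Matrix.mul_assoc, ← Matrix.mul_assoc,
        Matrix.mul_nonsing_inv _ hQ, Matrix.one_mul]
    have h' : act Q (act B y) = ρ • act U (act Q y) := by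
      rw [← act_mul, h, ← act_mul]
      ext i
      simp [act, Matrix.smul_mulVec]
    rw [h', norm_smul, norm_act_orthogonal hU, Real.norm_of_nonneg hρ0]
  have hpow : ∀ j : ℕ, ‖act Q (act (B ^ j) x)‖ = ρ ^ j * ‖act Q x‖ := by
    intro j
    induction j with
    | zero => simp [act_one]
    | succ j ih => rw [act_pow_succ, hstep, ih, pow_succ]; ring
  have h0 : Tendsto (fun j : ℕ => act Q (act (B ^ j) x)) atTop (𝓝 0) := by
    rw [tendsto_zero_iff_norm_tendsto_zero]
    simp only [hpow]
    simpa using (tendsto_pow_atTop_nhds_zero_of_lt_one hρ0 hρ).mul_const ‖act Q x‖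
  have h1 := ((continuous_act Q⁻¹).tendsto 0).comp h0
  rw [act_zero] at h1
  refine h1.congr fun j => ?_
  simp only [Function.comp_apply]
  rw [← act_mul, Matrix.nonsing_inv_mul _ hQ, act_one]

theorem tendsto_act_invT_pow (hA : IsDilationMatrix A) (hd : d ≠ 0)
    {Q U : Matrix (Fin d) (Fin d) ℝ} (hQ : Q.PosDef)
    (hU : U ∈ Matrix.orthogonalGroup (Fin d) ℝ)
    (hfac : invT A = (|(toReal A).det| ^ (-(1 / (d : ℝ)))) • (Q⁻¹ * U * Q)) (x : Space d) :
    Tendsto (fun j : ℕ => act (invT A ^ j) x) atTop (𝓝 0) := by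
  refine tendsto_act_pow (Real.rpow_nonneg (abs_nonneg _) _) ?_
    ((Matrix.isUnit_iff_isUnit_det _).1 hQ.isUnit) hU hfac x
  refine Real.rpow_lt_one_of_one_lt_of_neg (hA.one_lt_abs_det hd) ?_
  have : (0 : ℝ) < d := by exact_mod_cast Nat.pos_of_ne_zero hd
  rw [neg_lt_zero]
  positivity

theorem act_invT_transpose (h : (toReal A).det ≠ 0) (x : Space d) :
    act (invT A) (act (toReal A.transpose) x) = x := by
  have ht : toReal A.transpose = (toReal A).transpose := rfl
  rw [← act_mul, invT, ht, Matrix.nonsing_inv_mul _ (by simpa using h), act_one]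

theorem act_transpose_invT (h : (toReal A).det ≠ 0) (x : Space d) :
    act (toReal A.transpose) (act (invT A) x) = x := by
  have ht : toReal A.transpose = (toReal A).transpose := rfl
  rw [← act_mul, invT, ht, Matrix.mul_nonsing_inv _ (by simpa using h), act_one]

theorem latticePt_add (m n : Fin d → ℤ) : latticePt (m + n) = latticePt m + latticePt n := by
  ext i; simp [latticePt]

theorem latticePt_neg (n : Fin d → ℤ) : latticePt (-n) = -latticePt n := by
  ext i; simp [latticePt]

theorem latticePt_sub (m n : Fin d → ℤ) : latticePt (m - n) = latticePt m - latticePt n := by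
  ext i; simp [latticePt]

theorem latticePt_zero : latticePt (0 : Fin d → ℤ) = 0 := by
  ext i; simp [latticePt]

theorem latticePt_injective : Function.Injective (latticePt (d := d)) := by
  intro m n h
  funext i
  have := congrArg (fun v : Space d => v i) h
  simpa [latticePt] using this

theorem act_toReal_latticePt (M : Matrix (Fin d) (Fin d) ℤ) (n : Fin d → ℤ) :
    act (toReal M) (latticePt n) = latticePt (M.mulVec n) := by
  ext i
  simp [act, latticePt, toReal, Matrix.mulVec, dotProduct]

theorem latticePt_eq_zero_of_norm_lt {n : Fin d → ℤ} (h : ‖latticePt n‖ < 1) : n = 0 := by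
  funext i
  have h1 : |(n i : ℝ)| < 1 := (PiLp.norm_apply_le (latticePt n) i).trans_lt h
  rw [← Int.cast_abs] at h1
  exact Int.abs_lt_one_iff.1 (by exact_mod_cast h1)

/-- The orbit tends to `0` and never reaches it, since `A^{-T}` is injective; as `0` is isolated in
the lattice, the orbit cannot stay there. -/
theorem exists_first_nonlattice (hdet : (toReal A).det ≠ 0) {n : Fin d → ℤ} (hn : n ≠ 0)
    (hlim : Tendsto (fun j : ℕ => act (invT A ^ j) (latticePt n)) atTop (𝓝 0)) :
    ∃ j : ℕ, (∀ l ≤ j, ∃ p, act (invT A ^ l) (latticePt n) = latticePt p) ∧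
      ∀ p, act (invT A ^ (j + 1)) (latticePt n) ≠ latticePt p := by
  classical
  have hex : ∃ l : ℕ, ∀ p, act (invT A ^ l) (latticePt n) ≠ latticePt p := by
    by_contra! hall
    obtain ⟨j, hj⟩ := (hlim.eventually (Metric.ball_mem_nhds 0 one_pos)).exists
    obtain ⟨p, hp⟩ := hall j
    rw [hp, dist_zero_right] at hj
    have hp0 := latticePt_eq_zero_of_norm_lt hj
    rw [hp0, latticePt_zero] at hp
    have hinj : ∀ l : ℕ, act (invT A ^ l) (latticePt n) ≠ 0 := by
      intro l
      induction l with
      | zero =>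
        rw [pow_zero, act_one, ← latticePt_zero]
        exact fun h => hn (latticePt_injective h)
      | succ l ih =>
        intro h
        rw [act_pow_succ] at h
        refine ih ?_
        rw [← act_transpose_invT hdet (act (invT A ^ l) (latticePt n)), h, act_zero]
    exact hinj j hp
  have h0 : Nat.find hex ≠ 0 := by
    intro h
    have := Nat.find_spec hex n
    rw [h, pow_zero, act_one] at this
    exact this rfl
  refine ⟨Nat.find hex - 1, fun l hl => ?_, ?_⟩
  · have := Nat.find_min hex (m := l) (by omega)
    push Not at this
    exact this
  · rw [Nat.sub_add_cancel (Nat.one_le_iff_ne_zero.2 h0)]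
    exact Nat.find_spec hex

end Dilation

/-! ### Trigonometric polynomials and masks -/

theorem trigEval_add_two_pi_smul (G : TrigPoly d) (ξ : Space d) (l : Fin d → ℤ) :
    trigEval G (ξ + (2 * Real.pi) • latticePt l) = trigEval G ξ := by
  refine Finsupp.sum_congr fun n _ => ?_
  congr 1
  rw [Complex.exp_eq_exp_iff_exists_int]
  refine ⟨∑ i, n i * l i, ?_⟩
  push_cast
  rw [Finset.mul_sum, Finset.mul_sum, Finset.sum_mul, ← Finset.sum_add_distrib]
  refine Finset.sum_congr rfl fun i _ => ?_
  simp [latticePt]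
  ring

theorem exists_hasJet_trigEval (G : TrigPoly d) (x : Space d) (r : ℕ) :
    ∃ T, HasJet r (fun η => trigEval G (x + η)) T := by
  refine HasJet.finset_sum _ fun n _ => ?_
  obtain ⟨L, hL⟩ : ∃ L : MvPolynomial (Fin d) ℂ,
      L = ∑ i, MvPolynomial.C (Complex.I * n i) * MvPolynomial.X i := ⟨_, rfl⟩
  have hL0 : L.coeff 0 = 0 := by
    rw [hL, MvPolynomial.coeff_sum]
    refine Finset.sum_eq_zero fun i _ => ?_
    rw [MvPolynomial.coeff_C_mul, MvPolynomial.coeff_zero_X, mul_zero]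
  obtain ⟨T, hT⟩ := HasJet.exp r hL0
  refine ⟨_, ((HasJet.const r (G n * Complex.exp (Complex.I *
    ((∑ i, (n i : ℝ) * x i : ℝ) : ℂ)))).mul hT).congr' (Eventually.of_forall fun η => ?_)⟩
  simp only
  rw [mul_assoc, ← Complex.exp_add]
  congr 2
  rw [hL, evalReal_sum]
  simp only [evalReal_mul, evalReal_C, evalReal_X]
  push_cast
  rw [Finset.mul_sum, Finset.mul_sum, ← Finset.sum_add_distrib]
  refine Finset.sum_congr rfl fun i _ => ?_
  simp only [PiLp.add_apply]
  push_cast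
  ring

section Mask

variable {A : Matrix (Fin d) (Fin d) ℤ} {G : TrigPoly d}

/-- The nonzero coset points as a finset. -/
def cosetFinset (A : Matrix (Fin d) (Fin d) ℤ) (h : (toReal A).det ≠ 0) : Finset (Space d) :=
  ((finite_cosetPoints A.transpose (by
    rwa [toReal_det, Matrix.det_transpose, ← toReal_det])).subset
      (Set.sdiff_subset (t := {0}))).toFinset

theorem mem_cosetFinset {h : (toReal A).det ≠ 0} {s : Space d} :
    s ∈ cosetFinset A h ↔ s ∈ cosetPoints A.transpose \ {0} := by
  simp [cosetFinset]

theorem mask_eq (h : (toReal A).det ≠ 0) (G : TrigPoly d) (ξ : Space d) :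
    mask A G ξ = (∏ s ∈ cosetFinset A h, trigEval G (ξ + (2 * Real.pi) • s)) /
      ∏ s ∈ cosetFinset A h, trigEval G ((2 * Real.pi) • s) := by
  rw [mask, finprod_mem_eq_finite_toFinset_prod, finprod_mem_eq_finite_toFinset_prod]
  rfl

theorem mask_add_two_pi_smul (h : (toReal A).det ≠ 0) (G : TrigPoly d) (ξ : Space d)
    (l : Fin d → ℤ) : mask A G (ξ + (2 * Real.pi) • latticePt l) = mask A G ξ := by
  rw [mask_eq h, mask_eq h]
  congr 1
  refine Finset.prod_congr rfl fun s _ => ?_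
  rw [add_right_comm, trigEval_add_two_pi_smul]

theorem mask_zero (h : (toReal A).det ≠ 0)
    (hG : ∀ s ∈ cosetPoints A.transpose \ {0}, trigEval G ((2 * Real.pi) • s) ≠ 0) :
    mask A G 0 = 1 := by
  rw [mask_eq h]
  simp only [zero_add]
  exact div_self (Finset.prod_ne_zero_iff.2 fun s hs => hG s (mem_cosetFinset.1 hs))

theorem exists_hasJet_mask (h : (toReal A).det ≠ 0) (G : TrigPoly d) (x : Space d) (r : ℕ) :
    ∃ T, HasJet r (fun η => mask A G (x + η)) T := by
  obtain ⟨T, hT⟩ := HasJet.finset_prod (r := r) (cosetFinset A h)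
    (f := fun s η => trigEval G (x + η + (2 * Real.pi) • s)) fun s _ => by
      obtain ⟨T, hT⟩ := exists_hasJet_trigEval G (x + (2 * Real.pi) • s) r
      exact ⟨T, hT.congr' (Eventually.of_forall fun η => by simp only [add_right_comm])⟩
  refine ⟨_, (hT.mul (HasJet.const r
    (∏ s ∈ cosetFinset A h, trigEval G ((2 * Real.pi) • s))⁻¹)).congr'
      (Eventually.of_forall fun η => ?_)⟩
  simp only
  rw [mask_eq h, div_eq_mul_inv]

theorem exists_add_latticePt_mem_cosetPoints {M : Matrix (Fin d) (Fin d) ℤ} {x : Space d}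
    (hx : ∃ p, act (toReal M) x = latticePt p) :
    ∃ l, x + latticePt l ∈ cosetPoints M := by
  obtain ⟨p, hp⟩ := hx
  refine ⟨fun i => -⌊x i⌋, fun i => ?_, p + M.mulVec fun i => -⌊x i⌋, ?_⟩
  · simp only [latticePt, PiLp.add_apply, Int.cast_neg, ← sub_eq_add_neg, Set.mem_Ico]
    exact ⟨Int.fract_nonneg _, Int.fract_lt_one _⟩
  · rw [act_add, hp, act_toReal_latticePt, latticePt_add]

theorem trigEval_ne_zero_of_coset
    (hG : ∀ s ∈ cosetPoints A.transpose \ {0}, trigEval G ((2 * Real.pi) • s) ≠ 0)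
    {x : Space d} (hx : ∃ p, act (toReal A.transpose) x = latticePt p)
    (hx' : ∀ p, x ≠ latticePt p) : trigEval G ((2 * Real.pi) • x) ≠ 0 := by
  obtain ⟨l, hl⟩ := exists_add_latticePt_mem_cosetPoints hx
  have h := hG _ ⟨hl, fun h0 => hx' (-l) ?_⟩
  · rwa [smul_add, trigEval_add_two_pi_smul] at h
  · rw [latticePt_neg]
    exact eq_neg_of_add_eq_zero_left h0

theorem eq_of_cosetPoints_sub {M : Matrix (Fin d) (Fin d) ℤ} {s t : Space d}
    (hs : s ∈ cosetPoints M) (ht : t ∈ cosetPoints M) {p : Fin d → ℤ}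
    (h : s - t = latticePt p) : s = t := by
  have hp : p = 0 := by
    funext i
    have h1 : s i - t i = p i := congrArg (fun v : Space d => v i) h
    have h2 := hs.1 i
    have h3 := ht.1 i
    have h4 : |(p i : ℝ)| < 1 := by
      rw [← h1, abs_lt]
      constructor <;> linarith [h2.1, h2.2, h3.1, h3.2]
    rw [← Int.cast_abs] at h4
    exact Int.abs_lt_one_iff.1 (by exact_mod_cast h4)
  rwa [hp, latticePt_zero, sub_eq_zero] at h

/-- At a point of `2π A^{-T} ℤ^d` outside `2π ℤ^d` the mask has the factor `G`. -/
theorem mask_factor (h : (toReal A).det ≠ 0)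
    (hG : ∀ s ∈ cosetPoints A.transpose \ {0}, trigEval G ((2 * Real.pi) • s) ≠ 0)
    {v : Space d} (hv : ∃ p, act (toReal A.transpose) v = latticePt p)
    (hv' : ∀ p, v ≠ latticePt p) :
    ∃ H : Space d → ℂ, (∀ r, ∃ T, HasJet r H T) ∧ H 0 ≠ 0 ∧
      ∀ ζ, mask A G ((2 * Real.pi) • v + ζ) = trigEval G ζ * H ζ := by
  classical
  obtain ⟨q, hq⟩ := hv
  have hneg : ∃ p, act (toReal A.transpose) (-v) = latticePt p := by
    refine ⟨-q, ?_⟩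
    rw [← neg_one_smul ℝ v, act_smul, hq, latticePt_neg, neg_one_smul]
  obtain ⟨l, hl⟩ := exists_add_latticePt_mem_cosetPoints hneg
  -- The factor of the mask with `s = t ≡ -v` is `G(ζ)` by periodicity.
  set t := -v + latticePt l with ht
  have ht0 : t ≠ 0 := fun h0 => hv' l (by
    rw [ht, neg_add_eq_sub, sub_eq_zero] at h0
    exact h0.symm)
  have htS : t ∈ cosetFinset A h := mem_cosetFinset.2 ⟨hl, ht0⟩
  set D := ∏ s ∈ cosetFinset A h, trigEval G ((2 * Real.pi) • s) with hD
  have hD0 : D ≠ 0 := Finset.prod_ne_zero_iff.2 fun s hs => hG s (mem_cosetFinset.1 hs)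
  refine ⟨fun ζ => (∏ s ∈ (cosetFinset A h).erase t,
    trigEval G ((2 * Real.pi) • (v + s) + ζ)) * D⁻¹, fun r => ?_, ?_, fun ζ => ?_⟩
  · obtain ⟨T, hT⟩ := HasJet.finset_prod (r := r) ((cosetFinset A h).erase t)
      (f := fun s ζ => trigEval G ((2 * Real.pi) • (v + s) + ζ))
      fun s _ => exists_hasJet_trigEval G _ r
    exact ⟨_, hT.mul (HasJet.const r _)⟩
  -- For `s ≠ t` the point `v + s` is a coset point outside the lattice, where `G` does not vanish.
  · refine mul_ne_zero (Finset.prod_ne_zero_iff.2 fun s hs => ?_) (inv_ne_zero hD0)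
    obtain ⟨hst, hs⟩ := Finset.mem_erase.1 hs
    have hsS := (mem_cosetFinset.1 hs).1
    obtain ⟨p, hp⟩ := hsS.2
    rw [add_zero]
    refine trigEval_ne_zero_of_coset hG ⟨q + p, by rw [act_add, hq, hp, latticePt_add]⟩
      fun p' hp' => hst (eq_of_cosetPoints_sub hsS hl (p := p' - l) ?_)
    rw [latticePt_sub, ← hp', ht]
    abel
  · rw [mask_eq h, ← Finset.mul_prod_erase _ _ htS, div_eq_mul_inv, mul_assoc]
    congr 1
    · rw [add_right_comm, ← smul_add, ht, add_neg_cancel_left, add_comm, trigEval_add_two_pi_smul]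
    congr 1
    refine Finset.prod_congr rfl fun s _ => ?_
    rw [add_right_comm, ← smul_add]

end Mask

/-! ### The Fourier transforms of the scaling functions -/

section Scaling

variable {A : Matrix (Fin d) (Fin d) ℤ} {m₀ : ℤ → Space d → ℂ}
  {φ : ℤ → 𝓢'(Space d, ℂ)} {φhat : ℤ → Space d → ℂ}

theorem prod_Icc_one_add {M : Type*} [CommMonoid M] (f : ℕ → M) (j N : ℕ) :
    ∏ i ∈ Finset.Icc 1 (j + N), f i =
      (∏ i ∈ Finset.Icc 1 j, f i) * ∏ i ∈ Finset.Icc 1 N, f (j + i) := by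
  induction N with
  | zero => simp
  | succ N ih =>
    rw [← add_assoc, Finset.prod_Icc_succ_top (by omega), ih, Finset.prod_Icc_succ_top (by omega),
      mul_assoc, add_assoc]

theorem IsNonstationaryScaling.fourier_eq_prod (hφ : IsNonstationaryScaling A m₀ φ φhat)
    (j : ℕ) (ξ : Space d) :
    φhat 0 ξ = (∏ l ∈ Finset.Icc 1 j, m₀ l (act (invT A ^ l) ξ)) *
      φhat j (act (invT A ^ j) ξ) := by
  have h1 := (hφ.product 0 ξ).comp (tendsto_add_atTop_nat j)
  have h2 := (hφ.product j (act (invT A ^ j) ξ)).const_mul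
    (∏ l ∈ Finset.Icc 1 j, m₀ l (act (invT A ^ l) ξ))
  refine tendsto_nhds_unique h1 (h2.congr fun N => ?_)
  simp only [Function.comp_apply]
  rw [add_comm N j, prod_Icc_one_add]
  congr 1
  · exact Finset.prod_congr rfl fun l _ => by rw [zero_add]
  · refine Finset.prod_congr rfl fun i _ => ?_
    rw [← act_mul, ← pow_add, add_comm i j, zero_add]
    push_cast
    rfl

theorem IsNonstationaryScaling.fourier_zero (hφ : IsNonstationaryScaling A m₀ φ φhat)
    (hm : ∀ j, m₀ j 0 = 1) (n : ℤ) : φhat n 0 = 1 := by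
  refine tendsto_nhds_unique (hφ.product n 0) ?_
  simp [act_zero, hm]

end Scaling

/-- Near `2πn`, the Fourier transform of an elliptic scaling function is a multiple of
`X + W ^ m`, up to terms of higher order. -/
theorem exists_hasJet_fourier {m : ℕ} {A : Matrix (Fin d) (Fin d) ℤ}
    (h : (toReal A).det ≠ 0) {P : MvPolynomial (Fin d) ℂ} {G : ℤ → TrigPoly d} {C : ℤ → ℂ}
    (hC : ∀ j, C j ≠ 0)
    (hG : ∀ j, ∀ s ∈ cosetPoints A.transpose \ {0}, trigEval (G j) ((2 * Real.pi) • s) ≠ 0)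
    (hexp : ∀ j : ℕ, HasJet m (fun ξ => trigEval (G j) (act (invT A ^ j) ξ))
      (MvPolynomial.C (C j) * P))
    {φ : ℤ → 𝓢'(Space d, ℂ)} {φhat : ℤ → Space d → ℂ}
    (hφ : IsNonstationaryScaling A (fun j => mask A (G j)) φ φhat)
    {j : ℕ} {n : Fin d → ℤ}
    (hn : ∀ l ≤ j, ∃ p, act (invT A ^ l) (latticePt n) = latticePt p)
    (hn' : ∀ p, act (invT A ^ (j + 1)) (latticePt n) ≠ latticePt p) :
    ∃ H : MvPolynomial (Fin d) ℂ,
      HasJet m (fun η => φhat 0 ((2 * Real.pi) • latticePt n + η)) (P * H) ∧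
      (φhat (j + 1 : ℕ) ((2 * Real.pi) • act (invT A ^ (j + 1)) (latticePt n)) ≠ 0 →
        H.coeff 0 ≠ 0) := by
  set v := act (invT A ^ (j + 1)) (latticePt n) with hv
  have hv1 : ∃ p, act (toReal A.transpose) v = latticePt p := by
    obtain ⟨p, hp⟩ := hn j le_rfl
    refine ⟨p, ?_⟩
    rw [hv, act_pow_succ, act_transpose_invT h, hp]
  obtain ⟨H₁, hH₁, hH₁0, hmask⟩ := mask_factor h (hG (j + 1 : ℕ)) hv1 hn'
  obtain ⟨T₁, hT₁⟩ := hH₁ m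
  obtain ⟨T₂, hT₂⟩ : ∃ T, HasJet m (fun η => ∏ l ∈ Finset.Icc 1 j,
      mask A (G l) (act (invT A ^ l) η)) T := HasJet.finset_prod _ fun l _ => by
    obtain ⟨T, hT⟩ := exists_hasJet_mask h (G l) 0 m
    simp only [zero_add] at hT
    exact ⟨_, hT.comp_act (invT A ^ l)⟩
  obtain ⟨T₃, hT₃⟩ := (hφ.fourier (j + 1 : ℕ)).exists_hasJet (hφ.compact_support _)
    ((2 * Real.pi) • v) m
  have hT₁' := hT₁.comp_act (invT A ^ (j + 1))
  have hT₃' := hT₃.comp_act (invT A ^ (j + 1))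
  have hall := ((hexp (j + 1)).mul hT₁').mul (hT₂.mul hT₃')
  -- The first `j` masks sit at points of `2πℤ^d` and lose the shift by periodicity, mask `j + 1`
  -- contributes `G` and `H₁`, and the rest of the product is the Fourier transform of index `j +
  -- 1`.
  have hprod : ∀ η, φhat 0 ((2 * Real.pi) • latticePt n + η) =
      trigEval (G (j + 1 : ℕ)) (act (invT A ^ (j + 1)) η) * H₁ (act (invT A ^ (j + 1)) η) *
        ((∏ l ∈ Finset.Icc 1 j, mask A (G l) (act (invT A ^ l) η)) *
          φhat (j + 1 : ℕ) ((2 * Real.pi) • v + act (invT A ^ (j + 1)) η)) := by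
    intro η
    have hact : ∀ l, act (invT A ^ l) ((2 * Real.pi) • latticePt n + η) =
        (2 * Real.pi) • act (invT A ^ l) (latticePt n) + act (invT A ^ l) η := fun l => by
      rw [act_add, act_smul]
    rw [hφ.fourier_eq_prod (j + 1), Finset.prod_Icc_succ_top (by omega), hact (j + 1), ← hv,
      hmask]
    have : ∏ l ∈ Finset.Icc 1 j, mask A (G l) (act (invT A ^ l)
        ((2 * Real.pi) • latticePt n + η)) =
        ∏ l ∈ Finset.Icc 1 j, mask A (G l) (act (invT A ^ l) η) := by
      refine Finset.prod_congr rfl fun l hl => ?_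
      obtain ⟨p, hp⟩ := hn l (Finset.mem_Icc.1 hl).2
      rw [hact, hp, add_comm, mask_add_two_pi_smul h]
    rw [this]
    ring
  have hT₂0 : T₂.coeff 0 = 1 := by
    rw [← hT₂.apply_zero]
    refine Finset.prod_eq_one fun l _ => ?_
    rw [act_zero, mask_zero h (hG l)]
  set R₁ := MvPolynomial.bind₁ (fun i => ∑ j', MvPolynomial.C (((invT A ^ (j + 1)) i j' : ℝ) : ℂ) *
    MvPolynomial.X j') T₁ with hR₁
  set R₃ := MvPolynomial.bind₁ (fun i => ∑ j', MvPolynomial.C (((invT A ^ (j + 1)) i j' : ℝ) : ℂ) *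
    MvPolynomial.X j') T₃ with hR₃
  refine ⟨MvPolynomial.C (C (j + 1 : ℕ)) * R₁ * (T₂ * R₃), ?_, fun hne => ?_⟩
  · have hpoly : P * (MvPolynomial.C (C (j + 1 : ℕ)) * R₁ * (T₂ * R₃)) =
        MvPolynomial.C (C (j + 1 : ℕ)) * P * R₁ * (T₂ * R₃) := by ring
    rw [hpoly]
    exact hall.congr' (Eventually.of_forall fun η => (hprod η).symm)
  · have h1 : R₁.coeff 0 ≠ 0 := by
      rw [← hT₁'.apply_zero, act_zero]
      exact hH₁0
    have h3 : R₃.coeff 0 ≠ 0 := by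
      rw [← hT₃'.apply_zero, act_zero, add_zero]
      exact hne
    simp only [← MvPolynomial.constantCoeff_eq, map_mul] at *
    simp only [MvPolynomial.constantCoeff_C, hT₂0, one_mul]
    exact mul_ne_zero (mul_ne_zero (hC _) h1) h3

/-! ### Polynomial reproduction -/

theorem totalDegree_symbolOp_le (T p : MvPolynomial (Fin d) ℂ) :
    (symbolOp T p).totalDegree ≤ p.totalDegree := by
  have key : ∀ n, p.totalDegree < n →
      MvPolynomial.homogeneousComponent n (symbolOp T p) = 0 := by
    intro n hn
    induction T using MvPolynomial.induction_on' with
    | monomial a c =>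
      rw [homogeneousComponent_symbolOp (MvPolynomial.isHomogeneous_monomial c rfl),
        MvPolynomial.homogeneousComponent_eq_zero _ _ (by omega), map_zero]
    | add T T' ih ih' => rw [symbolOp_add, LinearMap.add_apply, map_add, ih, ih', add_zero]
  refine Finset.sup_le fun b hb => ?_
  by_contra! hlt
  refine MvPolynomial.mem_support_iff.1 hb ?_
  have hdeg : b.degree = b.sum fun _ e => e := rfl
  have h := congrArg (MvPolynomial.coeff b) (key b.degree (by rwa [hdeg]))
  rwa [MvPolynomial.coeff_homogeneousComponent, if_pos rfl, MvPolynomial.coeff_zero] at h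

section Reproduction

variable {φ : 𝓢'(Space d, ℂ)} {g : Space d → ℂ}

/-- An integer shift only renumbers the coefficients, and integer shifts suffice. -/
theorem isShiftInvariant_reproduced (φ : 𝓢'(Space d, ℂ)) : IsShiftInvariant (reproduced φ) := by
  refine isShiftInvariant_of_int fun P hP n => ?_
  obtain ⟨c, hc⟩ := hP
  refine ⟨fun k => c (k + n), fun ψ hψ => ?_⟩
  have hcomp : ∀ k : Fin d → ℤ, SchwartzMap.compSubConstCLM ℂ (-latticePt (k + n))
      (SchwartzMap.compSubConstCLM ℂ (latticePt n) ψ) =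
      SchwartzMap.compSubConstCLM ℂ (-latticePt k) ψ := by
    intro k
    ext x
    simp only [SchwartzMap.compSubConstCLM_apply, latticePt_add]
    congr 1
    abel
  have hsupp : HasCompactSupport (SchwartzMap.compSubConstCLM ℂ (latticePt n) ψ) :=
    hψ.comp_homeomorph (Homeomorph.subRight (latticePt n))
  have h := (Equiv.addRight n).hasSum_iff.2 (hc _ hsupp)
  have hint : ∫ x, evalReal P x * SchwartzMap.compSubConstCLM ℂ (latticePt n) ψ x =
      ∫ x, evalReal (shiftHom (fun i => algebraMap ℝ ℂ (n i)) P) x * ψ x := by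
    rw [← MeasureTheory.integral_add_right_eq_self _ (latticePt n)]
    refine MeasureTheory.integral_congr_ae (Eventually.of_forall fun x => ?_)
    simp only [SchwartzMap.compSubConstCLM_apply, add_sub_cancel_right]
    congr 1
    rw [evalReal, evalReal, eval_shiftHom]
    congr 2
    funext i
    simp [latticePt]
  rw [← hint]
  refine h.congr_fun fun k => ?_
  simp only [Function.comp_apply, Equiv.coe_addRight, hcomp]

theorem IsFourierTransform.hasJet_fourierInt_shiftPairing (hg : IsFourierTransform φ g)
    (hφ : IsCompact (dsupport φ)) {ψ : 𝓢(Space d, ℂ)} (hψ : HasCompactSupport ψ)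
    {ξ₀ : Space d} {r : ℕ} {T : MvPolynomial (Fin d) ℂ} (hT : HasJet r (fun η => g (ξ₀ + η)) T) :
    HasJet r (fourierInt fun y => shiftPairing φ ψ y * wave (-ξ₀) y)
      (momentPoly r (fun y => ψ (-y) * wave (-ξ₀) y) *
        (MvPolynomial.C (fourierConst d)⁻¹ * T)) := by
  have h := (hasJet_fourierInt (continuous_comp_neg_mul_wave ψ.continuous ξ₀)
    (hasCompactSupport_comp_neg_mul_wave hψ ξ₀) r).mul ((HasJet.const r (fourierConst d)⁻¹).mul hT)
  refine h.congr' (Eventually.of_forall fun η => ?_)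
  simp only
  rw [hg.fourierInt_shiftPairing hφ hψ]
  ring

theorem hasCompactSupport_evalReal_neg_mul {w : Space d → ℂ} (hwc : HasCompactSupport w)
    (p : MvPolynomial (Fin d) ℂ) : HasCompactSupport fun y => evalReal p (0 - y) * w y :=
  hwc.mul_left

/-- The Strang–Fix conditions imply polynomial reproduction. -/
theorem isReproduced_of_hasJet (hg : IsFourierTransform φ g) (hφ : IsCompact (dsupport φ))
    {p : MvPolynomial (Fin d) ℂ} {r : ℕ} (hp : p.totalDegree ≤ r) (hg0 : g 0 ≠ 0)
    (hT : ∀ n : Fin d → ℤ, n ≠ 0 → ∃ T,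
      HasJet r (fun η => g ((2 * Real.pi) • latticePt n + η)) T ∧ symbolOp T p = 0) :
    IsReproduced φ p := by
  obtain ⟨T₀, hT₀⟩ := hg.exists_hasJet hφ 0 r
  have hT₀0 : T₀.coeff 0 ≠ 0 := by
    rw [← hT₀.apply_zero, add_zero]
    exact hg0
  -- The mapping `q ↦ ∑ q(k) φ(· - k)` is expected to act on `q` with the symbol `g`, up to the
  -- factor `(2π)^{d/2}`; inverting it to order `r` gives the coefficients.
  obtain ⟨S, hS⟩ := exists_approx_inverse r hT₀0
  set q := symbolOp (MvPolynomial.C (fourierConst d) * S) p with hq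
  have hqr : q.totalDegree ≤ r := (totalDegree_symbolOp_le _ _).trans hp
  refine ⟨fun k => evalReal q (latticePt k), fun ψ hψ => ?_⟩
  set u := shiftPairing φ ψ with hu
  have huc : HasCompactSupport u := hg.hasCompactSupport_shiftPairing hφ hψ
  have hucont : Continuous u := continuous_shiftPairing φ hψ
  have hneg : Continuous fun y : Space d => evalReal q (0 - y) :=
    (continuous_evalReal q).comp (continuous_const.sub continuous_id)
  have hjet := fun (ξ₀ : Space d) (T : MvPolynomial (Fin d) ℂ)
      (hT : HasJet r (fun η => g (ξ₀ + η)) T) =>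
    integral_evalReal_sub_mul (w := fun y => u y * wave (-ξ₀) y)
      (hucont.mul (continuous_wave (-ξ₀))) huc.mul_right
      (hg.hasJet_fourierInt_shiftPairing hφ hψ hT) hqr 0
  -- The expansion at `2πn` annihilates `p`, hence also `q`, because the operators commute.
  have hvan : ∀ n : Fin d → ℤ, n ≠ 0 →
      fourierInt (fun y => evalReal q (0 - y) * u y) ((2 * Real.pi) • latticePt n) = 0 := by
    intro n hn
    obtain ⟨T, hTj, hTp⟩ := hT n hn
    have h := hjet _ T hTj
    simp only [← mul_assoc] at h
    rw [fourierInt, h, hq, ← symbolOp_mul, mul_right_comm, mul_comm, mul_assoc, mul_comm T,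
      symbolOp_mul, hTp, map_zero]
    simp [evalReal]
  have hval : ∫ y, evalReal q (0 - y) * u y = ∫ x, evalReal p x * ψ x := by
    have h := hjet 0 T₀ hT₀
    simp only [neg_zero, wave_zero_left, mul_one] at h
    have h1 : symbolOp (T₀ * S) p = p := by
      have hone : symbolOp (MvPolynomial.C (1 : ℂ)) p = p := by rw [symbolOp_C, one_smul]
      rw [hS.symbolOp_eq (HasJet.const r 1) hp, hone]
    rw [h, hq, ← LinearMap.comp_apply, ← Module.End.mul_eq_comp, Module.End.mul_apply,
      ← symbolOp_mul]
    have h2 : momentPoly r (fun y => ψ (-y)) * (MvPolynomial.C (fourierConst d)⁻¹ * T₀) *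
        (MvPolynomial.C (fourierConst d) * S) = momentPoly r (fun y => ψ (-y)) * (T₀ * S) := by
      have hc : (MvPolynomial.C (fourierConst d)⁻¹ * MvPolynomial.C (fourierConst d) :
          MvPolynomial (Fin d) ℂ) = 1 := by
        rw [← MvPolynomial.C_mul, inv_mul_cancel₀ (fourierConst_ne_zero d), MvPolynomial.C_1]
      calc _ = momentPoly r (fun y => ψ (-y)) * (T₀ * S) *
            (MvPolynomial.C (fourierConst d)⁻¹ * MvPolynomial.C (fourierConst d)) := by ring
        _ = _ := by rw [hc, mul_one]
    have hψn : HasCompactSupport fun y => ψ (-y) :=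
      hψ.comp_homeomorph (Homeomorph.neg (Space d))
    have hψnc : Continuous fun y => ψ (-y) := ψ.continuous.comp continuous_neg
    rw [h2, symbolOp_mul, h1,
      ← integral_evalReal_sub_mul hψnc hψn (hasJet_fourierInt hψnc hψn r) hp 0,
      ← MeasureTheory.integral_neg_eq_self]
    refine MeasureTheory.integral_congr_ae (Eventually.of_forall fun y => ?_)
    simp
  have h := hasSum_latticePt_of_fourierInt_eq_zero
    (w := fun y => evalReal q (0 - y) * u y) (hneg.mul hucont)
    (hasCompactSupport_evalReal_neg_mul huc q) hvan
  rw [hval] at h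
  -- Poisson summation yields `q(-n) ⟨φ, ψ(· - n)⟩`; the substitution `k = -n` matches the sign
  -- convention of `IsReproduced`.
  refine ((Equiv.neg (Fin d → ℤ)).hasSum_iff.2 h).congr_fun fun k => ?_
  simp only [Function.comp_apply, Equiv.neg_apply, latticePt_neg, sub_neg_eq_add, zero_add]
  rfl

end Reproduction

/-! ### An obstruction to polynomial reproduction -/

theorem symbolOp_apply_C (T : MvPolynomial (Fin d) ℂ) (c : ℂ) :
    symbolOp T (MvPolynomial.C c) = MvPolynomial.C (T.coeff 0 * c) := by
  rw [symbolOp_congr (T' := MvPolynomial.C (T.coeff 0)) (r := 0) ?_ (by simp), symbolOp_C,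
    MvPolynomial.smul_eq_C_mul, ← MvPolynomial.C_mul]
  intro a ha
  obtain rfl : a = 0 := (Finsupp.degree_eq_zero_iff a).1 (Nat.le_zero.1 ha)
  rw [MvPolynomial.coeff_zero_C]

/-- On the line along the coordinate `i` scaled by `1 / n i` the wave is `e^{2πit}`. At integers `t`
it equals `1`, which forces the polynomial to be the constant `α`; at `t = 1/2` it equals `-1`, so
`α = -α`. -/
theorem eq_zero_of_evalReal_eq_wave_mul {b : MvPolynomial (Fin d) ℂ} {n : Fin d → ℤ} (hn : n ≠ 0)
    {α : ℂ} (h : ∀ x, evalReal b x = wave ((2 * Real.pi) • latticePt n) x * α) : α = 0 := by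
  obtain ⟨i, hi⟩ := Function.ne_iff.1 hn
  have hi' : (n i : ℝ) ≠ 0 := by exact_mod_cast hi
  set v : Space d := EuclideanSpace.single i (n i : ℝ)⁻¹ with hv
  set q : Polynomial ℂ := ∑ l ∈ Finset.range (b.totalDegree + 1),
    Polynomial.C (evalReal (MvPolynomial.homogeneousComponent l b) v) * Polynomial.X ^ l with hq
  have hqt : ∀ t : ℝ, q.eval (t : ℂ) = Complex.exp (2 * Real.pi * Complex.I * t) * α := by
    intro t
    have h1 : q.eval (t : ℂ) = evalReal b (t • v) := by
      rw [evalReal_smul_eq_sum, hq, Polynomial.eval_finsetSum]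
      refine Finset.sum_congr rfl fun l _ => ?_
      rw [Polynomial.eval_mul, Polynomial.eval_C, Polynomial.eval_pow, Polynomial.eval_X, mul_comm]
    rw [h1, h, wave]
    congr 2
    have h2 : ∑ j, ((2 * Real.pi) • latticePt n) j * (t • v) j = 2 * Real.pi * t := by
      rw [Finset.sum_eq_single i]
      · simp [hv, latticePt]
        field_simp
      · intro j _ hj
        simp [hv, hj]
      · simp
    rw [h2]
    push_cast
    ring
  have hconst : q = Polynomial.C α := by
    refine Polynomial.eq_of_infinite_eval_eq _ _ ?_
    refine (Set.infinite_range_of_injective (f := fun t : ℕ => (t : ℂ))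
      Nat.cast_injective).mono ?_
    rintro _ ⟨t, rfl⟩
    have ht := hqt t
    have hexp : Complex.exp (2 * Real.pi * Complex.I * (t : ℝ)) = 1 := by
      rw [Complex.exp_eq_one_iff]
      exact ⟨t, by push_cast; ring⟩
    rw [hexp, one_mul] at ht
    simpa using ht
  have hhalf := hqt (1 / 2)
  have hexp : Complex.exp (2 * Real.pi * Complex.I * ((1 / 2 : ℝ) : ℂ)) = -1 := by
    rw [← Complex.exp_pi_mul_I]
    congr 1
    push_cast
    ring
  rw [hconst, Polynomial.eval_C, hexp, neg_one_mul] at hhalf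
  exact self_eq_neg.1 hhalf

theorem wave_two_pi_smul_latticePt (n k : Fin d → ℤ) :
    wave ((2 * Real.pi) • latticePt n) (latticePt k) = 1 := by
  rw [wave, Complex.exp_eq_one_iff]
  refine ⟨∑ i, n i * k i, ?_⟩
  push_cast
  rw [Finset.mul_sum, Finset.sum_mul]
  refine Finset.sum_congr rfl fun i _ => ?_
  simp [latticePt]
  ring

theorem finite_norm_latticePt_le (M : ℝ) : {k : Fin d → ℤ | ‖latticePt k‖ ≤ M}.Finite := by
  refine (finite_norm_intVec_le (max M 0)).subset fun k hk => ?_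
  refine (pi_norm_le_iff_of_nonneg (le_max_right _ _)).2 fun i => ?_
  exact (PiLp.norm_apply_le (latticePt k) i).trans (le_trans hk (le_max_left _ _))

theorem hasSum_integral_mul {u v p : Space d → ℂ} (hu : Continuous u) (huc : HasCompactSupport u)
    (hv : Continuous v) (hvc : HasCompactSupport v) {c : (Fin d → ℤ) → ℂ}
    (hp : ∀ y, HasSum (fun k => c k * u (y - latticePt k)) (p y)) :
    HasSum (fun k => c k * ∫ y, u (y - latticePt k) * v y) (∫ y, p y * v y) := by
  obtain ⟨R₁, -, hR₁⟩ := exists_tsupport_subset_closedBall huc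
  obtain ⟨R₂, -, hR₂⟩ := exists_tsupport_subset_closedBall hvc
  set F := (finite_norm_latticePt_le (d := d) (R₁ + R₂)).toFinset with hF
  have hzero : ∀ k ∉ F, ∀ y, u (y - latticePt k) * v y = 0 := by
    intro k hk y
    by_contra hne
    obtain ⟨h1, h2⟩ := mul_ne_zero_iff.1 hne
    have h1' := mem_closedBall_zero_iff.1 (hR₁ (subset_tsupport _ h1))
    have h2' := mem_closedBall_zero_iff.1 (hR₂ (subset_tsupport _ h2))
    refine hk ?_
    simp only [hF, Set.Finite.mem_toFinset, Set.mem_ofPred_eq]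
    calc ‖latticePt k‖ = ‖y - (y - latticePt k)‖ := by rw [sub_sub_cancel]
      _ ≤ ‖y‖ + ‖y - latticePt k‖ := norm_sub_le _ _
      _ ≤ R₁ + R₂ := by linarith
  have hint : ∀ k, MeasureTheory.Integrable fun y => u (y - latticePt k) * v y := fun k =>
    ((hu.comp (continuous_id.sub continuous_const)).mul hv).integrable_of_hasCompactSupport
      hvc.mul_left
  have hpy : ∀ y, p y * v y = ∑ k ∈ F, c k * (u (y - latticePt k) * v y) := by
    intro y
    have h1 := (hp y).mul_right (v y)
    simp only [mul_assoc] at h1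
    exact h1.unique (hasSum_sum_of_ne_finset_zero fun k hk => by rw [hzero k hk, mul_zero])
  have hval : ∫ y, p y * v y = ∑ k ∈ F, c k * ∫ y, u (y - latticePt k) * v y := by
    simp only [hpy]
    rw [MeasureTheory.integral_finsetSum _ fun k _ => (hint k).const_mul _]
    simp only [MeasureTheory.integral_const_mul]
  rw [hval]
  exact hasSum_sum_of_ne_finset_zero fun k hk => by simp [hzero k hk]

/-- The substitution `y ↦ τ + k - y` exchanges the two functions. That the wave is `1` at lattice
points keeps the phase independent of `k`. -/
theorem integral_sub_latticePt_mul_wave (u₁ u₂ : Space d → ℂ) (n k : Fin d → ℤ) (τ : Space d) :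
    ∫ y, u₁ (y - latticePt k) * (wave ((2 * Real.pi) • latticePt n) y * u₂ (τ - y)) =
      wave ((2 * Real.pi) • latticePt n) τ *
        ∫ y, u₂ (y - latticePt k) * (wave (-((2 * Real.pi) • latticePt n)) y * u₁ (τ - y)) := by
  rw [← MeasureTheory.integral_sub_left_eq_self _ _ (τ + latticePt k),
    ← MeasureTheory.integral_const_mul]
  refine MeasureTheory.integral_congr_ae (Eventually.of_forall fun y => ?_)
  simp only
  rw [sub_eq_add_neg (τ + latticePt k) y, wave_add_right, wave_add_right,
    wave_two_pi_smul_latticePt, wave_neg_right, mul_one]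
  have h1 : τ + latticePt k + -y - latticePt k = τ - y := by abel
  have h2 : τ - (τ + latticePt k + -y) = y - latticePt k := by abel
  rw [h1, h2]
  ring

section Reproduction

variable {φ : 𝓢'(Space d, ℂ)} {g : Space d → ℂ}

theorem hasSum_shiftPairing {R : MvPolynomial (Fin d) ℂ} {r : ℕ} (hR : R.totalDegree ≤ r)
    {c : (Fin d → ℤ) → ℂ}
    (hc : ∀ ψ : 𝓢(Space d, ℂ), HasCompactSupport ψ →
      HasSum (fun k => c k * φ (SchwartzMap.compSubConstCLM ℂ (-latticePt k) ψ))
        (∫ x, evalReal R x * ψ x))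
    {ψ : 𝓢(Space d, ℂ)} (hψ : HasCompactSupport ψ) (y : Space d) :
    HasSum (fun k => c k * shiftPairing φ ψ (y - latticePt k))
      (evalReal (symbolOp (momentPoly r fun z => ψ (-z)) R) y) := by
  have hsupp : HasCompactSupport (SchwartzMap.compSubConstCLM ℂ y ψ) :=
    hψ.comp_homeomorph (Homeomorph.subRight y)
  have h := hc _ hsupp
  have hψn : HasCompactSupport fun y => ψ (-y) := hψ.comp_homeomorph (Homeomorph.neg (Space d))
  have hψnc : Continuous fun y => ψ (-y) := ψ.continuous.comp continuous_neg
  have hval : ∫ x, evalReal R x * SchwartzMap.compSubConstCLM ℂ y ψ x =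
      evalReal (symbolOp (momentPoly r fun z => ψ (-z)) R) y := by
    rw [← integral_evalReal_sub_mul hψnc hψn (hasJet_fourierInt hψnc hψn r) hR,
      ← MeasureTheory.integral_sub_left_eq_self _ _ y]
    refine MeasureTheory.integral_congr_ae (Eventually.of_forall fun z => ?_)
    simp only [SchwartzMap.compSubConstCLM_apply]
    rw [sub_sub_cancel_left]
  rw [hval] at h
  refine h.congr_fun fun k => ?_
  rw [shiftPairing]
  congr 2
  ext x
  simp only [SchwartzMap.compSubConstCLM_apply]
  congr 1
  abel

theorem integral_evalReal_mul_wave {u : Space d → ℂ} (hu : Continuous u)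
    (huc : HasCompactSupport u) {ξ : Space d} {r : ℕ} {T p : MvPolynomial (Fin d) ℂ}
    (hT : HasJet r (fourierInt fun y => u y * wave (-ξ) y) T) (hp : p.totalDegree ≤ r)
    (τ : Space d) :
    ∫ y, evalReal p y * (wave ξ y * u (τ - y)) = wave ξ τ * evalReal (symbolOp T p) τ := by
  rw [← integral_evalReal_sub_mul (w := fun y => u y * wave (-ξ) y)
      (hu.mul (continuous_wave (-ξ))) huc.mul_right hT hp,
    ← MeasureTheory.integral_sub_left_eq_self _ _ τ, ← MeasureTheory.integral_const_mul]
  refine MeasureTheory.integral_congr_ae (Eventually.of_forall fun y => ?_)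
  simp only
  rw [sub_sub_cancel, sub_eq_add_neg, wave_add_right, wave_neg_right]
  ring

/-- Regularizing `R = ∑ e_k φ(· - k)` by two test functions gives polynomials `p₁`, `p₂` with `p_i =
∑ e_k u_i(· - k)`. The sum over `k` of `e_k ∫ u₁(y - k) e^{iξ·y} u₂(τ - y) dy` is then computed
twice. Through `p₁` it is `e^{iξ·τ}` times a constant, a nonzero multiple of `c`; after exchanging
`u₁` and `u₂`, it is a polynomial in `τ`, obtained from `p₂`. For `ξ ≠ 0` in `2πℤ^d` this is
impossible. -/
theorem not_isReproduced_of_hasJet (hg : IsFourierTransform φ g) (hφ : IsCompact (dsupport φ))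
    {R : MvPolynomial (Fin d) ℂ} {r : ℕ} (hR : R.totalDegree ≤ r) {n : Fin d → ℤ} (hn : n ≠ 0)
    {T : MvPolynomial (Fin d) ℂ}
    (hT : HasJet r (fun η => g ((2 * Real.pi) • latticePt n + η)) T) {c : ℂ} (hc : c ≠ 0)
    (hTR : symbolOp T R = MvPolynomial.C c) : ¬ IsReproduced φ R := by
  rintro ⟨e, he⟩
  set ξ : Space d := (2 * Real.pi) • latticePt n with hξ
  obtain ⟨f⟩ : Nonempty (ContDiffBump (0 : Space d)) := inferInstance
  -- The frequencies `0` and `-ξ` make the constant terms of both `M₁` and `M₂` equal to the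
  -- positive integral of the bump function.
  set ψ₁ := cutWave f 0 with hψ₁
  set ψ₂ := cutWave f (-ξ) with hψ₂
  have hc₁ : HasCompactSupport ψ₁ := hasCompactSupport_cutWave f _
  have hc₂ : HasCompactSupport ψ₂ := hasCompactSupport_cutWave f _
  have hf : ∫ x, ((f x : ℝ) : ℂ) ≠ 0 := by
    rw [integral_complex_ofReal]
    exact Complex.ofReal_ne_zero.2 f.integral_pos.ne'
  set u₁ := shiftPairing φ ψ₁ with hu₁
  set u₂ := shiftPairing φ ψ₂ with hu₂
  have hu₁c : Continuous u₁ := continuous_shiftPairing φ hc₁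
  have hu₂c : Continuous u₂ := continuous_shiftPairing φ hc₂
  have hu₁s : HasCompactSupport u₁ := hg.hasCompactSupport_shiftPairing hφ hc₁
  have hu₂s : HasCompactSupport u₂ := hg.hasCompactSupport_shiftPairing hφ hc₂
  set M₁ := momentPoly r fun z => ψ₁ (-z) with hM₁
  set p₁ := symbolOp M₁ R with hp₁
  set p₂ := symbolOp (momentPoly r fun z => ψ₂ (-z)) R with hp₂
  have hp₁r : p₁.totalDegree ≤ r := (totalDegree_symbolOp_le _ _).trans hR
  have hp₂r : p₂.totalDegree ≤ r := (totalDegree_symbolOp_le _ _).trans hR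
  set M₂ := momentPoly r fun y => ψ₂ (-y) * wave (-ξ) y with hM₂
  have hneg : ∀ {u : Space d → ℂ}, HasCompactSupport u → ∀ τ,
      HasCompactSupport fun y => u (τ - y) :=
    fun hu τ => hu.comp_homeomorph (Homeomorph.subLeft τ)
  have hjet₁ := hasJet_fourierInt (w := fun y => u₁ y * wave (- -ξ) y)
    (hu₁c.mul (continuous_wave _)) hu₁s.mul_right r
  have hjet₂ := hg.hasJet_fourierInt_shiftPairing hφ hc₂ hT
  have hM₁0 : M₁.coeff 0 = ∫ x, ((f x : ℝ) : ℂ) := by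
    have hψn : HasCompactSupport fun y => ψ₁ (-y) :=
      hc₁.comp_homeomorph (Homeomorph.neg (Space d))
    have hψnc : Continuous fun y => ψ₁ (-y) := ψ₁.continuous.comp continuous_neg
    rw [hM₁, ← (hasJet_fourierInt hψnc hψn r).apply_zero, fourierInt,
      ← MeasureTheory.integral_neg_eq_self]
    refine MeasureTheory.integral_congr_ae (Eventually.of_forall fun y => ?_)
    simp [hψ₁, cutWave_apply, wave_zero_left]
  have hM₂0 : M₂.coeff 0 = ∫ x, ((f x : ℝ) : ℂ) := by
    rw [hM₂, ← (hasJet_fourierInt (continuous_comp_neg_mul_wave ψ₂.continuous ξ)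
      (hasCompactSupport_comp_neg_mul_wave hc₂ ξ) r).apply_zero, fourierInt,
      ← MeasureTheory.integral_neg_eq_self]
    refine MeasureTheory.integral_congr_ae (Eventually.of_forall fun y => ?_)
    simp only [hψ₂, cutWave_apply, neg_neg, neg_zero, wave_zero_left, mul_one]
    rw [wave_neg_right, neg_neg, mul_assoc, wave_neg_mul, mul_one]
  -- Once `T` has produced a constant, the remaining operators act only through their constant
  -- terms.
  have hconst : symbolOp (M₂ * (MvPolynomial.C (fourierConst d)⁻¹ * T)) p₁ =
      MvPolynomial.C (M₂.coeff 0 * M₁.coeff 0 * ((fourierConst d)⁻¹ * c)) := by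
    rw [hp₁, ← symbolOp_mul]
    have hcomm : M₂ * (MvPolynomial.C (fourierConst d)⁻¹ * T) * M₁ =
        M₂ * M₁ * MvPolynomial.C (fourierConst d)⁻¹ * T := by ring
    rw [hcomm, symbolOp_mul, hTR, symbolOp_apply_C]
    congr 1
    simp only [← MvPolynomial.constantCoeff_eq, map_mul, MvPolynomial.constantCoeff_C]
    ring
  have key : ∀ τ, evalReal (symbolOp (momentPoly r fun y => u₁ y * wave (- -ξ) y) p₂) τ =
      wave ξ τ * (M₂.coeff 0 * M₁.coeff 0 * ((fourierConst d)⁻¹ * c)) := by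
    intro τ
    have h₁ := hasSum_integral_mul hu₁c hu₁s (v := fun y => wave ξ y * u₂ (τ - y))
      ((continuous_wave ξ).mul (hu₂c.comp (continuous_const.sub continuous_id)))
      (hneg hu₂s τ).mul_left (hasSum_shiftPairing hR he hc₁)
    have h₂ := hasSum_integral_mul hu₂c hu₂s (v := fun y => wave (-ξ) y * u₁ (τ - y))
      ((continuous_wave (-ξ)).mul (hu₁c.comp (continuous_const.sub continuous_id)))
      (hneg hu₁s τ).mul_left (hasSum_shiftPairing hR he hc₂)
    have h₃ := h₁.unique ((h₂.mul_left (wave ξ τ)).congr_fun fun k => by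
      rw [hξ, integral_sub_latticePt_mul_wave]
      ring)
    rw [integral_evalReal_mul_wave hu₂c hu₂s hjet₂ hp₁r,
      integral_evalReal_mul_wave hu₁c hu₁s hjet₁ hp₂r, hconst, evalReal_C,
      ← mul_assoc (wave ξ τ) (wave (-ξ) τ),
      mul_comm (wave ξ τ) (wave (-ξ) τ), wave_neg_mul, one_mul] at h₃
    exact h₃.symm
  refine mul_ne_zero (mul_ne_zero ?_ ?_) (mul_ne_zero (inv_ne_zero (fourierConst_ne_zero d)) hc)
    (eq_zero_of_evalReal_eq_wave_mul hn key)
  · rwa [hM₂0]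
  · rwa [hM₁0]

end Reproduction

/-! ### Invariant subspaces -/

theorem IsShiftInvariant.inf_ker_symbolOp {V : Submodule ℂ (MvPolynomial (Fin d) ℂ)}
    (hV : IsShiftInvariant V) (T : MvPolynomial (Fin d) ℂ) :
    IsShiftInvariant (V ⊓ LinearMap.ker (symbolOp T)) := by
  intro P hP h
  refine ⟨hV P hP.1 h, ?_⟩
  have h1 := symbolOp_shiftHom T (fun i => algebraMap ℝ ℂ (h i)) P
  rw [LinearMap.mem_ker.1 hP.2, map_zero] at h1
  exact h1

/-- The polynomials with real coefficients in a space of complex polynomials. -/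
def realPart (V : Submodule ℂ (MvPolynomial (Fin d) ℂ)) :
    Submodule ℝ (MvPolynomial (Fin d) ℝ) :=
  (V.restrictScalars ℝ).comap (MvPolynomial.mapAlgHom (Algebra.ofId ℝ ℂ)).toLinearMap

theorem mem_realPart {V : Submodule ℂ (MvPolynomial (Fin d) ℂ)} {P : MvPolynomial (Fin d) ℝ} :
    P ∈ realPart V ↔ MvPolynomial.map Complex.ofRealHom P ∈ V := Iff.rfl

theorem realPart_mono {V V' : Submodule ℂ (MvPolynomial (Fin d) ℂ)} (h : V ≤ V') :
    realPart V ≤ realPart V' := fun _ hP => h hP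

theorem IsShiftInvariant.realPart {V : Submodule ℂ (MvPolynomial (Fin d) ℂ)}
    (hV : IsShiftInvariant V) : IsShiftInvariant (realPart V) := by
  intro P hP h
  rw [mem_realPart, MvPolynomial.map_bind₁]
  have e : (fun i : Fin d => MvPolynomial.map Complex.ofRealHom
      (MvPolynomial.X i + MvPolynomial.C (algebraMap ℝ ℝ (h i)))) =
      fun i => MvPolynomial.X i + MvPolynomial.C (algebraMap ℝ ℂ (h i)) := by
    funext i
    rw [map_add, MvPolynomial.map_X, MvPolynomial.map_C]
    rfl
  rw [e]
  exact hV _ (mem_realPart.1 hP) h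

/-- Scale invariance would put the degree-`k` components of the real and imaginary parts of `S` into
`V`, and with them that of `S`. -/
theorem not_isScaleInvariant_realPart {V : Submodule ℂ (MvPolynomial (Fin d) ℂ)}
    {S : MvPolynomial (Fin d) ℂ} (hS : S ∈ V) (hS' : MvPolynomial.map (starRingEnd ℂ) S ∈ V)
    {k : ℕ} (hk : MvPolynomial.homogeneousComponent k S ∉ V) :
    ¬ IsScaleInvariant (realPart V) := by
  intro hV
  obtain ⟨a, b, ha, hb, rfl⟩ := exists_real_parts_mem hS hS'
  have hcomp : ∀ c : MvPolynomial (Fin d) ℝ, MvPolynomial.homogeneousComponent k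
      (MvPolynomial.map Complex.ofRealHom c) =
      MvPolynomial.map Complex.ofRealHom (MvPolynomial.homogeneousComponent k c) := by
    intro c
    ext x
    simp only [MvPolynomial.coeff_homogeneousComponent, MvPolynomial.coeff_map]
    split_ifs <;> simp
  refine hk ?_
  rw [map_add, map_smul, hcomp, hcomp]
  exact V.add_mem (hV.homogeneousComponent_mem (mem_realPart.2 ha) k)
    (V.smul_mem _ (hV.homogeneousComponent_mem (mem_realPart.2 hb) k))

/-! ### Elliptic scaling functions -/

theorem ne_zero_of_isHomogeneous {k : ℕ} (hk : 1 ≤ k) {X : MvPolynomial (Fin d) ℂ}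
    (hX : X.IsHomogeneous k) (hX0 : X ≠ 0) : d ≠ 0 := by
  rintro rfl
  obtain ⟨a, ha⟩ := MvPolynomial.ne_zero_iff.1 hX0
  have h := hX.degree_eq_of_coeff ha
  rw [Subsingleton.elim a 0, map_zero] at h
  omega

/-- Applying `Aᵀ` to `n` `j` times gives a frequency whose orbit stays in the lattice up to index
`j`; this converts the tail condition at `A^{-T} n` into a statement about the Fourier transform of
index `0`. -/
theorem exists_lattice_preimage {A : Matrix (Fin d) (Fin d) ℤ} (h : (toReal A).det ≠ 0)
    (n : Fin d → ℤ) (j : ℕ) :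
    ∃ n' : Fin d → ℤ, (∀ l ≤ j, ∃ p, act (invT A ^ l) (latticePt n') = latticePt p) ∧
      act (invT A ^ j) (latticePt n') = latticePt n := by
  induction j with
  | zero =>
    refine ⟨n, fun l hl => ⟨n, ?_⟩, ?_⟩
    · rw [Nat.le_zero.1 hl, pow_zero, act_one]
    · rw [pow_zero, act_one]
  | succ j ih =>
    obtain ⟨n', h1, h2⟩ := ih
    have hstep : ∀ l, act (invT A ^ (l + 1)) (latticePt (A.transpose.mulVec n')) =
        act (invT A ^ l) (latticePt n') := fun l => by
      rw [pow_succ, act_mul, ← act_toReal_latticePt, act_invT_transpose h]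
    refine ⟨A.transpose.mulVec n', fun l hl => ?_, by rw [hstep, h2]⟩
    cases l with
    | zero => exact ⟨_, by rw [pow_zero, act_one]⟩
    | succ l =>
      rw [hstep]
      exact h1 l (by omega)

section Elliptic

variable {r : ℕ} {A : Matrix (Fin d) (Fin d) ℤ} {P : MvPolynomial (Fin d) ℂ} {G : ℤ → TrigPoly d}
  {C : ℤ → ℂ} {φ : ℤ → 𝓢'(Space d, ℂ)} {φhat : ℤ → Space d → ℂ}

/-- An elliptic scaling function reproduces the kernel of its symbol, up to the order of
contact. -/
theorem mem_reproduced_of_symbolOp_eq_zero (hdet : (toReal A).det ≠ 0)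
    (hlim : ∀ x : Space d, Tendsto (fun j : ℕ => act (invT A ^ j) x) atTop (𝓝 0))
    (hC : ∀ j, C j ≠ 0)
    (hG : ∀ j, ∀ s ∈ cosetPoints A.transpose \ {0}, trigEval (G j) ((2 * Real.pi) • s) ≠ 0)
    (hexp : ∀ j : ℕ, HasJet r (fun ξ => trigEval (G j) (act (invT A ^ j) ξ))
      (MvPolynomial.C (C j) * P))
    (hφ : IsNonstationaryScaling A (fun j => mask A (G j)) φ φhat)
    {p : MvPolynomial (Fin d) ℂ} (hp : p.totalDegree ≤ r) (hPp : symbolOp P p = 0) :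
    p ∈ reproduced (φ 0) := by
  refine isReproduced_of_hasJet (hφ.fourier 0) (hφ.compact_support 0) hp ?_ fun n hn => ?_
  · rw [hφ.fourier_zero fun j => mask_zero hdet (hG j)]
    exact one_ne_zero
  · obtain ⟨j, hj, hj'⟩ := exists_first_nonlattice hdet hn (hlim _)
    obtain ⟨H, hH, -⟩ := exists_hasJet_fourier hdet hC hG hexp hφ hj hj'
    exact ⟨_, hH, by rw [mul_comm, symbolOp_mul, hPp, map_zero]⟩

/-- If the tails of the infinite product do not all vanish, no polynomial is reproduced that the
symbol maps to a nonzero constant. -/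
theorem notMem_reproduced_of_symbolOp_eq_C (hdet : (toReal A).det ≠ 0)
    (hC : ∀ j, C j ≠ 0)
    (hG : ∀ j, ∀ s ∈ cosetPoints A.transpose \ {0}, trigEval (G j) ((2 * Real.pi) • s) ≠ 0)
    (hexp : ∀ j : ℕ, HasJet r (fun ξ => trigEval (G j) (act (invT A ^ j) ξ))
      (MvPolynomial.C (C j) * P))
    (hφ : IsNonstationaryScaling A (fun j => mask A (G j)) φ φhat)
    (htail : HasNonvanishingTail A φhat)
    {p : MvPolynomial (Fin d) ℂ} (hp : p.totalDegree ≤ r) {c : ℂ} (hc : c ≠ 0)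
    (hPp : symbolOp P p = MvPolynomial.C c) : p ∉ reproduced (φ 0) := by
  obtain ⟨i, n, hi, hn, hne⟩ := htail
  obtain ⟨j, rfl⟩ : ∃ j : ℕ, i = (j + 1 : ℕ) := ⟨(i - 1).toNat, by omega⟩
  obtain ⟨n', hj, hn'⟩ := exists_lattice_preimage hdet n j
  have hv : act (invT A ^ (j + 1)) (latticePt n') = act (invT A) (latticePt n) := by
    rw [act_pow_succ, hn']
  obtain ⟨H, hH, hH0⟩ := exists_hasJet_fourier hdet hC hG hexp hφ hj (by rwa [hv])
  rw [hv] at hH0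
  have hn0 : n' ≠ 0 := by
    rintro rfl
    refine hn 0 ?_
    rw [← hv, latticePt_zero, act_zero]
  refine not_isReproduced_of_hasJet (hφ.fourier 0) (hφ.compact_support 0) hp hn0 hH
    (mul_ne_zero (hH0 hne) hc) ?_
  rw [mul_comm, symbolOp_mul, hPp, symbolOp_apply_C]

end Elliptic

end EllipticScaling

end

open EllipticScaling in
theorem mainTheorem3 {d m k : ℕ} (hm : 1 ≤ m) (hk : 1 ≤ k) (hkm : k ≤ 2 * m - 1)
    -- the isotropic dilation matrix and the quadratic form `W = quadPoly Q`
    (A : Matrix (Fin d) (Fin d) ℤ) (hA : IsDilationMatrix A) (hiso : IsIsotropic (toReal A))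
    (Q U : Matrix (Fin d) (Fin d) ℝ) (hQ : Q.PosDef) (hU : U ∈ Matrix.orthogonalGroup (Fin d) ℝ)
    (hfac : invT A = (|(toReal A).det| ^ (-(1 / (d : ℝ)))) • (Q⁻¹ * U * Q))
    -- the homogeneous polynomial `X`
    (X : MvPolynomial (Fin d) ℂ) (hX : X.IsHomogeneous k) (hX0 : X ≠ 0)
    -- the trigonometric polynomials that define the masks
    (G : ℤ → TrigPoly d) (C : ℤ → ℂ) (hC : ∀ j, C j ≠ 0)
    (hG : ∀ j, ∀ s ∈ cosetPoints A.transpose \ {0}, trigEval (G j) ((2 * Real.pi) • s) ≠ 0)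
    (hexp : ∀ j : ℤ, (fun ξ : EuclideanSpace ℝ (Fin d) => trigEval (G j) (act (invT A ^ j) ξ) -
      C j * (evalReal X ξ + evalReal (quadPoly Q) ξ ^ m)) =O[𝓝 0] fun ξ => ‖ξ‖ ^ (2 * m + 1))
    (hker : ∃ P : MvPolynomial (Fin d) ℂ,
      symbolOp X P = 0 ∧ (symbolOp (quadPoly Q) ^ m) P ≠ 0)
    -- the nonstationary elliptic scaling functions and their Fourier transforms
    (φ : ℤ → 𝓢'(EuclideanSpace ℝ (Fin d), ℂ)) (φhat : ℤ → EuclideanSpace ℝ (Fin d) → ℂ)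
    (hφ : IsNonstationaryScaling A (fun j => mask A (G j)) φ φhat) :
    -- complex polynomials
    (IsShiftInvariant (reproduced (φ 0)) ∧
      (∃ V ≤ reproduced (φ 0), IsShiftInvariant V ∧ ¬ IsScaleInvariant V) ∧
      (HasNonvanishingTail A φhat → ¬ IsScaleInvariant (reproduced (φ 0)))) ∧
    -- real polynomials, if the operator `X(-iD)` has real coefficients
    ((∃ Y : MvPolynomial (Fin d) ℝ,
        X = MvPolynomial.C (Complex.I ^ k) * MvPolynomial.map Complex.ofRealHom Y) →
      IsShiftInvariant (reproducedReal (φ 0)) ∧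
      (∃ V ≤ reproducedReal (φ 0), IsShiftInvariant V ∧ ¬ IsScaleInvariant V) ∧
      (HasNonvanishingTail A φhat → ¬ IsScaleInvariant (reproducedReal (φ 0)))) := by
  have hd : d ≠ 0 := ne_zero_of_isHomogeneous hk hX hX0
  have hdet := hA.det_ne_zero
  have hlim := tendsto_act_invT_pow hA hd hQ hU hfac
  have hF : (quadPoly Q ^ m).IsHomogeneous (2 * m) := (isHomogeneous_quadPoly Q).pow m
  have hjet : ∀ j : ℕ, HasJet (2 * m) (fun ξ => trigEval (G j) (act (invT A ^ j) ξ))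
      (MvPolynomial.C (C j) * (X + quadPoly Q ^ m)) := by
    intro j
    refine (hexp j).congr_left fun ξ => ?_
    rw [evalReal_mul, evalReal_C, evalReal_add, evalReal_pow, zpow_natCast]
  obtain ⟨P, hXP, hWP⟩ := hker
  rw [← symbolOp_pow] at hWP
  obtain ⟨S, hS, hXS, c, hc, -, hcS⟩ :=
    exists_inhomogeneous_solution (by omega) hX hX0 hF hXP hWP
  have hmem : ∀ p : MvPolynomial (Fin d) ℂ, p.totalDegree ≤ 2 * m →
      symbolOp (X + quadPoly Q ^ m) p = 0 → p ∈ reproduced (φ 0) := fun p hp hPp =>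
    mem_reproduced_of_symbolOp_eq_zero hdet hlim hC hG hjet hφ hp hPp
  have hshift := isShiftInvariant_reproduced (φ 0)
  have hnotMem : HasNonvanishingTail A φhat →
      MvPolynomial.homogeneousComponent k S ∉ reproduced (φ 0) := fun htail =>
    notMem_reproduced_of_symbolOp_eq_C hdet hC hG hjet hφ htail
      ((MvPolynomial.homogeneousComponent_isHomogeneous k S).totalDegree_le.trans (by omega)) hc hcS
  -- Intersecting with the kernel excludes the component of `S` by algebra alone, so this part needs
  -- no tail condition.
  set V := reproduced (φ 0) ⊓ LinearMap.ker (symbolOp (X + quadPoly Q ^ m)) with hV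
  have hSV : S ∈ V := ⟨hmem S hS hXS, hXS⟩
  have hRV : MvPolynomial.homogeneousComponent k S ∉ V := fun h => by
    have h0 := LinearMap.mem_ker.1 h.2
    rw [hcS] at h0
    exact hc (MvPolynomial.C_eq_zero.1 h0)
  have hVshift : IsShiftInvariant V := hshift.inf_ker_symbolOp _
  refine ⟨⟨hshift, ⟨V, inf_le_left, hVshift, fun h => hRV (h.homogeneousComponent_mem hSV k)⟩,
    fun htail h => hnotMem htail (h.homogeneousComponent_mem hSV.1 k)⟩, ?_⟩
  rintro ⟨Y, hY⟩
  -- Both `X(-iD)` and `W(-iD)^m` now have real coefficients, so conjugation preserves the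
  -- solutions.
  have hconj : symbolOp (X + quadPoly Q ^ m) (MvPolynomial.map (starRingEnd ℂ) S) = 0 := by
    rw [symbolOp_add, LinearMap.add_apply, symbolOp_I_pow_map_conj hX hY,
      symbolOp_quadPoly_pow_map_conj, ← map_add, ← LinearMap.add_apply, ← symbolOp_add, hXS,
      map_zero]
  have hS' : MvPolynomial.map (starRingEnd ℂ) S ∈ V :=
    ⟨hmem _ ((Finset.sup_mono (MvPolynomial.support_map_subset _ S)).trans hS) hconj, hconj⟩
  exact ⟨hshift.realPart, ⟨realPart V, realPart_mono inf_le_left, hVshift.realPart,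
      not_isScaleInvariant_realPart hSV hS' hRV⟩,
    fun htail => not_isScaleInvariant_realPart hSV.1 hS'.1 (hnotMem htail)⟩
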